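/- **Conventions.** All algebras are associative algebras over $\mathbb C$, not necessarily unital. An algebra $X$ is *non-degenerate* if $xX=0$ implies $x=0$ and $Xx=0$ implies $x=0$; it is *idempotent* if $X=X^2$. Products of subspaces denote linear spans. $M(X)$ is the multiplier algebra of $X$, and $\iota$ is the identity map. **Weak multiplier bialgebras.** A weak multiplier bialgebra is a pair $(A,\Delta)$ of a non-degenerate idempotent algebra $A$ and a homomorphism $\Delta:A\to M(A\otimes A)$ such that: 1. (regular coproduct) $\Delta(a)(1\otimes b)$, $(b\otimes1)\Delta(a)$, $\Delta(a)(b\otimes1)$ and $(1\otimes b)\Delta(a)$ lie in $A\otimes A$, and $(c\otimes1\otimes1)(\Delta\otimes\iota)(\Delta(a)(1\otimes b))=(\iota\otimes\Delta)((c\otimes1)\Delta(a))(1\otimes1\otimes b)$, for all $a,b,c\in A$; 2. (full) if $V,W\subseteq A$ are subspaces with $\Delta(A)(1\otimes A)\subseteq V\otimes A$ and $(A\otimes1)\Delta(A)\subseteq A\otimes W$, then $V=W=A$; 3. there is an idempotent $E\in M(A\otimes A)$, necessarily unique and called the *canonical idempotent*, with $\Delta(A)(A\otimes A)=E(A\otimes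 A)$ and $(A\otimes A)\Delta(A)=(A\otimes A)E$, and it satisfies $(\Delta\otimes\iota)(E)=(E\otimes1)(1\otimes E)=(1\otimes E)(E\otimes1)$, where $\Delta\otimes\iota$ is extended to $M(A\otimes A)$ as the unique homomorphism with $(\Delta\otimes\iota)(m)=(E\otimes1)(\Delta\otimes\iota)(m)=(\Delta\otimes\iota)(m)(E\otimes1)$; 4. there is a *counit*, that is, a linear functional $\varepsilon$ on $A$ (necessarily unique) with $(\varepsilon\otimes\iota)(\Delta(a)(1\otimes b))=ab=(\iota\otimes\varepsilon)((a\otimes1)\Delta(b))$, and it satisfies $\varepsilon(abc)=(\varepsilon\otimes\varepsilon)((a\otimes1)\Delta(b)(1\otimes c))=(\varepsilon\otimes\varepsilon)((1\otimes a)\Delta(b)(c\otimes1))$ for all $a,b,c\in A$. **Regular separability idempotents.** Let $B,C$ be non-degenerate idempotent algebras. An idempotent $F\in M(B\otimes C)$ is a *regular separability idempotent* if - $F(1\otimes c)$, $(1\otimes c)F$, $(b\otimes1)F$, $F(b\otimes1)$ lie in $B\otimes C$ for all $b\in B$, $c\in C$; - $F$ is full, i.e. its left leg is $B$ and its right leg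 is $C$: a subspace $V\subseteq B$ with $F(1\otimes C)\subseteq V\otimes C$, or with $(1\otimes C)F\subseteq V\otimes C$, equals $B$, and a subspace $W\subseteq C$ with $(B\otimes1)F\subseteq B\otimes W$, or with $F(B\otimes1)\subseteq B\otimes W$, equals $C$; - $F(B\otimes1)=F(1\otimes C)$ and $(B\otimes1)F=(1\otimes C)F$. For subalgebras $B,C\subseteq M(A)$ with $BA=AB=A$ and $CA=AC=A$, one regards $M(B\otimes C)$ as a subalgebra of $M(A\otimes A)$. **Proposition 2.3.** Let $(A,\Delta)$ be a weak multiplier bialgebra with canonical idempotent $E$ and counit $\varepsilon$. Then the formulas $$\varepsilon_s(a)=(\iota\otimes\varepsilon)((1\otimes a)E),\qquad \varepsilon_t(a)=(\varepsilon\otimes\iota)(E(a\otimes 1))$$ define linear maps $\varepsilon_s,\varepsilon_t:A\to M(A)$. Their ranges $B=\varepsilon_s(A)$ and $C=\varepsilon_t(A)$ are subalgebras of $M(A)$ with $BA=AB=A$ and $CA=AC=A$. The idempotent $E$ belongs to $M(B\otimes C)$ and is a regular separability idempotent there. Consequently $(A,\Delta)$, $E$, $B$, $C$ satisfy the following conditions,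 which do not involve a counit: $A$ is a non-degenerate idempotent algebra, $\Delta$ is a regular and full coproduct with canonical idempotent $E$, $(\Delta\otimes\iota)(E)=(1\otimes E)(E\otimes1)=(E\otimes1)(1\otimes E)$, the subalgebras $B$ and $C$ of $M(A)$ satisfy $BA=AB=A$ and $CA=AC=A$, and $E$ is a regular separability idempotent in $M(B\otimes C)$. -/

import Mathlib

open scoped TensorProduct

namespace WMB

section Multipliers

/-- The multiplier algebra `M(X)` of a (not necessarily unital) complex algebra `X`, as the unital
algebra of double centralizers: pairs `(L, R)` of linear maps of `X`, to be thought of as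
`L x = m x` and `R x = x m`, such that `L` is a right module map, `R` is a left module map and
`(x m) y = x (m y)`.  The second component lives in the opposite of `End X`, since
`x (m n) = (x m) n`. -/
def multiplierSubalgebra (X : Type*) [NonUnitalRing X] [Module ℂ X] [IsScalarTower ℂ X X]
    [SMulCommClass ℂ X X] : Subalgebra ℂ (Module.End ℂ X × (Module.End ℂ X)ᵐᵒᵖ) where
  carrier := {m | (∀ x y, m.1 (x * y) = m.1 x * y) ∧
    (∀ x y, m.2.unop (x * y) = x * m.2.unop y) ∧
    (∀ x y, m.2.unop x * y = x * m.1 y)}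
  mul_mem' := by
    rintro a b ⟨ha1, ha2, ha3⟩ ⟨hb1, hb2, hb3⟩
    refine ⟨fun x y => ?_, fun x y => ?_, fun x y => ?_⟩
    · simp [ha1, hb1]
    · simp [ha2, hb2]
    · simp [ha3, hb3]
  add_mem' := by
    rintro a b ⟨ha1, ha2, ha3⟩ ⟨hb1, hb2, hb3⟩
    refine ⟨fun x y => ?_, fun x y => ?_, fun x y => ?_⟩
    · simp [ha1, hb1, add_mul]
    · simp [ha2, hb2, mul_add]
    · simp [ha3, hb3, add_mul, mul_add]
  algebraMap_mem' := by
    intro r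
    refine ⟨fun x y => ?_, fun x y => ?_, fun x y => ?_⟩
    · simp [smul_mul_assoc]
    · simp [mul_smul_comm]
    · simp [smul_mul_assoc, mul_smul_comm]

/-- The multiplier algebra `M(X)`. -/
def Multiplier (X : Type*) [NonUnitalRing X] [Module ℂ X] [IsScalarTower ℂ X X]
    [SMulCommClass ℂ X X] : Type _ :=
  multiplierSubalgebra X

variable {X Y : Type*} [NonUnitalRing X] [Module ℂ X] [IsScalarTower ℂ X X] [SMulCommClass ℂ X X]
  [NonUnitalRing Y] [Module ℂ Y] [IsScalarTower ℂ Y Y] [SMulCommClass ℂ Y Y]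

noncomputable instance : Ring (Multiplier X) := inferInstanceAs (Ring (multiplierSubalgebra X))

noncomputable instance : Algebra ℂ (Multiplier X) :=
  inferInstanceAs (Algebra ℂ (multiplierSubalgebra X))

/-- Left multiplication `x ↦ m x` by a multiplier `m`. -/
def lact (m : Multiplier X) : X →ₗ[ℂ] X := m.1.1

/-- Right multiplication `x ↦ x m` by a multiplier `m`. -/
def ract (m : Multiplier X) : X →ₗ[ℂ] X := m.1.2.unop

/-- The canonical embedding `X → M(X)`, sending `a` to the pair of maps `x ↦ a x` and `x ↦ x a`;
it is a homomorphism, and injective if `X` is non-degenerate. -/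
def embed (a : X) : Multiplier X :=
  (⟨(LinearMap.mulLeft ℂ a, MulOpposite.op (LinearMap.mulRight ℂ a)),
    fun x y => by simp [mul_assoc], fun x y => by simp [mul_assoc],
    fun x y => by simp [mul_assoc]⟩ : multiplierSubalgebra X)

/-- The canonical embedding `X → M(X)` as a linear map. -/
noncomputable def embedLin : X →ₗ[ℂ] Multiplier X where
  toFun := embed
  map_add' a b := by
    apply Subtype.ext
    refine Prod.ext (LinearMap.ext fun x => ?_)
      (MulOpposite.unop_injective (LinearMap.ext fun x => ?_))
    · exact add_mul a b x
    · exact mul_add x a b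
  map_smul' c a := by
    apply Subtype.ext
    refine Prod.ext (LinearMap.ext fun x => ?_)
      (MulOpposite.unop_injective (LinearMap.ext fun x => ?_))
    · exact smul_mul_assoc c a x
    · exact mul_smul_comm c x a

/-- The multiplier `m ⊗ n` of `X ⊗ Y`, for multipliers `m` of `X` and `n` of `Y`. -/
noncomputable def mtmul (m : Multiplier X) (n : Multiplier Y) : Multiplier (X ⊗[ℂ] Y) :=
  (⟨(TensorProduct.map (lact m) (lact n), MulOpposite.op (TensorProduct.map (ract m) (ract n))), by
    obtain ⟨⟨mL, mR⟩, hm1, hm2, hm3⟩ := m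
    obtain ⟨⟨nL, nR⟩, hn1, hn2, hn3⟩ := n
    dsimp only at hm1 hm2 hm3 hn1 hn2 hn3
    refine ⟨fun x y => ?_, fun x y => ?_, fun x y => ?_⟩ <;>
    · induction x using TensorProduct.induction_on with
      | zero => simp
      | add x x' hx hx' =>
        simp only [add_mul, map_add, MulOpposite.unop_op] at hx hx' ⊢
        rw [hx, hx']
      | tmul x x' =>
        induction y using TensorProduct.induction_on with
        | zero => simp
        | add y y' hy hy' =>
          simp only [mul_add, map_add, MulOpposite.unop_op] at hy hy' ⊢
          rw [hy, hy']
        | tmul y y' =>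
          simp [lact, ract, hm1, hm2, hm3, hn1, hn2, hn3]⟩ :
    multiplierSubalgebra (X ⊗[ℂ] Y))

/-- The map `(m, n) ↦ m ⊗ n` as a bilinear map. -/
noncomputable def mtmulBilin : Multiplier X →ₗ[ℂ] Multiplier Y →ₗ[ℂ] Multiplier (X ⊗[ℂ] Y) :=
  LinearMap.mk₂ ℂ mtmul
    (fun m m' n => Subtype.ext (Prod.ext (TensorProduct.map_add_left (lact m) (lact m') (lact n))
      (MulOpposite.unop_injective (TensorProduct.map_add_left (ract m) (ract m') (ract n)))))
    (fun c m n => Subtype.ext (Prod.ext (TensorProduct.map_smul_left c (lact m) (lact n))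
      (MulOpposite.unop_injective (TensorProduct.map_smul_left c (ract m) (ract n)))))
    (fun m n n' => Subtype.ext (Prod.ext (TensorProduct.map_add_right (lact m) (lact n) (lact n'))
      (MulOpposite.unop_injective (TensorProduct.map_add_right (ract m) (ract n) (ract n')))))
    (fun c m n => Subtype.ext (Prod.ext (TensorProduct.map_smul_right c (lact m) (lact n))
      (MulOpposite.unop_injective (TensorProduct.map_smul_right c (ract m) (ract n)))))

/-- Transport of multipliers along a multiplicative linear equivalence. -/
noncomputable def Multiplier.transport (e : X ≃ₗ[ℂ] Y) (he : ∀ x y, e (x * y) = e x * e y)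
    (m : Multiplier X) : Multiplier Y :=
  (⟨(e.conj (lact m), MulOpposite.op (e.conj (ract m))), by
    have he' : ∀ x y, e.symm (x * y) = e.symm x * e.symm y := fun x y => by
      apply e.injective; simp [he]
    obtain ⟨⟨mL, mR⟩, hm1, hm2, hm3⟩ := m
    dsimp only at hm1 hm2 hm3
    refine ⟨fun x y => ?_, fun x y => ?_, fun x y => ?_⟩
    · simp [LinearEquiv.conj_apply, lact, he', hm1, he]
    · simp [LinearEquiv.conj_apply, ract, he', hm2, he]
    · have h := congrArg e (hm3 (e.symm x) (e.symm y))
      simpa [LinearEquiv.conj_apply, lact, ract, he] using h⟩ : multiplierSubalgebra Y)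

theorem assoc_symm_mul (x y : X ⊗[ℂ] (X ⊗[ℂ] X)) :
    (TensorProduct.assoc ℂ X X X).symm (x * y) =
      (TensorProduct.assoc ℂ X X X).symm x * (TensorProduct.assoc ℂ X X X).symm y := by
  have key : ∀ a b c (y : X ⊗[ℂ] (X ⊗[ℂ] X)),
      (TensorProduct.assoc ℂ X X X).symm ((a ⊗ₜ (b ⊗ₜ c)) * y) =
        (TensorProduct.assoc ℂ X X X).symm (a ⊗ₜ (b ⊗ₜ c)) *
          (TensorProduct.assoc ℂ X X X).symm y := by
    intro a b c y
    induction y using TensorProduct.induction_on with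
    | zero => simp
    | add y y' hy hy' => simp only [mul_add, map_add, hy, hy']
    | tmul p q =>
      induction q using TensorProduct.induction_on with
      | zero => simp
      | add q q' hq hq' => simp only [TensorProduct.tmul_add, mul_add, map_add, hq, hq']
      | tmul q r => simp
  induction x using TensorProduct.induction_on with
  | zero => simp
  | add x x' hx hx' => simp only [add_mul, map_add, hx, hx']
  | tmul a u =>
    induction u using TensorProduct.induction_on with
    | zero => simp
    | add u u' hu hu' => simp only [TensorProduct.tmul_add, add_mul, map_add, hu, hu']
    | tmul b c => exact key a b c y

/-- The identification of `M(X ⊗ (X ⊗ X))` with `M((X ⊗ X) ⊗ X)`. -/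
noncomputable def reassoc (m : Multiplier (X ⊗[ℂ] (X ⊗[ℂ] X))) :
    Multiplier ((X ⊗[ℂ] X) ⊗[ℂ] X) :=
  Multiplier.transport (TensorProduct.assoc ℂ X X X).symm assoc_symm_mul m

/-- The product of `X` is non-degenerate as a bilinear map. -/
def IsNondegenerate (X : Type*) [NonUnitalRing X] : Prop :=
  (∀ x : X, (∀ y, x * y = 0) → x = 0) ∧ (∀ x : X, (∀ y, y * x = 0) → x = 0)

/-- `X = X²`: every element of `X` is a sum of products. -/
def IsIdempotentAlg (X : Type*) [NonUnitalRing X] [Module ℂ X] : Prop :=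
  Submodule.span ℂ {z : X | ∃ x y, z = x * y} = ⊤

/-- The image of `V ⊗ Y` in `X ⊗ Y`, for a subspace `V` of `X`. -/
noncomputable def leftSub (V : Submodule ℂ X) (Y : Type*) [NonUnitalRing Y] [Module ℂ Y] :
    Submodule ℂ (X ⊗[ℂ] Y) :=
  LinearMap.range (V.subtype.rTensor Y)

/-- The image of `X ⊗ W` in `X ⊗ Y`, for a subspace `W` of `Y`. -/
noncomputable def rightSub (X : Type*) [NonUnitalRing X] [Module ℂ X] (W : Submodule ℂ Y) :
    Submodule ℂ (X ⊗[ℂ] Y) :=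
  LinearMap.range (W.subtype.lTensor X)

end Multipliers

section Slices

variable {A : Type*} [NonUnitalRing A] [Module ℂ A]

/-- The slice map `ω ⊗ ι : A ⊗ A → A`. -/
noncomputable def sliceLeft (ω : A →ₗ[ℂ] ℂ) : A ⊗[ℂ] A →ₗ[ℂ] A :=
  (TensorProduct.lid ℂ A).toLinearMap ∘ₗ ω.rTensor A

/-- The slice map `ι ⊗ ω : A ⊗ A → A`. -/
noncomputable def sliceRight (ω : A →ₗ[ℂ] ℂ) : A ⊗[ℂ] A →ₗ[ℂ] A :=
  (TensorProduct.rid ℂ A).toLinearMap ∘ₗ ω.lTensor A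

/-- The functional `ω ⊗ ω : A ⊗ A → ℂ`. -/
noncomputable def sliceBoth (ω : A →ₗ[ℂ] ℂ) : A ⊗[ℂ] A →ₗ[ℂ] ℂ :=
  ω ∘ₗ sliceLeft ω

end Slices

section WeakMultiplierBialgebra

variable {A : Type*} [NonUnitalRing A] [Module ℂ A] [IsScalarTower ℂ A A] [SMulCommClass ℂ A A]

/-- The map `Δ ⊗ ι` from `A ⊗ A` to `M(A ⊗ A ⊗ A)`, `a ⊗ b ↦ Δ(a) ⊗ b`. -/
noncomputable def deltaId (Δ : A →ₙₐ[ℂ] Multiplier (A ⊗[ℂ] A)) :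
    A ⊗[ℂ] A →ₗ[ℂ] Multiplier ((A ⊗[ℂ] A) ⊗[ℂ] A) :=
  TensorProduct.lift (mtmulBilin.compl₁₂ (Δ : A →ₗ[ℂ] Multiplier (A ⊗[ℂ] A))
    embedLin)

/-- The map `ι ⊗ Δ` from `A ⊗ A` to `M(A ⊗ A ⊗ A)`, `a ⊗ b ↦ a ⊗ Δ(b)`. -/
noncomputable def idDelta (Δ : A →ₙₐ[ℂ] Multiplier (A ⊗[ℂ] A)) :
    A ⊗[ℂ] A →ₗ[ℂ] Multiplier (A ⊗[ℂ] (A ⊗[ℂ] A)) :=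
  TensorProduct.lift (mtmulBilin.compl₁₂ embedLin
    (Δ : A →ₗ[ℂ] Multiplier (A ⊗[ℂ] A)))

/-- A regular coproduct on `A`: a homomorphism `Δ : A → M(A ⊗ A)` such that `Δ(a)(1 ⊗ b)`,
`(b ⊗ 1)Δ(a)`, `Δ(a)(b ⊗ 1)` and `(1 ⊗ b)Δ(a)` lie in `A ⊗ A`, and which is coassociative:
`(c ⊗ 1 ⊗ 1)(Δ ⊗ ι)(Δ(a)(1 ⊗ b)) = (ι ⊗ Δ)((c ⊗ 1)Δ(a))(1 ⊗ 1 ⊗ b)`. -/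
structure IsRegularCoproduct (Δ : A →ₙₐ[ℂ] Multiplier (A ⊗[ℂ] A)) : Prop where
  mem₁ : ∀ a b, ∃ t, embed t = Δ a * mtmul 1 (embed b)
  mem₂ : ∀ a b, ∃ t, embed t = mtmul (embed b) 1 * Δ a
  mem₃ : ∀ a b, ∃ t, embed t = Δ a * mtmul (embed b) 1
  mem₄ : ∀ a b, ∃ t, embed t = mtmul 1 (embed b) * Δ a
  coassoc : ∀ a b c s t,
    embed s = Δ a * mtmul 1 (embed b) → embed t = mtmul (embed c) 1 * Δ a →
      mtmul (mtmul (embed c) 1) 1 * deltaId Δ s =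
        reassoc (idDelta Δ t) * mtmul 1 (embed b)

/-- The coproduct is full: if `V`, `W` are subspaces of `A` with `Δ(A)(1 ⊗ A) ⊆ V ⊗ A` and
`(A ⊗ 1)Δ(A) ⊆ A ⊗ W`, then `V = A` and `W = A`. -/
def IsFull (Δ : A →ₙₐ[ℂ] Multiplier (A ⊗[ℂ] A)) : Prop :=
  ∀ V W : Submodule ℂ A,
    (∀ a b, ∃ t ∈ leftSub V A, embed t = Δ a * mtmul 1 (embed b)) →
    (∀ a b, ∃ t ∈ rightSub A W, embed t = mtmul (embed b) 1 * Δ a) →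
    V = ⊤ ∧ W = ⊤

/-- `E` is a canonical idempotent for `Δ`: an idempotent in `M(A ⊗ A)` with
`Δ(A)(A ⊗ A) = E(A ⊗ A)` and `(A ⊗ A)Δ(A) = (A ⊗ A)E` (products of spaces are linear spans). -/
structure IsCanonicalIdempotent (Δ : A →ₙₐ[ℂ] Multiplier (A ⊗[ℂ] A))
    (E : Multiplier (A ⊗[ℂ] A)) : Prop where
  idem : E * E = E
  range_left : Submodule.span ℂ {z | ∃ a x, z = lact (Δ a) x} = LinearMap.range (lact E)
  range_right : Submodule.span ℂ {z | ∃ a x, z = ract (Δ a) x} = LinearMap.range (ract E)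

/-- `X` is the value at `m ∈ M(A ⊗ A)` of the extension of `Δ ⊗ ι` to `M(A ⊗ A)`, normalised by
`(E ⊗ 1)X = X = X(E ⊗ 1)`.  Multiplicativity of the extension says that
`X (Δ ⊗ ι)(u) = (Δ ⊗ ι)(mu)` and `(Δ ⊗ ι)(u) X = (Δ ⊗ ι)(um)` for `u ∈ A ⊗ A`; since
`Δ(A)(A ⊗ A) = E(A ⊗ A)` and `(A ⊗ A)Δ(A) = (A ⊗ A)E`, these conditions determine `X`. -/
structure IsDeltaIdExtension (Δ : A →ₙₐ[ℂ] Multiplier (A ⊗[ℂ] A)) (E m : Multiplier (A ⊗[ℂ] A))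
    (X : Multiplier ((A ⊗[ℂ] A) ⊗[ℂ] A)) : Prop where
  mul_delta : ∀ u, X * deltaId Δ u = deltaId Δ (lact m u)
  delta_mul : ∀ u, deltaId Δ u * X = deltaId Δ (ract m u)
  left_corner : mtmul E 1 * X = X
  right_corner : X * mtmul E 1 = X

/-- Weak comultiplicativity of the unit:
`(Δ ⊗ ι)(E) = (E ⊗ 1)(1 ⊗ E) = (1 ⊗ E)(E ⊗ 1)` in `M(A ⊗ A ⊗ A)`. -/
structure IsWeaklyComultiplicative (Δ : A →ₙₐ[ℂ] Multiplier (A ⊗[ℂ] A))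
    (E : Multiplier (A ⊗[ℂ] A)) : Prop where
  delta_eq : IsDeltaIdExtension Δ E E (mtmul E 1 * reassoc (mtmul 1 E))
  comm : mtmul E 1 * reassoc (mtmul 1 E) = reassoc (mtmul 1 E) * mtmul E 1

/-- `ε` is a counit: `(ε ⊗ ι)(Δ(a)(1 ⊗ b)) = ab` and `(ι ⊗ ε)((a ⊗ 1)Δ(b)) = ab`. -/
structure IsCounit (Δ : A →ₙₐ[ℂ] Multiplier (A ⊗[ℂ] A)) (ε : A →ₗ[ℂ] ℂ) : Prop where
  left : ∀ a b t, embed t = Δ a * mtmul 1 (embed b) → sliceLeft ε t = a * b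
  right : ∀ a b t, embed t = mtmul (embed a) 1 * Δ b → sliceRight ε t = a * b

/-- The counit is weakly multiplicative: `ε(abc) = (ε ⊗ ε)((a ⊗ 1)Δ(b)(1 ⊗ c))` and
`ε(abc) = (ε ⊗ ε)((1 ⊗ a)Δ(b)(c ⊗ 1))`. -/
structure IsWeaklyMultiplicative (Δ : A →ₙₐ[ℂ] Multiplier (A ⊗[ℂ] A)) (ε : A →ₗ[ℂ] ℂ) :
    Prop where
  first : ∀ a b c t, embed t = mtmul (embed a) 1 * Δ b * mtmul 1 (embed c) →
    ε (a * b * c) = sliceBoth ε t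
  second : ∀ a b c t, embed t = mtmul 1 (embed a) * Δ b * mtmul (embed c) 1 →
    ε (a * b * c) = sliceBoth ε t

/-- A weak multiplier bialgebra `(A, Δ)` (with regular and full coproduct). -/
structure IsWeakMultiplierBialgebra (Δ : A →ₙₐ[ℂ] Multiplier (A ⊗[ℂ] A)) : Prop where
  nondegenerate : IsNondegenerate A
  idempotent : IsIdempotentAlg A
  coproduct : IsRegularCoproduct Δ
  full : IsFull Δ
  canonical : ∃ E, IsCanonicalIdempotent Δ E ∧ IsWeaklyComultiplicative Δ E
  counit : ∃ ε, IsCounit Δ ε ∧ IsWeaklyMultiplicative Δ ε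

/-- `εs : A → M(A)` is the source counital map `a ↦ (ι ⊗ ε)((1 ⊗ a)E)`; the right-hand side is
the multiplier `m` with `x m = (ι ⊗ ε)((x ⊗ a)E)` for all `x ∈ A`. -/
def IsSourceMap (E : Multiplier (A ⊗[ℂ] A)) (ε : A →ₗ[ℂ] ℂ) (εs : A →ₗ[ℂ] Multiplier A) : Prop :=
  ∀ a x, ract (εs a) x = sliceRight ε (ract E (x ⊗ₜ a))

/-- `εt : A → M(A)` is the target counital map `a ↦ (ε ⊗ ι)(E(a ⊗ 1))`; the right-hand side is
the multiplier `m` with `m x = (ε ⊗ ι)(E(a ⊗ x))` for all `x ∈ A`. -/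
def IsTargetMap (E : Multiplier (A ⊗[ℂ] A)) (ε : A →ₗ[ℂ] ℂ) (εt : A →ₗ[ℂ] Multiplier A) : Prop :=
  ∀ a x, lact (εt a) x = sliceLeft ε (lact E (a ⊗ₜ x))

end WeakMultiplierBialgebra

section Separability

/-- A regular separability idempotent `F ∈ M(B ⊗ C)`, for non-degenerate idempotent algebras
`B` and `C`. -/
structure IsRegularSeparabilityIdempotent {B C : Type*} [NonUnitalRing B] [Module ℂ B]
    [IsScalarTower ℂ B B] [SMulCommClass ℂ B B] [NonUnitalRing C] [Module ℂ C]
    [IsScalarTower ℂ C C] [SMulCommClass ℂ C C] (F : Multiplier (B ⊗[ℂ] C)) : Prop where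
  nondegenerate_left : IsNondegenerate B
  nondegenerate_right : IsNondegenerate C
  idempotent_left : IsIdempotentAlg B
  idempotent_right : IsIdempotentAlg C
  idem : F * F = F
  mem₁ : ∀ c : C, ∃ t, embed t = F * mtmul 1 (embed c)
  mem₂ : ∀ b : B, ∃ t, embed t = mtmul (embed b) 1 * F
  mem₃ : ∀ c : C, ∃ t, embed t = mtmul 1 (embed c) * F
  mem₄ : ∀ b : B, ∃ t, embed t = F * mtmul (embed b) 1
  /-- The left leg of `F`, the smallest `V` with `F(1 ⊗ C) ⊆ V ⊗ C`, is `B`. -/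
  left_leg : ∀ V : Submodule ℂ B,
    (∀ c : C, ∃ t ∈ leftSub V C, embed t = F * mtmul 1 (embed c)) → V = ⊤
  /-- The same, with the factor on the other side: `(1 ⊗ C)F ⊆ V ⊗ C`. -/
  left_leg' : ∀ V : Submodule ℂ B,
    (∀ c : C, ∃ t ∈ leftSub V C, embed t = mtmul 1 (embed c) * F) → V = ⊤
  /-- The right leg of `F`, the smallest `W` with `(B ⊗ 1)F ⊆ B ⊗ W`, is `C`. -/
  right_leg : ∀ W : Submodule ℂ C,
    (∀ b : B, ∃ t ∈ rightSub B W, embed t = mtmul (embed b) 1 * F) → W = ⊤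
  /-- The same, with the factor on the other side: `F(B ⊗ 1) ⊆ B ⊗ W`. -/
  right_leg' : ∀ W : Submodule ℂ C,
    (∀ b : B, ∃ t ∈ rightSub B W, embed t = F * mtmul (embed b) 1) → W = ⊤
  /-- `F(B ⊗ 1) = F(1 ⊗ C)`. -/
  sep_left : Set.range (fun b : B => F * mtmul (embed b) (1 : Multiplier C)) =
    Set.range (fun c : C => F * mtmul (1 : Multiplier B) (embed c))
  /-- `(B ⊗ 1)F = (1 ⊗ C)F`. -/
  sep_right : Set.range (fun b : B => mtmul (embed b) (1 : Multiplier C) * F) =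
    Set.range (fun c : C => mtmul (1 : Multiplier B) (embed c) * F)

variable {A : Type*} [NonUnitalRing A] [Module ℂ A] [IsScalarTower ℂ A A] [SMulCommClass ℂ A A]

/-- The subalgebra `B` of `M(A)` sits in `M(A)` in a non-degenerate way: `BA = A = AB`. -/
def IsNondegSubalgebra (B : NonUnitalSubalgebra ℂ (Multiplier A)) : Prop :=
  Submodule.span ℂ {z | ∃ b ∈ B, ∃ x, z = lact b x} = ⊤ ∧
    Submodule.span ℂ {z | ∃ b ∈ B, ∃ x, z = ract b x} = ⊤

/-- The inclusion `B ⊗ C → M(A ⊗ A)` for subalgebras `B`, `C` of `M(A)`. -/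
noncomputable def inclTensor (B C : NonUnitalSubalgebra ℂ (Multiplier A)) :
    B ⊗[ℂ] C →ₗ[ℂ] Multiplier (A ⊗[ℂ] A) :=
  TensorProduct.lift (mtmulBilin.compl₁₂ B.toSubmodule.subtype C.toSubmodule.subtype)

/-- `E ∈ M(A ⊗ A)` is the element of `M(A ⊗ A)` that corresponds to `F ∈ M(B ⊗ C)` under the
embedding `M(B ⊗ C) ⊆ M(A ⊗ A)` extending `B ⊗ C ⊆ M(A ⊗ A)`. -/
def IsImageOf (B C : NonUnitalSubalgebra ℂ (Multiplier A)) (E : Multiplier (A ⊗[ℂ] A))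
    (F : Multiplier (B ⊗[ℂ] C)) : Prop :=
  (∀ x, E * inclTensor B C x = inclTensor B C (lact F x)) ∧
    (∀ x, inclTensor B C x * E = inclTensor B C (ract F x))

/-- `E ∈ M(A ⊗ A)` is a regular separability idempotent in `M(B ⊗ C)`, where `B` and `C` are
subalgebras of `M(A)` sitting in `M(A)` in a non-degenerate way. -/
structure IsRegularSeparabilityIdempotentIn (B C : NonUnitalSubalgebra ℂ (Multiplier A))
    (E : Multiplier (A ⊗[ℂ] A)) : Prop where
  nondeg_left : IsNondegSubalgebra B
  nondeg_right : IsNondegSubalgebra C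
  separability : ∃ F : Multiplier (B ⊗[ℂ] C),
    IsImageOf B C E F ∧ IsRegularSeparabilityIdempotent F

/-- The setting of a counit-free Larson–Sweedler theorem: a non-degenerate idempotent algebra with
a regular full coproduct, whose canonical idempotent `E` exists, satisfies
`(Δ ⊗ ι)(E) = (1 ⊗ E)(E ⊗ 1) = (E ⊗ 1)(1 ⊗ E)` and is a regular separability idempotent in
`M(B ⊗ C)`. -/
structure IsSeparableFramework (Δ : A →ₙₐ[ℂ] Multiplier (A ⊗[ℂ] A))
    (E : Multiplier (A ⊗[ℂ] A)) (B C : NonUnitalSubalgebra ℂ (Multiplier A)) : Prop where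
  nondegenerate : IsNondegenerate A
  idempotent : IsIdempotentAlg A
  coproduct : IsRegularCoproduct Δ
  full : IsFull Δ
  canonical : IsCanonicalIdempotent Δ E
  comultiplicative : IsWeaklyComultiplicative Δ E
  separability : IsRegularSeparabilityIdempotentIn B C E

end Separability

end WMB

/-!
Both the canonical idempotent and the counit of a weak multiplier bialgebra are unique, so the
axioms may be used for the given `E` and `ε` (`IsWeakMultiplierBialgebra.isWeakBialgebraWith`).
The proof has to manufacture, from slices of `E` by `ε`, the algebras `B` and `C`, and to see that
`E` lives over them.

The formula for `(Δ ⊗ ι)(E)` says that `(Δ ⊗ ι)(Eu) = (1 ⊗ E)(Δ ⊗ ι)(u)`. Coassociativity turns it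
into the mirror formula `(ι ⊗ Δ)(Eu) = (E ⊗ 1)(ι ⊗ Δ)(u)` (`idDeltaAssoc_lact`), which is not among
the axioms; both hold also for right multiplication by `E`. On the other hand weak multiplicativity
of the counit gives `(ε ⊗ ι)(Δ(x)u) = x (ε ⊗ ι)(Eu)` and three mirror images
(`sliceLeft_lact_delta`). These say that the four slices `(ε ⊗ ι)(E(a ⊗ 1))`, `(ε ⊗ ι)((a ⊗ 1)E)`,
`(ι ⊗ ε)((1 ⊗ a)E)`, `(ι ⊗ ε)(E(1 ⊗ a))` are multipliers: the counital maps `target`, `target'`,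
`source`, `source'`.

Applying `ι ⊗ ε ⊗ ι` to the formulas for `ι ⊗ Δ` and `Δ ⊗ ι` yields
`E(1 ⊗ (ε ⊗ ι)(v)) = (ι ⊗ ε ⊗ ι)((E ⊗ 1)(1 ⊗ v))` for `v ∈ E(A ⊗ A)`, with mirror images
(`lact_tmul_sliceLeft`). Since `E ⊗ 1` and `1 ⊗ E` commute, this produces the product formulas
that make the ranges `B` and `C` of `source` and `target` subalgebras (`source_mul_source`,
`target_mul_target`), and the separability relations `E(1 ⊗ target a) = E(source' a ⊗ 1)` and
`(source a ⊗ 1)E = (1 ⊗ target' a)E`. Together with the counit property it produces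
`E(1 ⊗ ab) = (source' ⊗ ι)(Δ(a)(1 ⊗ b))` and
`E(1 ⊗ target (ab)) = (source' ⊗ target)(Δ(a)(1 ⊗ b))`.

Fullness of `Δ` now shows that every subspace of `M(A)` containing the first legs of
`(1 ⊗ A)E(1 ⊗ A)` contains the ranges of both `source` and `source'` (`range_source_le`). So these
two maps have the same range `B`, which is the left leg of `E`; similarly for `C`. In particular
`E(B ⊗ C) ⊆ B ⊗ C` and `(B ⊗ C)E ⊆ B ⊗ C`, and `E` is a multiplier of `B ⊗ C`. As `M(B ⊗ C)` embeds
multiplicatively and injectively in `M(A ⊗ A)`, its separability is verified there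
(`IsImageOf.isRegularSeparabilityIdempotent`).
-/

namespace WMB

/-! ### Non-degenerate algebras and their multipliers -/

section JointKernel

/-- If the maps `fᵢ` have trivial joint kernel, then so have the maps `fᵢ ⊗ ι`. The index set may be
infinite, so that this does not follow from flatness; it holds because `W` is free. -/
theorem joint_rTensor {ι V V' W : Type*} [AddCommGroup V] [Module ℂ V] [AddCommGroup V']
    [Module ℂ V'] [AddCommGroup W] [Module ℂ W] (f : ι → V →ₗ[ℂ] V')
    (hf : ∀ v, (∀ i, f i v = 0) → v = 0) (t : V ⊗[ℂ] W)
    (ht : ∀ i, (f i).rTensor W t = 0) : t = 0 := by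
  classical
  let b := Module.Basis.ofVectorSpace ℂ W
  have key : ∀ i (t : V ⊗[ℂ] W) j,
      TensorProduct.equivFinsuppOfBasisRight b ((f i).rTensor W t) j =
        f i (TensorProduct.equivFinsuppOfBasisRight b t j) := by
    intro i t j
    induction t using TensorProduct.induction_on with
    | zero => simp
    | add x y hx hy => simp only [map_add, Finsupp.add_apply, hx, hy]
    | tmul v w => simp
  apply (TensorProduct.equivFinsuppOfBasisRight b).injective
  rw [map_zero]
  ext j
  refine hf _ fun i => ?_
  rw [← key, ht, map_zero]
  rfl

theorem joint_lTensor {ι V V' W : Type*} [AddCommGroup V] [Module ℂ V] [AddCommGroup V']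
    [Module ℂ V'] [AddCommGroup W] [Module ℂ W] (f : ι → V →ₗ[ℂ] V')
    (hf : ∀ v, (∀ i, f i v = 0) → v = 0) (t : W ⊗[ℂ] V)
    (ht : ∀ i, (f i).lTensor W t = 0) : t = 0 := by
  apply (TensorProduct.comm ℂ W V).injective
  rw [map_zero]
  refine joint_rTensor f hf _ fun i => ?_
  have key : ∀ t : W ⊗[ℂ] V, (f i).rTensor W (TensorProduct.comm ℂ W V t) =
      TensorProduct.comm ℂ W V' ((f i).lTensor W t) := by
    intro t
    induction t using TensorProduct.induction_on with
    | zero => simp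
    | add x y hx hy => simp only [map_add, hx, hy]
    | tmul v w => simp
  rw [key, ht, map_zero]

end JointKernel

section Multipliers

variable {X Y : Type*} [NonUnitalRing X] [Module ℂ X] [IsScalarTower ℂ X X] [SMulCommClass ℂ X X]
  [NonUnitalRing Y] [Module ℂ Y] [IsScalarTower ℂ Y Y] [SMulCommClass ℂ Y Y]

theorem Multiplier.ext {m n : Multiplier X} (h₁ : ∀ x, lact m x = lact n x)
    (h₂ : ∀ x, ract m x = ract n x) : m = n :=
  Subtype.ext (Prod.ext (LinearMap.ext h₁) (MulOpposite.unop_injective (LinearMap.ext h₂)))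

theorem lact_apply_mul (m : Multiplier X) (x y : X) : lact m (x * y) = lact m x * y := m.2.1 x y

theorem ract_apply_mul (m : Multiplier X) (x y : X) : ract m (x * y) = x * ract m y := m.2.2.1 x y

theorem ract_mul_eq (m : Multiplier X) (x y : X) : ract m x * y = x * lact m y := m.2.2.2 x y

/-- Left multiplication by multipliers, as a linear map. -/
noncomputable def lactLin : Multiplier X →ₗ[ℂ] X →ₗ[ℂ] X where
  toFun := lact
  map_add' _ _ := rfl
  map_smul' _ _ := rfl

/-- Right multiplication by multipliers, as a linear map. -/
noncomputable def ractLin : Multiplier X →ₗ[ℂ] X →ₗ[ℂ] X where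
  toFun := ract
  map_add' _ _ := rfl
  map_smul' _ _ := rfl

@[simp] theorem lactLin_apply (m : Multiplier X) : lactLin m = lact m := rfl

@[simp] theorem ractLin_apply (m : Multiplier X) : ractLin m = ract m := rfl

@[simp] theorem lact_one : lact (1 : Multiplier X) = LinearMap.id := rfl

@[simp] theorem ract_one : ract (1 : Multiplier X) = LinearMap.id := rfl

@[simp] theorem lact_mul (m n : Multiplier X) (x : X) : lact (m * n) x = lact m (lact n x) := rfl

@[simp] theorem ract_mul (m n : Multiplier X) (x : X) : ract (m * n) x = ract n (ract m x) := rfl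

@[simp] theorem lact_zero (x : X) : lact (0 : Multiplier X) x = 0 := rfl

@[simp] theorem ract_zero (x : X) : ract (0 : Multiplier X) x = 0 := rfl

@[simp] theorem lact_add (m n : Multiplier X) (x : X) : lact (m + n) x = lact m x + lact n x := rfl

@[simp] theorem ract_add (m n : Multiplier X) (x : X) : ract (m + n) x = ract m x + ract n x := rfl

@[simp] theorem lact_embed (a x : X) : lact (embed a) x = a * x := rfl

@[simp] theorem ract_embed (a x : X) : ract (embed a) x = x * a := rfl

@[simp] theorem embedLin_apply (a : X) : embedLin a = embed a := rfl

@[simp] theorem lact_mtmul (m : Multiplier X) (n : Multiplier Y) :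
    lact (mtmul m n) = TensorProduct.map (lact m) (lact n) := rfl

@[simp] theorem ract_mtmul (m : Multiplier X) (n : Multiplier Y) :
    ract (mtmul m n) = TensorProduct.map (ract m) (ract n) := rfl

@[simp] theorem mtmulBilin_apply (m : Multiplier X) (n : Multiplier Y) :
    mtmulBilin m n = mtmul m n := rfl

theorem mul_embed (m : Multiplier X) (x : X) : m * embed x = embed (lact m x) :=
  Multiplier.ext (fun y => by simp [lact_apply_mul]) (fun y => by simp [ract_mul_eq])

theorem embed_mul_multiplier (m : Multiplier X) (x : X) : embed x * m = embed (ract m x) :=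
  Multiplier.ext (fun y => by simp [ract_mul_eq]) (fun y => by simp [ract_apply_mul])

theorem embed_mul (x y : X) : embed (x * y) = embed x * embed y :=
  (mul_embed (embed x) y).symm

theorem mtmul_mul_mtmul (m m' : Multiplier X) (n n' : Multiplier Y) :
    mtmul m n * mtmul m' n' = mtmul (m * m') (n * n') := by
  refine Multiplier.ext (fun x => ?_) (fun x => ?_)
  · induction x using TensorProduct.induction_on with
    | zero => simp
    | add x y hx hy => simp only [map_add, hx, hy]
    | tmul x y => simp
  · induction x using TensorProduct.induction_on with
    | zero => simp
    | add x y hx hy => simp only [map_add, hx, hy]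
    | tmul x y => simp

@[simp] theorem mtmul_one_one : mtmul (1 : Multiplier X) (1 : Multiplier Y) = 1 :=
  Multiplier.ext (fun x => by simp) (fun x => by simp)

theorem embed_tmul (x : X) (y : Y) : embed (x ⊗ₜ[ℂ] y) = mtmul (embed x) (embed y) := by
  refine Multiplier.ext (fun t => ?_) (fun t => ?_)
  · induction t using TensorProduct.induction_on with
    | zero => simp
    | add x y hx hy => simp only [map_add, hx, hy]
    | tmul x y => simp
  · induction t using TensorProduct.induction_on with
    | zero => simp
    | add x y hx hy => simp only [map_add, hx, hy]
    | tmul x y => simp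

theorem lact_reassoc (m : Multiplier (X ⊗[ℂ] (X ⊗[ℂ] X))) (t : (X ⊗[ℂ] X) ⊗[ℂ] X) :
    lact (reassoc m) t =
      (TensorProduct.assoc ℂ X X X).symm (lact m (TensorProduct.assoc ℂ X X X t)) := rfl

theorem ract_reassoc (m : Multiplier (X ⊗[ℂ] (X ⊗[ℂ] X))) (t : (X ⊗[ℂ] X) ⊗[ℂ] X) :
    ract (reassoc m) t =
      (TensorProduct.assoc ℂ X X X).symm (ract m (TensorProduct.assoc ℂ X X X t)) := rfl

theorem reassoc_mul (m n : Multiplier (X ⊗[ℂ] (X ⊗[ℂ] X))) :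
    reassoc (m * n) = reassoc m * reassoc n :=
  Multiplier.ext (fun x => by simp [lact_reassoc]) (fun x => by simp [ract_reassoc])

theorem reassoc_add (m n : Multiplier (X ⊗[ℂ] (X ⊗[ℂ] X))) :
    reassoc (m + n) = reassoc m + reassoc n :=
  Multiplier.ext (fun x => by simp [lact_reassoc]) (fun x => by simp [ract_reassoc])

theorem reassoc_zero : reassoc (0 : Multiplier (X ⊗[ℂ] (X ⊗[ℂ] X))) = 0 :=
  Multiplier.ext (fun x => by simp [lact_reassoc]) (fun x => by simp [ract_reassoc])

theorem reassoc_embed (t : X ⊗[ℂ] (X ⊗[ℂ] X)) :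
    reassoc (embed t) = embed ((TensorProduct.assoc ℂ X X X).symm t) :=
  Multiplier.ext (fun x => by simp [lact_reassoc, assoc_symm_mul])
    (fun x => by simp [ract_reassoc, assoc_symm_mul])

theorem reassoc_mtmul (a b c : Multiplier X) :
    reassoc (mtmul a (mtmul b c)) = mtmul (mtmul a b) c := by
  refine Multiplier.ext (fun x => ?_) (fun x => ?_)
  · rw [lact_reassoc, LinearEquiv.symm_apply_eq]
    simpa using LinearMap.congr_fun
      (TensorProduct.map_map_comp_assoc_eq (lact a) (lact b) (lact c)) x
  · rw [ract_reassoc, LinearEquiv.symm_apply_eq]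
    simpa using LinearMap.congr_fun
      (TensorProduct.map_map_comp_assoc_eq (ract a) (ract b) (ract c)) x

@[simp] theorem embed_zero : embed (0 : X) = 0 := map_zero embedLin

theorem embed_add (x y : X) : embed (x + y) = embed x + embed y := map_add embedLin x y

@[simp] theorem mtmul_zero (m : Multiplier X) : mtmul m (0 : Multiplier Y) = 0 :=
  map_zero (mtmulBilin m)

theorem mtmul_add (m : Multiplier X) (n n' : Multiplier Y) :
    mtmul m (n + n') = mtmul m n + mtmul m n' :=
  map_add (mtmulBilin m) n n'

theorem reassoc_one_mul (m n : Multiplier (X ⊗[ℂ] X)) :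
    reassoc (mtmul 1 (m * n)) = reassoc (mtmul 1 m) * reassoc (mtmul 1 n) := by
  rw [← reassoc_mul, mtmul_mul_mtmul, one_mul]

theorem embed_injective (hX : IsNondegenerate X) :
    Function.Injective (embed : X → Multiplier X) := by
  intro a b h
  rw [← sub_eq_zero]
  refine hX.1 _ fun y => ?_
  have := congrArg (fun m => lact m y) h
  simpa [sub_mul, sub_eq_zero] using this

theorem embedLin_injective (hX : IsNondegenerate X) :
    Function.Injective (embedLin : X →ₗ[ℂ] Multiplier X) := embed_injective hX

/-- For a non-degenerate algebra, either of the two components of a multiplier determines the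
other. -/
theorem ext_lact (hX : IsNondegenerate X) {m n : Multiplier X}
    (h : ∀ x, lact m x = lact n x) : m = n := by
  refine Multiplier.ext h fun x => ?_
  rw [← sub_eq_zero]
  refine hX.1 _ fun y => ?_
  rw [sub_mul, ract_mul_eq, ract_mul_eq, h, sub_self]

theorem ext_ract (hX : IsNondegenerate X) {m n : Multiplier X}
    (h : ∀ x, ract m x = ract n x) : m = n := by
  refine Multiplier.ext (fun x => ?_) h
  rw [← sub_eq_zero]
  refine hX.2 _ fun y => ?_
  rw [mul_sub, ← ract_mul_eq, ← ract_mul_eq, h, sub_self]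

theorem IsNondegenerate.tensor (hX : IsNondegenerate X) (hY : IsNondegenerate Y) :
    IsNondegenerate (X ⊗[ℂ] Y) := by
  constructor
  · intro t ht
    refine joint_rTensor (fun x : X => LinearMap.mulRight ℂ x) hX.1 t fun x => ?_
    refine joint_lTensor (fun y : Y => LinearMap.mulRight ℂ y) hY.1 _ fun y => ?_
    have key : ∀ t : X ⊗[ℂ] Y, (LinearMap.mulRight ℂ y).lTensor X
        ((LinearMap.mulRight ℂ x).rTensor Y t) = t * x ⊗ₜ y := by
      intro t
      induction t using TensorProduct.induction_on with
      | zero => simp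
      | add s t hs ht => simp only [map_add, add_mul, hs, ht]
      | tmul a b => simp
    rw [key, ht]
  · intro t ht
    refine joint_rTensor (fun x : X => LinearMap.mulLeft ℂ x) hX.2 t fun x => ?_
    refine joint_lTensor (fun y : Y => LinearMap.mulLeft ℂ y) hY.2 _ fun y => ?_
    have key : ∀ t : X ⊗[ℂ] Y, (LinearMap.mulLeft ℂ y).lTensor X
        ((LinearMap.mulLeft ℂ x).rTensor Y t) = x ⊗ₜ y * t := by
      intro t
      induction t using TensorProduct.induction_on with
      | zero => simp
      | add s t hs ht => simp only [map_add, mul_add, hs, ht]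
      | tmul a b => simp
    rw [key, ht]

theorem ext_lact_tmul (hX : IsNondegenerate X) (hY : IsNondegenerate Y)
    {m n : Multiplier (X ⊗[ℂ] Y)} (h : ∀ x y, lact m (x ⊗ₜ y) = lact n (x ⊗ₜ y)) : m = n :=
  ext_lact (hX.tensor hY) (LinearMap.congr_fun (TensorProduct.ext' h))

theorem ext_ract_tmul (hX : IsNondegenerate X) (hY : IsNondegenerate Y)
    {m n : Multiplier (X ⊗[ℂ] Y)} (h : ∀ x y, ract m (x ⊗ₜ y) = ract n (x ⊗ₜ y)) : m = n :=
  ext_ract (hX.tensor hY) (LinearMap.congr_fun (TensorProduct.ext' h))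

/-- The canonical map `M(X) ⊗ M(Y) → M(X ⊗ Y)`. -/
noncomputable def mtmulLin : Multiplier X ⊗[ℂ] Multiplier Y →ₗ[ℂ] Multiplier (X ⊗[ℂ] Y) :=
  TensorProduct.lift mtmulBilin

@[simp] theorem mtmulLin_tmul (m : Multiplier X) (n : Multiplier Y) :
    mtmulLin (m ⊗ₜ n) = mtmul m n := by simp [mtmulLin]

theorem mtmulLin_injective (hX : IsNondegenerate X) (hY : IsNondegenerate Y) :
    Function.Injective (mtmulLin : Multiplier X ⊗[ℂ] Multiplier Y →ₗ[ℂ] _) := by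
  rw [injective_iff_map_eq_zero]
  intro t ht
  refine joint_rTensor (fun x : X => lactLin.flip x) (fun m hm => ext_lact hX hm) t fun x => ?_
  refine joint_lTensor (fun y : Y => lactLin.flip y) (fun m hm => ext_lact hY hm) _ fun y => ?_
  have key : ∀ t : Multiplier X ⊗[ℂ] Multiplier Y,
      (lactLin.flip y).lTensor X ((lactLin.flip x).rTensor (Multiplier Y) t) =
        lact (mtmulLin t) (x ⊗ₜ y) := by
    intro t
    induction t using TensorProduct.induction_on with
    | zero => simp
    | add s t hs ht => simp only [map_add, hs, ht, lact_add]
    | tmul a b => simp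
  rw [key, ht, lact_zero]

/-- A linear map into `M(X)` that takes its values in `X`, seen as a map into `X`. -/
noncomputable def descend {V : Type*} [AddCommGroup V] [Module ℂ V] (hX : IsNondegenerate X)
    (g : V →ₗ[ℂ] Multiplier X) (hg : ∀ v, ∃ t, embed t = g v) : V →ₗ[ℂ] X :=
  (LinearEquiv.ofInjective embedLin (embedLin_injective hX)).symm.toLinearMap ∘ₗ
    g.codRestrict (LinearMap.range embedLin) hg

theorem embed_descend {V : Type*} [AddCommGroup V] [Module ℂ V] (hX : IsNondegenerate X)
    (g : V →ₗ[ℂ] Multiplier X) (hg : ∀ v, ∃ t, embed t = g v) (v : V) :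
    embed (descend hX g hg v) = g v := by
  have := LinearEquiv.apply_symm_apply (LinearEquiv.ofInjective embedLin (embedLin_injective hX))
    (g.codRestrict (LinearMap.range embedLin) hg v)
  exact congrArg Subtype.val this

end Multipliers

/-! ### Covered coproducts and coassociativity -/

section Bialgebra

variable {A : Type*} [NonUnitalRing A] [Module ℂ A] [IsScalarTower ℂ A A] [SMulCommClass ℂ A A]
  {Δ : A →ₙₐ[ℂ] Multiplier (A ⊗[ℂ] A)} {E : Multiplier (A ⊗[ℂ] A)} {ε : A →ₗ[ℂ] ℂ}

/-- The multiplier `a ⊗ 1` of `A ⊗ A`. -/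
noncomputable abbrev leg₁ (a : A) : Multiplier (A ⊗[ℂ] A) := mtmul (embed a) 1

/-- The multiplier `1 ⊗ a` of `A ⊗ A`. -/
noncomputable abbrev leg₂ (a : A) : Multiplier (A ⊗[ℂ] A) := mtmul 1 (embed a)

theorem IsCanonicalIdempotent.mul_delta (hE : IsCanonicalIdempotent Δ E) (hA : IsNondegenerate A)
    (a : A) : E * Δ a = Δ a := by
  refine ext_lact (hA.tensor hA) fun x => ?_
  have : lact (Δ a) x ∈ LinearMap.range (lact E) := by
    rw [← hE.range_left]
    exact Submodule.subset_span ⟨a, x, rfl⟩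
  obtain ⟨y, hy⟩ := this
  rw [lact_mul, ← hy, ← lact_mul, hE.idem]

theorem IsCanonicalIdempotent.delta_mul (hE : IsCanonicalIdempotent Δ E) (hA : IsNondegenerate A)
    (a : A) : Δ a * E = Δ a := by
  refine ext_ract (hA.tensor hA) fun x => ?_
  have : ract (Δ a) x ∈ LinearMap.range (ract E) := by
    rw [← hE.range_right]
    exact Submodule.subset_span ⟨a, x, rfl⟩
  obtain ⟨y, hy⟩ := this
  rw [ract_mul, ← hy, ← ract_mul, hE.idem]

/-- Linear maps that agree on `Δ(A)(A ⊗ A)` agree on `E(A ⊗ A)`. -/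
theorem IsCanonicalIdempotent.eq_left (hE : IsCanonicalIdempotent Δ E) {W : Type*}
    [AddCommGroup W] [Module ℂ W] (f g : A ⊗[ℂ] A →ₗ[ℂ] W)
    (h : ∀ a x y, f (lact (Δ a) (x ⊗ₜ y)) = g (lact (Δ a) (x ⊗ₜ y))) (u : A ⊗[ℂ] A) :
    f (lact E u) = g (lact E u) := by
  have hs : Set.EqOn f g (Submodule.span ℂ {z | ∃ a x, z = lact (Δ a) x}) := by
    refine LinearMap.eqOn_span ?_
    rintro _ ⟨a, x, rfl⟩
    exact LinearMap.congr_fun (TensorProduct.ext' (g := f ∘ₗ lact (Δ a)) (h := g ∘ₗ lact (Δ a))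
      (h a)) x
  exact hs (by rw [hE.range_left]; exact ⟨u, rfl⟩)

/-- Linear maps that agree on `(A ⊗ A)Δ(A)` agree on `(A ⊗ A)E`. -/
theorem IsCanonicalIdempotent.eq_right (hE : IsCanonicalIdempotent Δ E) {W : Type*}
    [AddCommGroup W] [Module ℂ W] (f g : A ⊗[ℂ] A →ₗ[ℂ] W)
    (h : ∀ a x y, f (ract (Δ a) (x ⊗ₜ y)) = g (ract (Δ a) (x ⊗ₜ y))) (u : A ⊗[ℂ] A) :
    f (ract E u) = g (ract E u) := by
  have hs : Set.EqOn f g (Submodule.span ℂ {z | ∃ a x, z = ract (Δ a) x}) := by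
    refine LinearMap.eqOn_span ?_
    rintro _ ⟨a, x, rfl⟩
    exact LinearMap.congr_fun (TensorProduct.ext' (g := f ∘ₗ ract (Δ a)) (h := g ∘ₗ ract (Δ a))
      (h a)) x
  exact hs (by rw [hE.range_right]; exact ⟨u, rfl⟩)

theorem IsCanonicalIdempotent.mul_eq (hE : IsCanonicalIdempotent Δ E) {E' : Multiplier (A ⊗[ℂ] A)}
    (hE' : IsCanonicalIdempotent Δ E') (hA : IsNondegenerate A) : E' * E = E :=
  ext_lact (hA.tensor hA) fun u =>
    hE.eq_left (lact E') LinearMap.id (fun a x y => by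
      rw [← lact_mul, hE'.mul_delta hA]; rfl) u

theorem IsCanonicalIdempotent.mul_eq' (hE : IsCanonicalIdempotent Δ E)
    {E' : Multiplier (A ⊗[ℂ] A)}
    (hE' : IsCanonicalIdempotent Δ E') (hA : IsNondegenerate A) : E * E' = E :=
  ext_ract (hA.tensor hA) fun u =>
    hE.eq_right (ract E') LinearMap.id (fun a x y => by
      rw [← ract_mul, hE'.delta_mul hA]; rfl) u

/-- Two canonical idempotents `E`, `E'` have the same left and right ranges, so `E = EE' = E'`. -/
theorem IsCanonicalIdempotent.unique (hE : IsCanonicalIdempotent Δ E)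
    {E' : Multiplier (A ⊗[ℂ] A)}
    (hE' : IsCanonicalIdempotent Δ E') (hA : IsNondegenerate A) : E = E' :=
  (hE.mul_eq' hE' hA).symm.trans (hE'.mul_eq hE hA)

/-- A weak multiplier bialgebra with its canonical idempotent and its counit. -/
structure IsWeakBialgebraWith (Δ : A →ₙₐ[ℂ] Multiplier (A ⊗[ℂ] A)) (E : Multiplier (A ⊗[ℂ] A))
    (ε : A →ₗ[ℂ] ℂ) : Prop where
  nondeg : IsNondegenerate A
  idem : IsIdempotentAlg A
  coproduct : IsRegularCoproduct Δ
  full : IsFull Δ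
  canonical : IsCanonicalIdempotent Δ E
  comult : IsWeaklyComultiplicative Δ E
  counit : IsCounit Δ ε
  weakMul : IsWeaklyMultiplicative Δ ε

section Coproduct

variable (hA : IsNondegenerate A) (hΔ : IsRegularCoproduct Δ)

/-- The map `a ↦ (b ⊗ 1)Δ(a)` from `A` to `A ⊗ A`. -/
noncomputable def IsRegularCoproduct.dl₁ (b : A) : A →ₗ[ℂ] A ⊗[ℂ] A :=
  descend (hA.tensor hA) (LinearMap.mulLeft ℂ (leg₁ b) ∘ₗ (Δ : A →ₗ[ℂ] Multiplier (A ⊗[ℂ] A)))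
    fun a => hΔ.mem₂ a b

/-- The map `a ↦ (1 ⊗ b)Δ(a)` from `A` to `A ⊗ A`. -/
noncomputable def IsRegularCoproduct.dl₂ (b : A) : A →ₗ[ℂ] A ⊗[ℂ] A :=
  descend (hA.tensor hA) (LinearMap.mulLeft ℂ (leg₂ b) ∘ₗ (Δ : A →ₗ[ℂ] Multiplier (A ⊗[ℂ] A)))
    fun a => hΔ.mem₄ a b

/-- The map `a ↦ Δ(a)(b ⊗ 1)` from `A` to `A ⊗ A`. -/
noncomputable def IsRegularCoproduct.dr₁ (b : A) : A →ₗ[ℂ] A ⊗[ℂ] A :=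
  descend (hA.tensor hA) (LinearMap.mulRight ℂ (leg₁ b) ∘ₗ (Δ : A →ₗ[ℂ] Multiplier (A ⊗[ℂ] A)))
    fun a => hΔ.mem₃ a b

/-- The map `a ↦ Δ(a)(1 ⊗ b)` from `A` to `A ⊗ A`. -/
noncomputable def IsRegularCoproduct.dr₂ (b : A) : A →ₗ[ℂ] A ⊗[ℂ] A :=
  descend (hA.tensor hA) (LinearMap.mulRight ℂ (leg₂ b) ∘ₗ (Δ : A →ₗ[ℂ] Multiplier (A ⊗[ℂ] A)))
    fun a => hΔ.mem₁ a b

theorem IsRegularCoproduct.embed_dl₁ (a b : A) : embed (hΔ.dl₁ hA b a) = leg₁ b * Δ a :=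
  embed_descend _ _ _ a

theorem IsRegularCoproduct.embed_dl₂ (a b : A) : embed (hΔ.dl₂ hA b a) = leg₂ b * Δ a :=
  embed_descend _ _ _ a

theorem IsRegularCoproduct.embed_dr₁ (a b : A) : embed (hΔ.dr₁ hA b a) = Δ a * leg₁ b :=
  embed_descend _ _ _ a

theorem IsRegularCoproduct.embed_dr₂ (a b : A) : embed (hΔ.dr₂ hA b a) = Δ a * leg₂ b :=
  embed_descend _ _ _ a

end Coproduct

theorem leg₁_mul_leg₂ (a b : A) : leg₁ a * leg₂ b = embed (a ⊗ₜ[ℂ] b) := by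
  rw [mtmul_mul_mtmul, one_mul, mul_one, embed_tmul]

theorem leg₂_mul_leg₁ (a b : A) : leg₂ b * leg₁ a = embed (a ⊗ₜ[ℂ] b) := by
  rw [mtmul_mul_mtmul, one_mul, mul_one, embed_tmul]

section ThreeLegs

/-- The homomorphism `ι ⊗ Δ` from `A ⊗ A` to `M((A ⊗ A) ⊗ A)`. -/
noncomputable def idDeltaAssoc (Δ : A →ₙₐ[ℂ] Multiplier (A ⊗[ℂ] A)) :
    A ⊗[ℂ] A →ₗ[ℂ] Multiplier ((A ⊗[ℂ] A) ⊗[ℂ] A) where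
  toFun u := reassoc (idDelta Δ u)
  map_add' u v := by rw [map_add, reassoc_add]
  map_smul' c u := by
    rw [map_smul]
    exact Multiplier.ext (fun x => map_smul (TensorProduct.assoc ℂ A A A).symm c _)
      (fun x => map_smul (TensorProduct.assoc ℂ A A A).symm c _)

@[simp] theorem idDeltaAssoc_tmul (a b : A) :
    idDeltaAssoc Δ (a ⊗ₜ b) = reassoc (mtmul (embed a) (Δ b)) := by
  simp [idDeltaAssoc, idDelta]

@[simp] theorem deltaId_tmul (a b : A) : deltaId Δ (a ⊗ₜ b) = mtmul (Δ a) (embed b) := by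
  simp [deltaId]

/-- The multiplier `a ⊗ 1 ⊗ 1`. -/
noncomputable abbrev tri₁ (a : A) : Multiplier ((A ⊗[ℂ] A) ⊗[ℂ] A) := mtmul (leg₁ a) 1

/-- The multiplier `1 ⊗ a ⊗ 1`. -/
noncomputable abbrev tri₂ (a : A) : Multiplier ((A ⊗[ℂ] A) ⊗[ℂ] A) := mtmul (leg₂ a) 1

/-- The multiplier `1 ⊗ 1 ⊗ a`. -/
noncomputable abbrev tri₃ (a : A) : Multiplier ((A ⊗[ℂ] A) ⊗[ℂ] A) := mtmul 1 (embed a)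

theorem tri₁_eq_reassoc (a : A) : tri₁ a = reassoc (mtmul (embed a) 1) := by
  rw [← mtmul_one_one, reassoc_mtmul]

theorem tri₂_eq_reassoc (a : A) : tri₂ a = reassoc (mtmul 1 (leg₁ a)) := by
  rw [reassoc_mtmul]

theorem tri₃_eq_reassoc (a : A) : tri₃ a = reassoc (mtmul 1 (leg₂ a)) := by
  rw [reassoc_mtmul, mtmul_one_one]

theorem mtmul_mul_tri₃ (m : Multiplier (A ⊗[ℂ] A)) (a : A) :
    mtmul m 1 * tri₃ a = tri₃ a * mtmul m 1 := by
  simp [mtmul_mul_mtmul]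

theorem mtmul_mul_tri₃_eq (m : Multiplier (A ⊗[ℂ] A)) (a : A) :
    mtmul m 1 * tri₃ a = mtmul m (embed a) := by
  simp [mtmul_mul_mtmul]

theorem tri₁_mul_idDeltaAssoc (a : A) (u : A ⊗[ℂ] A) :
    tri₁ a * idDeltaAssoc Δ u = idDeltaAssoc Δ (lact (leg₁ a) u) := by
  induction u using TensorProduct.induction_on with
  | zero => simp
  | add u v hu hv => simp only [map_add, mul_add, hu, hv]
  | tmul u v => simp [tri₁_eq_reassoc, ← reassoc_mul, mtmul_mul_mtmul, embed_mul]

theorem idDeltaAssoc_mul_tri₁ (a : A) (u : A ⊗[ℂ] A) :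
    idDeltaAssoc Δ u * tri₁ a = idDeltaAssoc Δ (ract (leg₁ a) u) := by
  induction u using TensorProduct.induction_on with
  | zero => simp
  | add u v hu hv => simp only [map_add, add_mul, hu, hv]
  | tmul u v => simp [tri₁_eq_reassoc, ← reassoc_mul, mtmul_mul_mtmul, embed_mul]

theorem delta_mul_idDeltaAssoc (a : A) (u : A ⊗[ℂ] A) :
    reassoc (mtmul 1 (Δ a)) * idDeltaAssoc Δ u = idDeltaAssoc Δ (lact (leg₂ a) u) := by
  induction u using TensorProduct.induction_on with
  | zero => simp
  | add u v hu hv => simp only [map_add, mul_add, hu, hv]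
  | tmul u v => simp [← reassoc_mul, mtmul_mul_mtmul]

theorem idDeltaAssoc_mul_delta (a : A) (u : A ⊗[ℂ] A) :
    idDeltaAssoc Δ u * reassoc (mtmul 1 (Δ a)) = idDeltaAssoc Δ (ract (leg₂ a) u) := by
  induction u using TensorProduct.induction_on with
  | zero => simp
  | add u v hu hv => simp only [map_add, add_mul, hu, hv]
  | tmul u v => simp [← reassoc_mul, mtmul_mul_mtmul]

theorem tri₃_mul_deltaId (a : A) (u : A ⊗[ℂ] A) :
    tri₃ a * deltaId Δ u = deltaId Δ (lact (leg₂ a) u) := by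
  induction u using TensorProduct.induction_on with
  | zero => simp
  | add u v hu hv => simp only [map_add, mul_add, hu, hv]
  | tmul u v => simp [mtmul_mul_mtmul, embed_mul]

theorem deltaId_mul_tri₃ (a : A) (u : A ⊗[ℂ] A) :
    deltaId Δ u * tri₃ a = deltaId Δ (ract (leg₂ a) u) := by
  induction u using TensorProduct.induction_on with
  | zero => simp
  | add u v hu hv => simp only [map_add, add_mul, hu, hv]
  | tmul u v => simp [mtmul_mul_mtmul, embed_mul]

theorem delta_mul_deltaId (a : A) (u : A ⊗[ℂ] A) :
    mtmul (Δ a) 1 * deltaId Δ u = deltaId Δ (lact (leg₁ a) u) := by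
  induction u using TensorProduct.induction_on with
  | zero => simp
  | add u v hu hv => simp only [map_add, mul_add, hu, hv]
  | tmul u v => simp [mtmul_mul_mtmul]

theorem deltaId_mul_delta (a : A) (u : A ⊗[ℂ] A) :
    deltaId Δ u * mtmul (Δ a) 1 = deltaId Δ (ract (leg₁ a) u) := by
  induction u using TensorProduct.induction_on with
  | zero => simp
  | add u v hu hv => simp only [map_add, add_mul, hu, hv]
  | tmul u v => simp [mtmul_mul_mtmul]

theorem idDeltaAssoc_mul (u v : A ⊗[ℂ] A) :
    idDeltaAssoc Δ (u * v) = idDeltaAssoc Δ u * idDeltaAssoc Δ v := by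
  induction u using TensorProduct.induction_on with
  | zero => simp
  | add u u' hu hu' => simp only [map_add, add_mul, hu, hu']
  | tmul a b =>
    induction v using TensorProduct.induction_on with
    | zero => simp
    | add u u' hu hu' => simp only [map_add, mul_add, hu, hu']
    | tmul c d => simp [← reassoc_mul, mtmul_mul_mtmul, embed_mul]

theorem tri₁_cancel_left (hA : IsNondegenerate A) {m n : Multiplier ((A ⊗[ℂ] A) ⊗[ℂ] A)}
    (h : ∀ a, tri₁ a * m = tri₁ a * n) : m = n := by
  refine ext_lact ((hA.tensor hA).tensor hA) fun x => sub_eq_zero.1 ?_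
  refine joint_rTensor (fun c : A => (LinearMap.mulLeft ℂ c).rTensor A)
    (joint_rTensor (fun c : A => LinearMap.mulLeft ℂ c) hA.2) _ fun c => ?_
  rw [map_sub, sub_eq_zero]
  exact congrArg (fun m => lact m x) (h c)

theorem tri₁_cancel_right (hA : IsNondegenerate A) {m n : Multiplier ((A ⊗[ℂ] A) ⊗[ℂ] A)}
    (h : ∀ a, m * tri₁ a = n * tri₁ a) : m = n := by
  refine ext_ract ((hA.tensor hA).tensor hA) fun x => sub_eq_zero.1 ?_
  refine joint_rTensor (fun c : A => (LinearMap.mulRight ℂ c).rTensor A)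
    (joint_rTensor (fun c : A => LinearMap.mulRight ℂ c) hA.1) _ fun c => ?_
  rw [map_sub, sub_eq_zero]
  exact congrArg (fun m => ract m x) (h c)

theorem tri₃_cancel_left (hA : IsNondegenerate A) {m n : Multiplier ((A ⊗[ℂ] A) ⊗[ℂ] A)}
    (h : ∀ a, tri₃ a * m = tri₃ a * n) : m = n := by
  refine ext_lact ((hA.tensor hA).tensor hA) fun x => sub_eq_zero.1 ?_
  refine joint_lTensor (fun c : A => LinearMap.mulLeft ℂ c) hA.2 _ fun c => ?_
  rw [map_sub, sub_eq_zero]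
  exact congrArg (fun m => lact m x) (h c)

theorem tri₃_cancel_right (hA : IsNondegenerate A) {m n : Multiplier ((A ⊗[ℂ] A) ⊗[ℂ] A)}
    (h : ∀ a, m * tri₃ a = n * tri₃ a) : m = n := by
  refine ext_ract ((hA.tensor hA).tensor hA) fun x => sub_eq_zero.1 ?_
  refine joint_lTensor (fun c : A => LinearMap.mulRight ℂ c) hA.1 _ fun c => ?_
  rw [map_sub, sub_eq_zero]
  exact congrArg (fun m => ract m x) (h c)

end ThreeLegs

section Coassociativity

variable (hA : IsNondegenerate A) (hΔ : IsRegularCoproduct Δ)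

theorem IsRegularCoproduct.ract_leg₁_dl₁ (a b c : A) :
    ract (leg₁ c) (hΔ.dl₁ hA b a) = lact (leg₁ b) (hΔ.dr₁ hA c a) := by
  apply embed_injective (hA.tensor hA)
  rw [← embed_mul_multiplier, ← mul_embed, hΔ.embed_dl₁, hΔ.embed_dr₁, mul_assoc]

theorem IsRegularCoproduct.ract_leg₂_dl₂ (a b c : A) :
    ract (leg₂ c) (hΔ.dl₂ hA b a) = lact (leg₂ b) (hΔ.dr₂ hA c a) := by
  apply embed_injective (hA.tensor hA)
  rw [← embed_mul_multiplier, ← mul_embed, hΔ.embed_dl₂, hΔ.embed_dr₂, mul_assoc]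

theorem IsRegularCoproduct.lact_delta_tmul (a x y : A) :
    lact (Δ a) (x ⊗ₜ y) = ract (leg₁ x) (hΔ.dr₂ hA y a) := by
  apply embed_injective (hA.tensor hA)
  rw [← embed_mul_multiplier, ← mul_embed, hΔ.embed_dr₂, mul_assoc, leg₂_mul_leg₁]

theorem IsRegularCoproduct.lact_delta_tmul' (a x y : A) :
    lact (Δ a) (x ⊗ₜ y) = ract (leg₂ y) (hΔ.dr₁ hA x a) := by
  apply embed_injective (hA.tensor hA)
  rw [← embed_mul_multiplier, ← mul_embed, hΔ.embed_dr₁, mul_assoc, leg₁_mul_leg₂]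

theorem IsRegularCoproduct.ract_delta_tmul (a x y : A) :
    ract (Δ a) (x ⊗ₜ y) = lact (leg₁ x) (hΔ.dl₂ hA y a) := by
  apply embed_injective (hA.tensor hA)
  rw [← embed_mul_multiplier, ← mul_embed, hΔ.embed_dl₂, ← mul_assoc, leg₁_mul_leg₂]

theorem IsRegularCoproduct.ract_delta_tmul' (a x y : A) :
    ract (Δ a) (x ⊗ₜ y) = lact (leg₂ y) (hΔ.dl₁ hA x a) := by
  apply embed_injective (hA.tensor hA)
  rw [← embed_mul_multiplier, ← mul_embed, hΔ.embed_dl₁, ← mul_assoc, leg₂_mul_leg₁]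

theorem IsRegularCoproduct.dl₁_mul (a b : A) (u : A ⊗[ℂ] A) :
    hΔ.dl₁ hA b a * u = lact (leg₁ b) (lact (Δ a) u) := by
  rw [← lact_embed, hΔ.embed_dl₁, lact_mul]

theorem IsRegularCoproduct.mul_dr₁ (a b : A) (u : A ⊗[ℂ] A) :
    u * hΔ.dr₁ hA b a = ract (leg₁ b) (ract (Δ a) u) := by
  rw [← ract_embed, hΔ.embed_dr₁, ract_mul]

theorem IsRegularCoproduct.coassoc_left_right (a b c : A) :
    tri₁ c * deltaId Δ (hΔ.dr₂ hA b a) = idDeltaAssoc Δ (hΔ.dl₁ hA c a) * tri₃ b :=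
  hΔ.coassoc a b c _ _ (hΔ.embed_dr₂ hA a b) (hΔ.embed_dl₁ hA a c)

/-- Coassociativity, with both covering factors on the right. -/
theorem IsRegularCoproduct.coassoc_right (a b c : A) :
    deltaId Δ (hΔ.dr₂ hA b a) * tri₁ c = idDeltaAssoc Δ (hΔ.dr₁ hA c a) * tri₃ b := by
  refine tri₁_cancel_left hA fun d => ?_
  rw [← mul_assoc, hΔ.coassoc_left_right, mul_assoc, ← mtmul_mul_tri₃, ← mul_assoc,
    idDeltaAssoc_mul_tri₁, hΔ.ract_leg₁_dl₁, ← tri₁_mul_idDeltaAssoc, mul_assoc]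

/-- Coassociativity, with both covering factors on the left. -/
theorem IsRegularCoproduct.coassoc_left (a b c : A) :
    tri₁ c * deltaId Δ (hΔ.dl₂ hA b a) = tri₃ b * idDeltaAssoc Δ (hΔ.dl₁ hA c a) := by
  refine tri₃_cancel_right hA fun d => ?_
  rw [mul_assoc, mul_assoc, deltaId_mul_tri₃, hΔ.ract_leg₂_dl₂, ← tri₃_mul_deltaId, ← mul_assoc,
    mtmul_mul_tri₃, mul_assoc, hΔ.coassoc_left_right]

end Coassociativity

end Bialgebra

/-! ### The canonical idempotent under `Δ ⊗ ι` and `ι ⊗ Δ` -/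

section Comultiplicativity

variable {A : Type*} [NonUnitalRing A] [Module ℂ A] [IsScalarTower ℂ A A] [SMulCommClass ℂ A A]
  {Δ : A →ₙₐ[ℂ] Multiplier (A ⊗[ℂ] A)} {E : Multiplier (A ⊗[ℂ] A)} {ε : A →ₗ[ℂ] ℂ}

theorem IsCanonicalIdempotent.mul_deltaId (hE : IsCanonicalIdempotent Δ E)
    (hA : IsNondegenerate A) (u : A ⊗[ℂ] A) : mtmul E 1 * deltaId Δ u = deltaId Δ u := by
  induction u using TensorProduct.induction_on with
  | zero => simp
  | add u v hu hv => simp only [map_add, mul_add, hu, hv]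
  | tmul u v => simp [mtmul_mul_mtmul, hE.mul_delta hA]

theorem IsCanonicalIdempotent.deltaId_mul (hE : IsCanonicalIdempotent Δ E)
    (hA : IsNondegenerate A) (u : A ⊗[ℂ] A) : deltaId Δ u * mtmul E 1 = deltaId Δ u := by
  induction u using TensorProduct.induction_on with
  | zero => simp
  | add u v hu hv => simp only [map_add, add_mul, hu, hv]
  | tmul u v => simp [mtmul_mul_mtmul, hE.delta_mul hA]

theorem IsCanonicalIdempotent.mul_idDeltaAssoc (hE : IsCanonicalIdempotent Δ E)
    (hA : IsNondegenerate A) (u : A ⊗[ℂ] A) :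
    reassoc (mtmul 1 E) * idDeltaAssoc Δ u = idDeltaAssoc Δ u := by
  induction u using TensorProduct.induction_on with
  | zero => simp
  | add u v hu hv => simp only [map_add, mul_add, hu, hv]
  | tmul u v =>
    rw [idDeltaAssoc_tmul, ← reassoc_mul, mtmul_mul_mtmul, hE.mul_delta hA, one_mul]

theorem IsCanonicalIdempotent.idDeltaAssoc_mul_one (hE : IsCanonicalIdempotent Δ E)
    (hA : IsNondegenerate A) (u : A ⊗[ℂ] A) :
    idDeltaAssoc Δ u * reassoc (mtmul 1 E) = idDeltaAssoc Δ u := by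
  induction u using TensorProduct.induction_on with
  | zero => simp
  | add u v hu hv => simp only [map_add, add_mul, hu, hv]
  | tmul u v =>
    rw [idDeltaAssoc_tmul, ← reassoc_mul, mtmul_mul_mtmul, hE.delta_mul hA, mul_one]

/-- Since `(A ⊗ A)Δ(A) = (A ⊗ A)E`, the family of left factors `Δ(a) ⊗ 1` cancels up to `E ⊗ 1`. -/
theorem IsCanonicalIdempotent.cancel_left (hE : IsCanonicalIdempotent Δ E)
    (hA : IsNondegenerate A) {m n : Multiplier ((A ⊗[ℂ] A) ⊗[ℂ] A)}
    (h : ∀ a, mtmul (Δ a) 1 * m = mtmul (Δ a) 1 * n) : mtmul E 1 * m = mtmul E 1 * n := by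
  refine ext_ract_tmul (hA.tensor hA) hA fun t r => ?_
  have := hE.eq_right (ract m ∘ₗ (TensorProduct.mk ℂ (A ⊗[ℂ] A) A).flip r)
    (ract n ∘ₗ (TensorProduct.mk ℂ (A ⊗[ℂ] A) A).flip r) (fun a x y => by
      simpa using congrArg (fun m => ract m ((x ⊗ₜ[ℂ] y) ⊗ₜ[ℂ] r)) (h a)) t
  simpa using this

/-- Since `Δ(A)(A ⊗ A) = E(A ⊗ A)`, the family of right factors `Δ(a) ⊗ 1` cancels up to `E ⊗ 1`. -/
theorem IsCanonicalIdempotent.cancel_right (hE : IsCanonicalIdempotent Δ E)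
    (hA : IsNondegenerate A) {m n : Multiplier ((A ⊗[ℂ] A) ⊗[ℂ] A)}
    (h : ∀ a, m * mtmul (Δ a) 1 = n * mtmul (Δ a) 1) : m * mtmul E 1 = n * mtmul E 1 := by
  refine ext_lact_tmul (hA.tensor hA) hA fun t r => ?_
  have := hE.eq_left (lact m ∘ₗ (TensorProduct.mk ℂ (A ⊗[ℂ] A) A).flip r)
    (lact n ∘ₗ (TensorProduct.mk ℂ (A ⊗[ℂ] A) A).flip r) (fun a x y => by
      simpa using congrArg (fun m => lact m ((x ⊗ₜ[ℂ] y) ⊗ₜ[ℂ] r)) (h a)) t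
  simpa using this

namespace IsWeakBialgebraWith

/-- `(Δ ⊗ ι)(Eu) = (1 ⊗ E)(Δ ⊗ ι)(u)`. -/
theorem deltaId_lact (h : IsWeakBialgebraWith Δ E ε) (u : A ⊗[ℂ] A) :
    deltaId Δ (lact E u) = reassoc (mtmul 1 E) * deltaId Δ u := by
  rw [← h.comult.delta_eq.mul_delta, h.comult.comm, mul_assoc, h.canonical.mul_deltaId h.nondeg]

/-- `(Δ ⊗ ι)(uE) = (Δ ⊗ ι)(u)(1 ⊗ E)`. -/
theorem deltaId_ract (h : IsWeakBialgebraWith Δ E ε) (u : A ⊗[ℂ] A) :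
    deltaId Δ (ract E u) = deltaId Δ u * reassoc (mtmul 1 E) := by
  rw [← h.comult.delta_eq.delta_mul, ← mul_assoc, h.canonical.deltaId_mul h.nondeg]

/-- `(ι ⊗ Δ)(Eu) = (E ⊗ 1)(ι ⊗ Δ)(Eu)`: once covered, the left-hand side is by coassociativity a sum
of products with left factor in `(Δ ⊗ ι)(A ⊗ A)`, which `E ⊗ 1` fixes. -/
theorem mul_idDeltaAssoc_lact (h : IsWeakBialgebraWith Δ E ε) (u : A ⊗[ℂ] A) :
    mtmul E 1 * idDeltaAssoc Δ (lact E u) = idDeltaAssoc Δ (lact E u) := by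
  refine h.canonical.eq_left (LinearMap.mulLeft ℂ (mtmul E 1) ∘ₗ idDeltaAssoc Δ) (idDeltaAssoc Δ)
    (fun a b y => ?_) u
  rw [h.coproduct.lact_delta_tmul' h.nondeg, LinearMap.comp_apply, LinearMap.mulLeft_apply,
    ← idDeltaAssoc_mul_delta]
  refine tri₃_cancel_right h.nondeg fun z => ?_
  have key : ∀ w : A ⊗[ℂ] A, mtmul E 1 * (idDeltaAssoc Δ (h.coproduct.dr₁ h.nondeg b a) *
      reassoc (mtmul 1 (embed w))) = idDeltaAssoc Δ (h.coproduct.dr₁ h.nondeg b a) *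
      reassoc (mtmul 1 (embed w)) := by
    intro w
    induction w using TensorProduct.induction_on with
    | zero => simp [reassoc_zero]
    | add v w hv hw => simp only [embed_add, mtmul_add, reassoc_add, mul_add, hv, hw]
    | tmul m n =>
      rw [← leg₂_mul_leg₁, reassoc_one_mul,
        ← tri₂_eq_reassoc, ← tri₃_eq_reassoc, ← mul_assoc _ (tri₃ n) (tri₂ m),
        ← h.coproduct.coassoc_right, ← mul_assoc, ← mul_assoc, h.canonical.mul_deltaId h.nondeg]
  have := key (h.coproduct.dr₂ h.nondeg z y)
  rw [h.coproduct.embed_dr₂, reassoc_one_mul,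
    ← tri₃_eq_reassoc] at this
  simpa only [mul_assoc] using this

/-- `(ι ⊗ Δ)(uE) = (ι ⊗ Δ)(uE)(E ⊗ 1)`. -/
theorem idDeltaAssoc_ract_mul (h : IsWeakBialgebraWith Δ E ε) (u : A ⊗[ℂ] A) :
    idDeltaAssoc Δ (ract E u) * mtmul E 1 = idDeltaAssoc Δ (ract E u) := by
  refine h.canonical.eq_right (LinearMap.mulRight ℂ (mtmul E 1) ∘ₗ idDeltaAssoc Δ)
    (idDeltaAssoc Δ) (fun a b y => ?_) u
  rw [h.coproduct.ract_delta_tmul' h.nondeg, LinearMap.comp_apply, LinearMap.mulRight_apply,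
    ← delta_mul_idDeltaAssoc]
  refine tri₃_cancel_left h.nondeg fun z => ?_
  have key : ∀ w : A ⊗[ℂ] A, reassoc (mtmul 1 (embed w)) *
      idDeltaAssoc Δ (h.coproduct.dl₁ h.nondeg b a) * mtmul E 1 =
      reassoc (mtmul 1 (embed w)) * idDeltaAssoc Δ (h.coproduct.dl₁ h.nondeg b a) := by
    intro w
    induction w using TensorProduct.induction_on with
    | zero => simp [reassoc_zero]
    | add v w hv hw => simp only [embed_add, mtmul_add, reassoc_add, add_mul, hv, hw]
    | tmul m n =>
      rw [← leg₁_mul_leg₂, reassoc_one_mul,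
        ← tri₂_eq_reassoc, ← tri₃_eq_reassoc, mul_assoc (tri₂ m), ← h.coproduct.coassoc_left,
        mul_assoc, mul_assoc, h.canonical.deltaId_mul h.nondeg]
  have := key (h.coproduct.dl₂ h.nondeg z y)
  rw [h.coproduct.embed_dl₂, reassoc_one_mul,
    ← tri₃_eq_reassoc] at this
  simpa only [mul_assoc] using this

/-- `(Δ ⊗ ι)(wE)(ι ⊗ Δ)(Eu) = (Δ ⊗ ι)(wE)(ι ⊗ Δ)(u)`: on the generators `(x ⊗ y)Δ(a)` of
`(A ⊗ A)E`, coassociativity moves the left factor under `ι ⊗ Δ`, where it absorbs `E`. -/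
theorem deltaId_ract_mul (h : IsWeakBialgebraWith Δ E ε) (u w : A ⊗[ℂ] A) :
    deltaId Δ (ract E w) * idDeltaAssoc Δ (lact E u) =
      deltaId Δ (ract E w) * idDeltaAssoc Δ u := by
  refine h.canonical.eq_right (LinearMap.mulRight ℂ (idDeltaAssoc Δ (lact E u)) ∘ₗ deltaId Δ)
    (LinearMap.mulRight ℂ (idDeltaAssoc Δ u) ∘ₗ deltaId Δ) (fun a m n => ?_) w
  rw [h.coproduct.ract_delta_tmul h.nondeg, LinearMap.comp_apply, LinearMap.comp_apply,
    LinearMap.mulRight_apply, LinearMap.mulRight_apply, ← delta_mul_deltaId, mul_assoc, mul_assoc]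
  congr 1
  refine tri₁_cancel_left h.nondeg fun c => ?_
  rw [← mul_assoc, ← mul_assoc, h.coproduct.coassoc_left, mul_assoc, mul_assoc,
    ← WMB.idDeltaAssoc_mul, ← WMB.idDeltaAssoc_mul, h.coproduct.dl₁_mul, h.coproduct.dl₁_mul,
    ← lact_mul (Δ a) E, h.canonical.delta_mul h.nondeg]

/-- `(ι ⊗ Δ)(uE)(Δ ⊗ ι)(Ew) = (ι ⊗ Δ)(u)(Δ ⊗ ι)(Ew)`. -/
theorem idDeltaAssoc_mul_lact (h : IsWeakBialgebraWith Δ E ε) (u w : A ⊗[ℂ] A) :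
    idDeltaAssoc Δ (ract E u) * deltaId Δ (lact E w) =
      idDeltaAssoc Δ u * deltaId Δ (lact E w) := by
  refine h.canonical.eq_left (LinearMap.mulLeft ℂ (idDeltaAssoc Δ (ract E u)) ∘ₗ deltaId Δ)
    (LinearMap.mulLeft ℂ (idDeltaAssoc Δ u) ∘ₗ deltaId Δ) (fun a m n => ?_) w
  rw [h.coproduct.lact_delta_tmul h.nondeg, LinearMap.comp_apply, LinearMap.comp_apply,
    LinearMap.mulLeft_apply, LinearMap.mulLeft_apply, ← deltaId_mul_delta, ← mul_assoc,
    ← mul_assoc]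
  congr 1
  refine tri₁_cancel_right h.nondeg fun c => ?_
  rw [mul_assoc, mul_assoc, h.coproduct.coassoc_right, ← mul_assoc, ← mul_assoc,
    ← WMB.idDeltaAssoc_mul, ← WMB.idDeltaAssoc_mul, h.coproduct.mul_dr₁, h.coproduct.mul_dr₁,
    ← ract_mul E (Δ a), h.canonical.mul_delta h.nondeg]

/-- `(ι ⊗ Δ)(Eu) = (E ⊗ 1)(ι ⊗ Δ)(u)`: the factors `Δ(a) ⊗ r` cancel from the left up to `E ⊗ 1`,
and after covering by them `deltaId_ract_mul` applies. -/
theorem idDeltaAssoc_lact (h : IsWeakBialgebraWith Δ E ε) (u : A ⊗[ℂ] A) :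
    idDeltaAssoc Δ (lact E u) = mtmul E 1 * idDeltaAssoc Δ u := by
  rw [← h.mul_idDeltaAssoc_lact]
  refine tri₃_cancel_left h.nondeg fun r => ?_
  have hX : ∀ u, tri₃ r * (mtmul E 1 * idDeltaAssoc Δ u) =
      mtmul E 1 * (tri₃ r * (mtmul E 1 * reassoc (mtmul 1 E) * idDeltaAssoc Δ u)) := by
    intro u
    rw [← mul_assoc (mtmul E 1) (tri₃ r), mtmul_mul_tri₃, mul_assoc, mul_assoc (mtmul E 1),
      h.canonical.mul_idDeltaAssoc h.nondeg, ← mul_assoc (mtmul E 1), mtmul_mul_mtmul,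
      h.canonical.idem, one_mul]
  have hΔ : ∀ a v, mtmul (Δ a) 1 *
      (tri₃ r * (mtmul E 1 * reassoc (mtmul 1 E) * idDeltaAssoc Δ v)) =
      deltaId Δ (ract E (a ⊗ₜ r)) * idDeltaAssoc Δ v := by
    intro a v
    rw [← mul_assoc, mtmul_mul_tri₃_eq, ← deltaId_tmul, ← mul_assoc, h.comult.delta_eq.delta_mul]
  rw [hX, hX]
  refine h.canonical.cancel_left h.nondeg fun a => ?_
  rw [hΔ, hΔ, h.deltaId_ract_mul]

/-- `(ι ⊗ Δ)(uE) = (ι ⊗ Δ)(u)(E ⊗ 1)`. -/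
theorem idDeltaAssoc_ract (h : IsWeakBialgebraWith Δ E ε) (u : A ⊗[ℂ] A) :
    idDeltaAssoc Δ (ract E u) = idDeltaAssoc Δ u * mtmul E 1 := by
  rw [← h.idDeltaAssoc_ract_mul]
  refine tri₃_cancel_right h.nondeg fun r => ?_
  have hX : ∀ u, idDeltaAssoc Δ u * mtmul E 1 * tri₃ r =
      idDeltaAssoc Δ u * (mtmul E 1 * reassoc (mtmul 1 E)) * tri₃ r * mtmul E 1 := by
    intro u
    rw [mul_assoc _ (tri₃ r) (mtmul E 1), ← mtmul_mul_tri₃, ← mul_assoc _ (mtmul E 1) (tri₃ r),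
      h.comult.comm, ← mul_assoc, h.canonical.idDeltaAssoc_mul_one h.nondeg,
      mul_assoc _ (mtmul E 1) (mtmul E 1), mtmul_mul_mtmul, h.canonical.idem, one_mul]
  have hΔ : ∀ a v, idDeltaAssoc Δ v * (mtmul E 1 * reassoc (mtmul 1 E)) * tri₃ r *
      mtmul (Δ a) 1 = idDeltaAssoc Δ v * deltaId Δ (lact E (a ⊗ₜ r)) := by
    intro a v
    rw [mul_assoc, ← mtmul_mul_tri₃, mtmul_mul_tri₃_eq, ← deltaId_tmul, mul_assoc,
      h.comult.delta_eq.mul_delta]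
  rw [hX, hX]
  refine h.canonical.cancel_right h.nondeg fun a => ?_
  rw [hΔ, hΔ, h.idDeltaAssoc_mul_lact]

end IsWeakBialgebraWith

end Comultiplicativity

/-! ### Slices by the counit -/

section Slicing

variable {A : Type*} [NonUnitalRing A] [Module ℂ A] {ε : A →ₗ[ℂ] ℂ}

@[simp] theorem sliceLeft_tmul (a b : A) : sliceLeft ε (a ⊗ₜ b) = ε a • b := by simp [sliceLeft]

@[simp] theorem sliceRight_tmul (a b : A) : sliceRight ε (a ⊗ₜ b) = ε b • a := by
  simp [sliceRight]

theorem sliceBoth_eq_right (t : A ⊗[ℂ] A) : sliceBoth ε t = ε (sliceRight ε t) := by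
  induction t using TensorProduct.induction_on with
  | zero => simp
  | add u v hu hv => simp only [map_add, hu, hv]
  | tmul u v => simp [sliceBoth, mul_comm]

/-- The slice map `ι ⊗ ε ⊗ ι`. -/
noncomputable def sliceMiddle (ε : A →ₗ[ℂ] ℂ) : (A ⊗[ℂ] A) ⊗[ℂ] A →ₗ[ℂ] A ⊗[ℂ] A :=
  (sliceRight ε).rTensor A

@[simp] theorem sliceMiddle_tmul (t : A ⊗[ℂ] A) (z : A) :
    sliceMiddle ε (t ⊗ₜ z) = sliceRight ε t ⊗ₜ z := rfl

@[simp] theorem sliceMiddle_assoc_symm (y : A) (t : A ⊗[ℂ] A) :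
    sliceMiddle ε ((TensorProduct.assoc ℂ A A A).symm (y ⊗ₜ t)) = y ⊗ₜ sliceLeft ε t := by
  induction t using TensorProduct.induction_on with
  | zero => simp
  | add u v hu hv => simp only [map_add, TensorProduct.tmul_add, hu, hv]
  | tmul u v => simp [TensorProduct.smul_tmul]

theorem rTensor_sliceLeft_assoc_symm (y : A) (t : A ⊗[ℂ] A) :
    (sliceLeft ε).rTensor A ((TensorProduct.assoc ℂ A A A).symm (y ⊗ₜ t)) = ε y • t := by
  induction t using TensorProduct.induction_on with
  | zero => simp
  | add u v hu hv => simp only [map_add, TensorProduct.tmul_add, smul_add, hu, hv]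
  | tmul u v => simp [TensorProduct.smul_tmul']

theorem lTensor_sliceRight_assoc (t : A ⊗[ℂ] A) (z : A) :
    (sliceRight ε).lTensor A (TensorProduct.assoc ℂ A A A (t ⊗ₜ z)) = ε z • t := by
  induction t using TensorProduct.induction_on with
  | zero => simp
  | add u v hu hv => simp only [map_add, TensorProduct.add_tmul, smul_add, hu, hv]
  | tmul u v => simp

end Slicing

section CounitalMaps

variable {A : Type*} [NonUnitalRing A] [Module ℂ A] [IsScalarTower ℂ A A] [SMulCommClass ℂ A A]
  {Δ : A →ₙₐ[ℂ] Multiplier (A ⊗[ℂ] A)} {E : Multiplier (A ⊗[ℂ] A)} {ε : A →ₗ[ℂ] ℂ}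

theorem sliceLeft_lact_leg₂ (a : A) (t : A ⊗[ℂ] A) :
    sliceLeft ε (lact (leg₂ a) t) = a * sliceLeft ε t := by
  induction t using TensorProduct.induction_on with
  | zero => simp
  | add u v hu hv => simp only [map_add, mul_add, hu, hv]
  | tmul u v => simp [mul_smul_comm]

theorem sliceLeft_ract_leg₂ (a : A) (t : A ⊗[ℂ] A) :
    sliceLeft ε (ract (leg₂ a) t) = sliceLeft ε t * a := by
  induction t using TensorProduct.induction_on with
  | zero => simp
  | add u v hu hv => simp only [map_add, add_mul, hu, hv]
  | tmul u v => simp [smul_mul_assoc]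

theorem sliceRight_lact_leg₁ (a : A) (t : A ⊗[ℂ] A) :
    sliceRight ε (lact (leg₁ a) t) = a * sliceRight ε t := by
  induction t using TensorProduct.induction_on with
  | zero => simp
  | add u v hu hv => simp only [map_add, mul_add, hu, hv]
  | tmul u v => simp [mul_smul_comm]

theorem sliceRight_ract_leg₁ (a : A) (t : A ⊗[ℂ] A) :
    sliceRight ε (ract (leg₁ a) t) = sliceRight ε t * a := by
  induction t using TensorProduct.induction_on with
  | zero => simp
  | add u v hu hv => simp only [map_add, add_mul, hu, hv]
  | tmul u v => simp [smul_mul_assoc]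

section Coproduct

variable (hA : IsNondegenerate A) (hΔ : IsRegularCoproduct Δ)

theorem IsRegularCoproduct.sliceLeft_dr₂ (hε : IsCounit Δ ε) (a b : A) :
    sliceLeft ε (hΔ.dr₂ hA b a) = a * b :=
  hε.left a b _ (hΔ.embed_dr₂ hA a b)

theorem IsRegularCoproduct.sliceRight_dl₁ (hε : IsCounit Δ ε) (a b : A) :
    sliceRight ε (hΔ.dl₁ hA b a) = b * a :=
  hε.right b a _ (hΔ.embed_dl₁ hA a b)

theorem IsRegularCoproduct.sliceLeft_dl₂ (hε : IsCounit Δ ε) (a b : A) :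
    sliceLeft ε (hΔ.dl₂ hA b a) = b * a := by
  refine sub_eq_zero.1 (hA.1 _ fun y => ?_)
  rw [sub_mul, sub_eq_zero, ← sliceLeft_ract_leg₂, hΔ.ract_leg₂_dl₂, sliceLeft_lact_leg₂,
    hΔ.sliceLeft_dr₂ hA hε, mul_assoc]

theorem IsRegularCoproduct.sliceRight_dr₁ (hε : IsCounit Δ ε) (a b : A) :
    sliceRight ε (hΔ.dr₁ hA b a) = a * b := by
  refine sub_eq_zero.1 (hA.2 _ fun y => ?_)
  rw [mul_sub, sub_eq_zero, ← sliceRight_lact_leg₁, ← hΔ.ract_leg₁_dl₁, sliceRight_ract_leg₁,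
    hΔ.sliceRight_dl₁ hA hε, mul_assoc]

theorem IsRegularCoproduct.lact_dr₁ (x a b : A) :
    lact (Δ x) (hΔ.dr₁ hA b a) = hΔ.dr₁ hA b (x * a) := by
  apply embed_injective (hA.tensor hA)
  rw [← mul_embed, hΔ.embed_dr₁, hΔ.embed_dr₁, map_mul, mul_assoc]

theorem IsRegularCoproduct.lact_dr₂ (x a b : A) :
    lact (Δ x) (hΔ.dr₂ hA b a) = hΔ.dr₂ hA b (x * a) := by
  apply embed_injective (hA.tensor hA)
  rw [← mul_embed, hΔ.embed_dr₂, hΔ.embed_dr₂, map_mul, mul_assoc]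

theorem IsRegularCoproduct.ract_dl₁ (x a b : A) :
    ract (Δ x) (hΔ.dl₁ hA b a) = hΔ.dl₁ hA b (a * x) := by
  apply embed_injective (hA.tensor hA)
  rw [← embed_mul_multiplier, hΔ.embed_dl₁, hΔ.embed_dl₁, map_mul, mul_assoc]

theorem IsRegularCoproduct.ract_dl₂ (x a b : A) :
    ract (Δ x) (hΔ.dl₂ hA b a) = hΔ.dl₂ hA b (a * x) := by
  apply embed_injective (hA.tensor hA)
  rw [← embed_mul_multiplier, hΔ.embed_dl₂, hΔ.embed_dl₂, map_mul, mul_assoc]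

/-- Coassociativity `(Δ ⊗ ι)(Δ(a)(1 ⊗ b))(c ⊗ 1 ⊗ 1) =
(ι ⊗ Δ)(Δ(a)(c ⊗ 1))(1 ⊗ 1 ⊗ b)` as an identity in `A ⊗ A ⊗ A`. -/
theorem IsRegularCoproduct.rTensor_dr₁ (a b c : A) :
    (hΔ.dr₁ hA c).rTensor A (hΔ.dr₂ hA b a) =
      (TensorProduct.assoc ℂ A A A).symm ((hΔ.dr₂ hA b).lTensor A (hΔ.dr₁ hA c a)) := by
  have h₁ : ∀ u, embed ((hΔ.dr₁ hA c).rTensor A u) = deltaId Δ u * tri₁ c := by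
    intro u
    induction u using TensorProduct.induction_on with
    | zero => simp
    | add u v hu hv => simp only [map_add, embed_add, add_mul, hu, hv]
    | tmul u v => simp [embed_tmul, hΔ.embed_dr₁, mtmul_mul_mtmul]
  have h₂ : ∀ u, embed ((TensorProduct.assoc ℂ A A A).symm ((hΔ.dr₂ hA b).lTensor A u)) =
      idDeltaAssoc Δ u * tri₃ b := by
    intro u
    induction u using TensorProduct.induction_on with
    | zero => simp
    | add u v hu hv => simp only [map_add, embed_add, add_mul, hu, hv]
    | tmul u v =>
      rw [LinearMap.lTensor_tmul, ← reassoc_embed, embed_tmul, hΔ.embed_dr₂, idDeltaAssoc_tmul,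
        tri₃_eq_reassoc, ← reassoc_mul, mtmul_mul_mtmul, mul_one]
  apply embed_injective ((hA.tensor hA).tensor hA)
  rw [h₁, h₂, hΔ.coassoc_right]

/-- Coassociativity `(c ⊗ 1 ⊗ 1)(Δ ⊗ ι)((1 ⊗ b)Δ(a)) =
(1 ⊗ 1 ⊗ b)(ι ⊗ Δ)((c ⊗ 1)Δ(a))` as an identity in `A ⊗ A ⊗ A`. -/
theorem IsRegularCoproduct.rTensor_dl₁ (a b c : A) :
    (hΔ.dl₁ hA c).rTensor A (hΔ.dl₂ hA b a) =
      (TensorProduct.assoc ℂ A A A).symm ((hΔ.dl₂ hA b).lTensor A (hΔ.dl₁ hA c a)) := by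
  have h₁ : ∀ u, embed ((hΔ.dl₁ hA c).rTensor A u) = tri₁ c * deltaId Δ u := by
    intro u
    induction u using TensorProduct.induction_on with
    | zero => simp
    | add u v hu hv => simp only [map_add, embed_add, mul_add, hu, hv]
    | tmul u v => simp [embed_tmul, hΔ.embed_dl₁, mtmul_mul_mtmul]
  have h₂ : ∀ u, embed ((TensorProduct.assoc ℂ A A A).symm ((hΔ.dl₂ hA b).lTensor A u)) =
      tri₃ b * idDeltaAssoc Δ u := by
    intro u
    induction u using TensorProduct.induction_on with
    | zero => simp
    | add u v hu hv => simp only [map_add, embed_add, mul_add, hu, hv]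
    | tmul u v =>
      rw [LinearMap.lTensor_tmul, ← reassoc_embed, embed_tmul, hΔ.embed_dl₂, idDeltaAssoc_tmul,
        tri₃_eq_reassoc, ← reassoc_mul, mtmul_mul_mtmul, one_mul]
  apply embed_injective ((hA.tensor hA).tensor hA)
  rw [h₁, h₂, hΔ.coassoc_left]

end Coproduct

namespace IsWeakBialgebraWith

/-- In Sweedler notation, `ε(rpb) = ε(r p₂) ε(p₁ b)`. -/
theorem counit_mul_dr₁ (h : IsWeakBialgebraWith Δ E ε) (r p b : A) :
    ε (r * (p * b)) = ε (r * sliceLeft ε (h.coproduct.dr₁ h.nondeg b p)) := by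
  rw [← mul_assoc, h.weakMul.second r p b (lact (leg₂ r) (h.coproduct.dr₁ h.nondeg b p)),
    sliceBoth, LinearMap.comp_apply, sliceLeft_lact_leg₂]
  rw [← mul_embed, h.coproduct.embed_dr₁, mul_assoc]

/-- In Sweedler notation, `ε(rpb) = ε(r p₁) ε(p₂ b)`. -/
theorem counit_mul_dr₂ (h : IsWeakBialgebraWith Δ E ε) (r p b : A) :
    ε (r * (p * b)) = ε (r * sliceRight ε (h.coproduct.dr₂ h.nondeg b p)) := by
  rw [← mul_assoc, h.weakMul.first r p b (lact (leg₁ r) (h.coproduct.dr₂ h.nondeg b p)),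
    sliceBoth_eq_right, sliceRight_lact_leg₁]
  rw [← mul_embed, h.coproduct.embed_dr₂, mul_assoc]

/-- In Sweedler notation, `ε(apr) = ε(a p₁) ε(p₂ r)`. -/
theorem counit_dl₁_mul (h : IsWeakBialgebraWith Δ E ε) (a p r : A) :
    ε (a * p * r) = ε (sliceLeft ε (h.coproduct.dl₁ h.nondeg a p) * r) := by
  rw [h.weakMul.first a p r (ract (leg₂ r) (h.coproduct.dl₁ h.nondeg a p)),
    sliceBoth, LinearMap.comp_apply, sliceLeft_ract_leg₂]
  rw [← embed_mul_multiplier, h.coproduct.embed_dl₁]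

/-- In Sweedler notation, `ε(apr) = ε(a p₂) ε(p₁ r)`. -/
theorem counit_dl₂_mul (h : IsWeakBialgebraWith Δ E ε) (a p r : A) :
    ε (a * p * r) = ε (sliceRight ε (h.coproduct.dl₂ h.nondeg a p) * r) := by
  rw [h.weakMul.second a p r (ract (leg₁ r) (h.coproduct.dl₂ h.nondeg a p)),
    sliceBoth_eq_right, sliceRight_ract_leg₁]
  rw [← embed_mul_multiplier, h.coproduct.embed_dl₂]

/-- `(ε ⊗ ι)(Δ(x)(b ⊗ y)) = x (ε ⊗ ι)(E(b ⊗ y))`. -/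
theorem sliceLeft_lact_delta (h : IsWeakBialgebraWith Δ E ε) (x : A) (u : A ⊗[ℂ] A) :
    sliceLeft ε (lact (Δ x) u) = x * sliceLeft ε (lact E u) := by
  have hA := h.nondeg
  have hΔ := h.coproduct
  rw [← h.canonical.delta_mul hA x, lact_mul]
  refine h.canonical.eq_left (sliceLeft ε ∘ₗ lact (Δ x)) (LinearMap.mulLeft ℂ x ∘ₗ sliceLeft ε)
    (fun w b y => ?_) u
  -- In Sweedler notation, weak multiplicativity gives
  -- `ε(x₁w₁b)x₂w₂y = ε(w₁b)ε(x₁w₂)x₂w₃y`, and the counit property reduces this to `ε(w₁b)xw₂y`.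
  let G : (A ⊗[ℂ] A) ⊗[ℂ] A →ₗ[ℂ] A := sliceLeft ε ∘ₗ lact (Δ x) ∘ₗ (sliceLeft ε).rTensor A
  have h₁ : ∀ u, sliceLeft ε (lact (Δ x) (ract (leg₁ b) u)) =
      G ((hΔ.dr₁ hA b).rTensor A u) := by
    intro u
    induction u using TensorProduct.induction_on with
    | zero => simp
    | add u v hu hv => simp only [map_add, hu, hv]
    | tmul p q =>
      simp only [G, LinearMap.comp_apply, LinearMap.rTensor_tmul, ract_mtmul,
        TensorProduct.map_tmul, ract_embed, ract_one, LinearMap.id_apply, hΔ.lact_delta_tmul hA]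
      induction hΔ.dr₂ hA q x using TensorProduct.induction_on with
      | zero => simp
      | add u v hu hv => simp only [map_add, hu, hv]
      | tmul r s => simp [h.counit_mul_dr₁ r p b]
  have h₂ : ∀ u, G ((TensorProduct.assoc ℂ A A A).symm ((hΔ.dr₂ hA y).lTensor A u)) =
      x * sliceLeft ε u * y := by
    intro u
    induction u using TensorProduct.induction_on with
    | zero => simp
    | add u v hu hv => simp only [map_add, mul_add, add_mul, hu, hv]
    | tmul m n =>
      simp only [G, LinearMap.comp_apply, LinearMap.lTensor_tmul, rTensor_sliceLeft_assoc_symm,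
        map_smul, hΔ.lact_dr₂, hΔ.sliceLeft_dr₂ hA h.counit, sliceLeft_tmul, mul_smul_comm,
        smul_mul_assoc]
  rw [LinearMap.comp_apply, LinearMap.comp_apply, hΔ.lact_delta_tmul hA, h₁, hΔ.rTensor_dr₁, h₂,
    LinearMap.mulLeft_apply, ← hΔ.lact_delta_tmul, hΔ.lact_delta_tmul' hA, sliceLeft_ract_leg₂,
    mul_assoc]

/-- `(ι ⊗ ε)(Δ(x)(y ⊗ b)) = x (ι ⊗ ε)(E(y ⊗ b))`. -/
theorem sliceRight_lact_delta (h : IsWeakBialgebraWith Δ E ε) (x : A) (u : A ⊗[ℂ] A) :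
    sliceRight ε (lact (Δ x) u) = x * sliceRight ε (lact E u) := by
  have hA := h.nondeg
  have hΔ := h.coproduct
  rw [← h.canonical.delta_mul hA x, lact_mul]
  refine h.canonical.eq_left (sliceRight ε ∘ₗ lact (Δ x)) (LinearMap.mulLeft ℂ x ∘ₗ sliceRight ε)
    (fun w y b => ?_) u
  let G : A ⊗[ℂ] (A ⊗[ℂ] A) →ₗ[ℂ] A := sliceRight ε ∘ₗ lact (Δ x) ∘ₗ (sliceRight ε).lTensor A
  have h₁ : ∀ u, sliceRight ε (lact (Δ x) (ract (leg₂ b) u)) =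
      G ((hΔ.dr₂ hA b).lTensor A u) := by
    intro u
    induction u using TensorProduct.induction_on with
    | zero => simp
    | add u v hu hv => simp only [map_add, hu, hv]
    | tmul p q =>
      simp only [G, LinearMap.comp_apply, LinearMap.lTensor_tmul, ract_mtmul,
        TensorProduct.map_tmul, ract_embed, ract_one, LinearMap.id_apply, hΔ.lact_delta_tmul' hA]
      induction hΔ.dr₁ hA p x using TensorProduct.induction_on with
      | zero => simp
      | add u v hu hv => simp only [map_add, hu, hv]
      | tmul r s => simp [h.counit_mul_dr₂ s q b]
  have h₂ : ∀ u, G (TensorProduct.assoc ℂ A A A ((hΔ.dr₁ hA y).rTensor A u)) =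
      x * sliceRight ε u * y := by
    intro u
    induction u using TensorProduct.induction_on with
    | zero => simp
    | add u v hu hv => simp only [map_add, mul_add, add_mul, hu, hv]
    | tmul m n =>
      simp only [G, LinearMap.comp_apply, LinearMap.rTensor_tmul, lTensor_sliceRight_assoc,
        map_smul, hΔ.lact_dr₁, hΔ.sliceRight_dr₁ hA h.counit, sliceRight_tmul, mul_smul_comm,
        smul_mul_assoc]
  rw [LinearMap.comp_apply, LinearMap.comp_apply, hΔ.lact_delta_tmul' hA, h₁,
    ← LinearEquiv.apply_symm_apply (TensorProduct.assoc ℂ A A A) ((hΔ.dr₂ hA b).lTensor A _),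
    ← hΔ.rTensor_dr₁, h₂,
    LinearMap.mulLeft_apply, ← hΔ.lact_delta_tmul', hΔ.lact_delta_tmul hA, sliceRight_ract_leg₁,
    mul_assoc]

/-- `(ε ⊗ ι)((a ⊗ y)Δ(x)) = (ε ⊗ ι)((a ⊗ y)E) x`. -/
theorem sliceLeft_ract_delta (h : IsWeakBialgebraWith Δ E ε) (x : A) (u : A ⊗[ℂ] A) :
    sliceLeft ε (ract (Δ x) u) = sliceLeft ε (ract E u) * x := by
  have hA := h.nondeg
  have hΔ := h.coproduct
  rw [← h.canonical.mul_delta hA x, ract_mul]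
  refine h.canonical.eq_right (sliceLeft ε ∘ₗ ract (Δ x)) (LinearMap.mulRight ℂ x ∘ₗ sliceLeft ε)
    (fun w a y => ?_) u
  let G : (A ⊗[ℂ] A) ⊗[ℂ] A →ₗ[ℂ] A := sliceLeft ε ∘ₗ ract (Δ x) ∘ₗ (sliceLeft ε).rTensor A
  have h₁ : ∀ u, sliceLeft ε (ract (Δ x) (lact (leg₁ a) u)) =
      G ((hΔ.dl₁ hA a).rTensor A u) := by
    intro u
    induction u using TensorProduct.induction_on with
    | zero => simp
    | add u v hu hv => simp only [map_add, hu, hv]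
    | tmul p q =>
      simp only [G, LinearMap.comp_apply, LinearMap.rTensor_tmul, lact_mtmul,
        TensorProduct.map_tmul, lact_embed, lact_one, LinearMap.id_apply, hΔ.ract_delta_tmul hA]
      induction hΔ.dl₂ hA q x using TensorProduct.induction_on with
      | zero => simp
      | add u v hu hv => simp only [map_add, hu, hv]
      | tmul r s => simp [h.counit_dl₁_mul a p r]
  have h₂ : ∀ u, G ((TensorProduct.assoc ℂ A A A).symm ((hΔ.dl₂ hA y).lTensor A u)) =
      y * (sliceLeft ε u * x) := by
    intro u
    induction u using TensorProduct.induction_on with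
    | zero => simp
    | add u v hu hv => simp only [map_add, mul_add, add_mul, hu, hv]
    | tmul m n =>
      simp only [G, LinearMap.comp_apply, LinearMap.lTensor_tmul, rTensor_sliceLeft_assoc_symm,
        map_smul, hΔ.ract_dl₂, hΔ.sliceLeft_dl₂ hA h.counit, sliceLeft_tmul, mul_smul_comm,
        smul_mul_assoc]
  rw [LinearMap.comp_apply, LinearMap.comp_apply, hΔ.ract_delta_tmul hA, h₁, hΔ.rTensor_dl₁, h₂,
    LinearMap.mulRight_apply, ← hΔ.ract_delta_tmul, hΔ.ract_delta_tmul' hA, sliceLeft_lact_leg₂,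
    mul_assoc]

/-- `(ι ⊗ ε)((y ⊗ a)Δ(x)) = (ι ⊗ ε)((y ⊗ a)E) x`. -/
theorem sliceRight_ract_delta (h : IsWeakBialgebraWith Δ E ε) (x : A) (u : A ⊗[ℂ] A) :
    sliceRight ε (ract (Δ x) u) = sliceRight ε (ract E u) * x := by
  have hA := h.nondeg
  have hΔ := h.coproduct
  rw [← h.canonical.mul_delta hA x, ract_mul]
  refine h.canonical.eq_right (sliceRight ε ∘ₗ ract (Δ x))
    (LinearMap.mulRight ℂ x ∘ₗ sliceRight ε) (fun w y a => ?_) u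
  let G : A ⊗[ℂ] (A ⊗[ℂ] A) →ₗ[ℂ] A := sliceRight ε ∘ₗ ract (Δ x) ∘ₗ (sliceRight ε).lTensor A
  have h₁ : ∀ u, sliceRight ε (ract (Δ x) (lact (leg₂ a) u)) =
      G ((hΔ.dl₂ hA a).lTensor A u) := by
    intro u
    induction u using TensorProduct.induction_on with
    | zero => simp
    | add u v hu hv => simp only [map_add, hu, hv]
    | tmul p q =>
      simp only [G, LinearMap.comp_apply, LinearMap.lTensor_tmul, lact_mtmul,
        TensorProduct.map_tmul, lact_embed, lact_one, LinearMap.id_apply, hΔ.ract_delta_tmul' hA]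
      induction hΔ.dl₁ hA p x using TensorProduct.induction_on with
      | zero => simp
      | add u v hu hv => simp only [map_add, hu, hv]
      | tmul r s => simp [h.counit_dl₂_mul a q s]
  have h₂ : ∀ u, G (TensorProduct.assoc ℂ A A A ((hΔ.dl₁ hA y).rTensor A u)) =
      y * (sliceRight ε u * x) := by
    intro u
    induction u using TensorProduct.induction_on with
    | zero => simp
    | add u v hu hv => simp only [map_add, mul_add, add_mul, hu, hv]
    | tmul m n =>
      simp only [G, LinearMap.comp_apply, LinearMap.rTensor_tmul, lTensor_sliceRight_assoc,
        map_smul, hΔ.ract_dl₁, hΔ.sliceRight_dl₁ hA h.counit, sliceRight_tmul, mul_smul_comm,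
        smul_mul_assoc]
  rw [LinearMap.comp_apply, LinearMap.comp_apply, hΔ.ract_delta_tmul' hA, h₁,
    ← LinearEquiv.apply_symm_apply (TensorProduct.assoc ℂ A A A) ((hΔ.dl₂ hA a).lTensor A _),
    ← hΔ.rTensor_dl₁, h₂,
    LinearMap.mulRight_apply, ← hΔ.ract_delta_tmul', hΔ.ract_delta_tmul hA, sliceRight_lact_leg₁,
    mul_assoc]

end IsWeakBialgebraWith

end CounitalMaps

/-! ### The counital maps and the slices of the canonical idempotent -/

section CounitalMaps

/-- A pair of linear maps `L`, `R` with `R(x) y = x L(y)` is a multiplier, if the product is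
non-degenerate. -/
def mkMultiplier {X : Type*} [NonUnitalRing X] [Module ℂ X] [IsScalarTower ℂ X X]
    [SMulCommClass ℂ X X] (hX : IsNondegenerate X) (L R : X →ₗ[ℂ] X)
    (hLR : ∀ x y, R x * y = x * L y) : Multiplier X :=
  (⟨(L, MulOpposite.op R), fun x y => sub_eq_zero.1 (hX.2 _ fun z => by
      rw [mul_sub, ← hLR, ← mul_assoc, hLR, mul_assoc, sub_self]),
    fun x y => sub_eq_zero.1 (hX.1 _ fun z => by
      rw [sub_mul, MulOpposite.unop_op, hLR, mul_assoc, mul_assoc, hLR, sub_self]), hLR⟩ :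
    multiplierSubalgebra X)

@[simp] theorem lact_mkMultiplier {X : Type*} [NonUnitalRing X] [Module ℂ X] [IsScalarTower ℂ X X]
    [SMulCommClass ℂ X X] (hX : IsNondegenerate X) (L R : X →ₗ[ℂ] X)
    (hLR : ∀ x y, R x * y = x * L y) : lact (mkMultiplier hX L R hLR) = L := rfl

@[simp] theorem ract_mkMultiplier {X : Type*} [NonUnitalRing X] [Module ℂ X] [IsScalarTower ℂ X X]
    [SMulCommClass ℂ X X] (hX : IsNondegenerate X) (L R : X →ₗ[ℂ] X)
    (hLR : ∀ x y, R x * y = x * L y) : ract (mkMultiplier hX L R hLR) = R := rfl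

variable {A : Type*} [NonUnitalRing A] [Module ℂ A] [IsScalarTower ℂ A A] [SMulCommClass ℂ A A]
  {Δ : A →ₙₐ[ℂ] Multiplier (A ⊗[ℂ] A)} {E : Multiplier (A ⊗[ℂ] A)} {ε : A →ₗ[ℂ] ℂ}

namespace IsWeakBialgebraWith

/-- The target counital map `a ↦ (ε ⊗ ι)(E(a ⊗ 1))`. -/
noncomputable def target (h : IsWeakBialgebraWith Δ E ε) : A →ₗ[ℂ] Multiplier A where
  toFun a := mkMultiplier h.nondeg (sliceLeft ε ∘ₗ lact E ∘ₗ TensorProduct.mk ℂ A A a)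
    (sliceLeft ε ∘ₗ h.coproduct.dr₁ h.nondeg a) fun x y => by
      simp only [LinearMap.comp_apply, TensorProduct.mk_apply]
      rw [← sliceLeft_ract_leg₂, ← h.coproduct.lact_delta_tmul', h.sliceLeft_lact_delta]
  map_add' a b := ext_lact h.nondeg fun x => by simp
  map_smul' c a := ext_lact h.nondeg fun x => by
    change sliceLeft ε (lact E ((c • a) ⊗ₜ x)) = c • sliceLeft ε (lact E (a ⊗ₜ x))
    rw [← TensorProduct.smul_tmul', map_smul, map_smul]

/-- The map `a ↦ (ε ⊗ ι)((a ⊗ 1)E)`. -/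
noncomputable def target' (h : IsWeakBialgebraWith Δ E ε) : A →ₗ[ℂ] Multiplier A where
  toFun a := mkMultiplier h.nondeg (sliceLeft ε ∘ₗ h.coproduct.dl₁ h.nondeg a)
    (sliceLeft ε ∘ₗ ract E ∘ₗ TensorProduct.mk ℂ A A a) fun x y => by
      simp only [LinearMap.comp_apply, TensorProduct.mk_apply]
      rw [← sliceLeft_lact_leg₂, ← h.coproduct.ract_delta_tmul', h.sliceLeft_ract_delta]
  map_add' a b := ext_ract h.nondeg fun x => by simp
  map_smul' c a := ext_ract h.nondeg fun x => by
    change sliceLeft ε (ract E ((c • a) ⊗ₜ x)) = c • sliceLeft ε (ract E (a ⊗ₜ x))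
    rw [← TensorProduct.smul_tmul', map_smul, map_smul]

/-- The source counital map `a ↦ (ι ⊗ ε)((1 ⊗ a)E)`. -/
noncomputable def source (h : IsWeakBialgebraWith Δ E ε) : A →ₗ[ℂ] Multiplier A where
  toFun a := mkMultiplier h.nondeg (sliceRight ε ∘ₗ h.coproduct.dl₂ h.nondeg a)
    (sliceRight ε ∘ₗ ract E ∘ₗ (TensorProduct.mk ℂ A A).flip a) fun x y => by
      simp only [LinearMap.comp_apply, TensorProduct.mk_apply, LinearMap.flip_apply]
      rw [← sliceRight_lact_leg₁, ← h.coproduct.ract_delta_tmul, h.sliceRight_ract_delta]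
  map_add' a b := ext_ract h.nondeg fun x => by simp
  map_smul' c a := ext_ract h.nondeg fun x => by
    change sliceRight ε (ract E (x ⊗ₜ (c • a))) = c • sliceRight ε (ract E (x ⊗ₜ a))
    rw [TensorProduct.tmul_smul, map_smul, map_smul]

/-- The map `a ↦ (ι ⊗ ε)(E(1 ⊗ a))`. -/
noncomputable def source' (h : IsWeakBialgebraWith Δ E ε) : A →ₗ[ℂ] Multiplier A where
  toFun a := mkMultiplier h.nondeg (sliceRight ε ∘ₗ lact E ∘ₗ (TensorProduct.mk ℂ A A).flip a)
    (sliceRight ε ∘ₗ h.coproduct.dr₂ h.nondeg a) fun x y => by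
      simp only [LinearMap.comp_apply, TensorProduct.mk_apply, LinearMap.flip_apply]
      rw [← sliceRight_ract_leg₁, ← h.coproduct.lact_delta_tmul, h.sliceRight_lact_delta]
  map_add' a b := ext_lact h.nondeg fun x => by simp
  map_smul' c a := ext_lact h.nondeg fun x => by
    change sliceRight ε (lact E (x ⊗ₜ (c • a))) = c • sliceRight ε (lact E (x ⊗ₜ a))
    rw [TensorProduct.tmul_smul, map_smul, map_smul]

theorem lact_target (h : IsWeakBialgebraWith Δ E ε) (a x : A) :
    lact (h.target a) x = sliceLeft ε (lact E (a ⊗ₜ x)) := rfl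

theorem ract_target' (h : IsWeakBialgebraWith Δ E ε) (a x : A) :
    ract (h.target' a) x = sliceLeft ε (ract E (a ⊗ₜ x)) := rfl

theorem ract_source (h : IsWeakBialgebraWith Δ E ε) (a x : A) :
    ract (h.source a) x = sliceRight ε (ract E (x ⊗ₜ a)) := rfl

theorem lact_source' (h : IsWeakBialgebraWith Δ E ε) (a x : A) :
    lact (h.source' a) x = sliceRight ε (lact E (x ⊗ₜ a)) := rfl

/-- Since `A = A²`, linear maps on `A` that agree on products are equal. -/
theorem eq_of_mul (h : IsWeakBialgebraWith Δ E ε) {W : Type*} [AddCommGroup W] [Module ℂ W]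
    (f g : A →ₗ[ℂ] W) (hfg : ∀ x y, f (x * y) = g (x * y)) (x : A) : f x = g x := by
  have hs : Set.EqOn f g (Submodule.span ℂ {z : A | ∃ x y, z = x * y}) := by
    refine LinearMap.eqOn_span ?_
    rintro _ ⟨x, y, rfl⟩
    exact hfg x y
  have := h.idem
  rw [IsIdempotentAlg] at this
  exact hs (by rw [this]; trivial)

/-- `E(1 ⊗ (ε ⊗ ι)(v)) = (ι ⊗ ε ⊗ ι)((E ⊗ 1)(1 ⊗ v))` for `v ∈ E(A ⊗ A)`. -/
theorem lact_tmul_sliceLeft (h : IsWeakBialgebraWith Δ E ε) (y : A) (u : A ⊗[ℂ] A) :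
    lact E (y ⊗ₜ sliceLeft ε (lact E u)) = sliceMiddle ε (lact (mtmul E 1)
      ((TensorProduct.assoc ℂ A A A).symm (y ⊗ₜ lact E u))) := by
  refine h.canonical.eq_left (lact E ∘ₗ TensorProduct.mk ℂ A A y ∘ₗ sliceLeft ε)
    (sliceMiddle ε ∘ₗ lact (mtmul E 1) ∘ₗ (TensorProduct.assoc ℂ A A A).symm.toLinearMap ∘ₗ
      TensorProduct.mk ℂ A (A ⊗[ℂ] A) y) (fun w b z => ?_) u
  simp only [LinearMap.comp_apply, TensorProduct.mk_apply, LinearEquiv.coe_coe]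
  refine h.eq_of_mul (lact E ∘ₗ (TensorProduct.mk ℂ A A).flip _)
    (sliceMiddle ε ∘ₗ lact (mtmul E 1) ∘ₗ (TensorProduct.assoc ℂ A A A).symm.toLinearMap ∘ₗ
      (TensorProduct.mk ℂ A (A ⊗[ℂ] A)).flip _) (fun y₁ y₂ => ?_) y
  simp only [LinearMap.comp_apply, TensorProduct.mk_apply, LinearEquiv.coe_coe,
    LinearMap.flip_apply]
  have h₁ : (TensorProduct.assoc ℂ A A A).symm ((y₁ * y₂) ⊗ₜ lact (Δ w) (b ⊗ₜ z)) =
      lact (idDeltaAssoc Δ (y₁ ⊗ₜ w)) ((TensorProduct.assoc ℂ A A A).symm (y₂ ⊗ₜ (b ⊗ₜ z))) := by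
    simp [lact_reassoc]
  have h₂ : ∀ u, sliceMiddle ε (lact (idDeltaAssoc Δ u)
      ((TensorProduct.assoc ℂ A A A).symm (y₂ ⊗ₜ (b ⊗ₜ z)))) =
      u * y₂ ⊗ₜ sliceLeft ε (lact E (b ⊗ₜ z)) := by
    intro u
    induction u using TensorProduct.induction_on with
    | zero => simp
    | add u v hu hv => simp only [map_add, lact_add, add_mul, hu, hv]
    | tmul p q => simp [lact_reassoc, h.sliceLeft_lact_delta]
  rw [h₁, ← lact_mul, ← h.idDeltaAssoc_lact, h₂, ← lact_apply_mul,
    Algebra.TensorProduct.tmul_mul_tmul, h.sliceLeft_lact_delta]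

/-- `E((ι ⊗ ε)(v) ⊗ 1) = (ι ⊗ ε ⊗ ι)((1 ⊗ E)(v ⊗ 1))` for `v ∈ E(A ⊗ A)`. -/
theorem lact_sliceRight_tmul (h : IsWeakBialgebraWith Δ E ε) (z : A) (u : A ⊗[ℂ] A) :
    lact E (sliceRight ε (lact E u) ⊗ₜ z) = sliceMiddle ε (lact (reassoc (mtmul 1 E))
      (lact E u ⊗ₜ z)) := by
  refine h.canonical.eq_left (lact E ∘ₗ (TensorProduct.mk ℂ A A).flip z ∘ₗ sliceRight ε)
    (sliceMiddle ε ∘ₗ lact (reassoc (mtmul 1 E)) ∘ₗ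
      (TensorProduct.mk ℂ (A ⊗[ℂ] A) A).flip z) (fun w y b => ?_) u
  simp only [LinearMap.comp_apply, TensorProduct.mk_apply, LinearMap.flip_apply]
  refine h.eq_of_mul (lact E ∘ₗ TensorProduct.mk ℂ A A _)
    (sliceMiddle ε ∘ₗ lact (reassoc (mtmul 1 E)) ∘ₗ
      TensorProduct.mk ℂ (A ⊗[ℂ] A) A _) (fun z₁ z₂ => ?_) z
  simp only [LinearMap.comp_apply, TensorProduct.mk_apply]
  have h₁ : lact (Δ w) (y ⊗ₜ b) ⊗ₜ[ℂ] (z₁ * z₂) =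
      lact (deltaId Δ (w ⊗ₜ z₁)) ((y ⊗ₜ b) ⊗ₜ z₂) := by
    simp
  have h₂ : ∀ u, sliceMiddle ε (lact (deltaId Δ u) ((y ⊗ₜ b) ⊗ₜ z₂)) =
      u * sliceRight ε (lact E (y ⊗ₜ b)) ⊗ₜ z₂ := by
    intro u
    induction u using TensorProduct.induction_on with
    | zero => simp
    | add u v hu hv => simp only [map_add, lact_add, add_mul, hu, hv]
    | tmul p q => simp [h.sliceRight_lact_delta]
  rw [h₁, ← lact_mul, ← h.deltaId_lact, h₂, ← lact_apply_mul,
    Algebra.TensorProduct.tmul_mul_tmul, h.sliceRight_lact_delta]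

/-- `(1 ⊗ (ε ⊗ ι)(v))E = (ι ⊗ ε ⊗ ι)((1 ⊗ v)(E ⊗ 1))` for `v ∈ (A ⊗ A)E`. -/
theorem ract_tmul_sliceLeft (h : IsWeakBialgebraWith Δ E ε) (y : A) (u : A ⊗[ℂ] A) :
    ract E (y ⊗ₜ sliceLeft ε (ract E u)) = sliceMiddle ε (ract (mtmul E 1)
      ((TensorProduct.assoc ℂ A A A).symm (y ⊗ₜ ract E u))) := by
  refine h.canonical.eq_right (ract E ∘ₗ TensorProduct.mk ℂ A A y ∘ₗ sliceLeft ε)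
    (sliceMiddle ε ∘ₗ ract (mtmul E 1) ∘ₗ (TensorProduct.assoc ℂ A A A).symm.toLinearMap ∘ₗ
      TensorProduct.mk ℂ A (A ⊗[ℂ] A) y) (fun w b z => ?_) u
  simp only [LinearMap.comp_apply, TensorProduct.mk_apply, LinearEquiv.coe_coe]
  refine h.eq_of_mul (ract E ∘ₗ (TensorProduct.mk ℂ A A).flip _)
    (sliceMiddle ε ∘ₗ ract (mtmul E 1) ∘ₗ (TensorProduct.assoc ℂ A A A).symm.toLinearMap ∘ₗ
      (TensorProduct.mk ℂ A (A ⊗[ℂ] A)).flip _) (fun y₁ y₂ => ?_) y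
  simp only [LinearMap.comp_apply, TensorProduct.mk_apply, LinearEquiv.coe_coe,
    LinearMap.flip_apply]
  have h₁ : (TensorProduct.assoc ℂ A A A).symm ((y₁ * y₂) ⊗ₜ ract (Δ w) (b ⊗ₜ z)) =
      ract (idDeltaAssoc Δ (y₂ ⊗ₜ w)) ((TensorProduct.assoc ℂ A A A).symm (y₁ ⊗ₜ (b ⊗ₜ z))) := by
    simp [ract_reassoc]
  have h₂ : ∀ u, sliceMiddle ε (ract (idDeltaAssoc Δ u)
      ((TensorProduct.assoc ℂ A A A).symm (y₁ ⊗ₜ (b ⊗ₜ z)))) =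
      y₁ ⊗ₜ sliceLeft ε (ract E (b ⊗ₜ z)) * u := by
    intro u
    induction u using TensorProduct.induction_on with
    | zero => simp
    | add u v hu hv => simp only [map_add, ract_add, mul_add, hu, hv]
    | tmul p q => simp [ract_reassoc, h.sliceLeft_ract_delta]
  rw [h₁, ← ract_mul, ← h.idDeltaAssoc_ract, h₂, ← ract_apply_mul,
    Algebra.TensorProduct.tmul_mul_tmul, h.sliceLeft_ract_delta]

/-- `((ι ⊗ ε)(v) ⊗ 1)E = (ι ⊗ ε ⊗ ι)((v ⊗ 1)(1 ⊗ E))` for `v ∈ (A ⊗ A)E`. -/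
theorem ract_sliceRight_tmul (h : IsWeakBialgebraWith Δ E ε) (z : A) (u : A ⊗[ℂ] A) :
    ract E (sliceRight ε (ract E u) ⊗ₜ z) = sliceMiddle ε (ract (reassoc (mtmul 1 E))
      (ract E u ⊗ₜ z)) := by
  refine h.canonical.eq_right (ract E ∘ₗ (TensorProduct.mk ℂ A A).flip z ∘ₗ sliceRight ε)
    (sliceMiddle ε ∘ₗ ract (reassoc (mtmul 1 E)) ∘ₗ
      (TensorProduct.mk ℂ (A ⊗[ℂ] A) A).flip z) (fun w y b => ?_) u
  simp only [LinearMap.comp_apply, TensorProduct.mk_apply, LinearMap.flip_apply]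
  refine h.eq_of_mul (ract E ∘ₗ TensorProduct.mk ℂ A A _)
    (sliceMiddle ε ∘ₗ ract (reassoc (mtmul 1 E)) ∘ₗ
      TensorProduct.mk ℂ (A ⊗[ℂ] A) A _) (fun z₁ z₂ => ?_) z
  simp only [LinearMap.comp_apply, TensorProduct.mk_apply]
  have h₁ : ract (Δ w) (y ⊗ₜ b) ⊗ₜ[ℂ] (z₁ * z₂) =
      ract (deltaId Δ (w ⊗ₜ z₂)) ((y ⊗ₜ b) ⊗ₜ z₁) := by
    simp
  have h₂ : ∀ u, sliceMiddle ε (ract (deltaId Δ u) ((y ⊗ₜ b) ⊗ₜ z₁)) =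
      sliceRight ε (ract E (y ⊗ₜ b)) ⊗ₜ z₁ * u := by
    intro u
    induction u using TensorProduct.induction_on with
    | zero => simp
    | add u v hu hv => simp only [map_add, ract_add, mul_add, hu, hv]
    | tmul p q => simp [h.sliceRight_ract_delta]
  rw [h₁, ← ract_mul, ← h.deltaId_ract, h₂, ← ract_apply_mul,
    Algebra.TensorProduct.tmul_mul_tmul, h.sliceRight_ract_delta]

end IsWeakBialgebraWith

end CounitalMaps

/-! ### The legs of the canonical idempotent -/

section Legs

variable {A : Type*} [NonUnitalRing A] [Module ℂ A] [IsScalarTower ℂ A A] [SMulCommClass ℂ A A]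
  {Δ : A →ₙₐ[ℂ] Multiplier (A ⊗[ℂ] A)} {E : Multiplier (A ⊗[ℂ] A)} {ε : A →ₗ[ℂ] ℂ}

section Full

variable (hA : IsNondegenerate A) (hΔ : IsRegularCoproduct Δ)

/-- If `f ⊗ ι` vanishes on `Δ(A)(1 ⊗ A)`, then `f` vanishes. -/
theorem IsFull.eq_zero_left (hF : IsFull Δ) {W : Type*} [AddCommGroup W] [Module ℂ W]
    (f : A →ₗ[ℂ] W) (hf : ∀ a b, f.rTensor A (hΔ.dr₂ hA b a) = 0) : f = 0 := by
  refine LinearMap.ker_eq_top.1 (hF (LinearMap.ker f) ⊤ (fun a b => ?_) (fun a b => ?_)).1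
  · exact ⟨_, (Module.Flat.rTensor_exact A (LinearMap.exact_subtype_ker_map f) _).1 (hf a b),
      hΔ.embed_dr₂ hA a b⟩
  · exact ⟨_, LinearMap.lTensor_surjective A (fun x => ⟨⟨x, trivial⟩, rfl⟩) (hΔ.dl₁ hA b a),
      hΔ.embed_dl₁ hA a b⟩

/-- If `ι ⊗ f` vanishes on `(A ⊗ 1)Δ(A)`, then `f` vanishes. -/
theorem IsFull.eq_zero_right (hF : IsFull Δ) {W : Type*} [AddCommGroup W] [Module ℂ W]
    (f : A →ₗ[ℂ] W) (hf : ∀ a b, f.lTensor A (hΔ.dl₁ hA b a) = 0) : f = 0 := by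
  refine LinearMap.ker_eq_top.1 (hF ⊤ (LinearMap.ker f) (fun a b => ?_) (fun a b => ?_)).2
  · exact ⟨_, LinearMap.rTensor_surjective A (fun x => ⟨⟨x, trivial⟩, rfl⟩) (hΔ.dr₂ hA b a),
      hΔ.embed_dr₂ hA a b⟩
  · exact ⟨_, (Module.Flat.lTensor_exact A (LinearMap.exact_subtype_ker_map f) _).1 (hf a b),
      hΔ.embed_dl₁ hA a b⟩

end Full

/-- A difference of two counits, applied to the first leg, vanishes on `Δ(A)(1 ⊗ A)`. -/
theorem IsCounit.unique (hA : IsNondegenerate A) (hΔ : IsRegularCoproduct Δ) (hF : IsFull Δ)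
    {ε' : A →ₗ[ℂ] ℂ} (hε : IsCounit Δ ε)
    (hε' : IsCounit Δ ε') : ε = ε' := by
  refine sub_eq_zero.1 (hF.eq_zero_left hA hΔ _ fun a b => ?_)
  apply (TensorProduct.lid ℂ A).injective
  rw [LinearMap.rTensor_sub, LinearMap.sub_apply, map_sub, map_zero, sub_eq_zero]
  exact (hΔ.sliceLeft_dr₂ hA hε a b).trans (hΔ.sliceLeft_dr₂ hA hε' a b).symm

/-- The image of `V ⊗ M(A)` in `M(A ⊗ A)`. -/
noncomputable def legLeft (V : Submodule ℂ (Multiplier A)) :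
    Submodule ℂ (Multiplier (A ⊗[ℂ] A)) :=
  LinearMap.range (mtmulLin ∘ₗ V.subtype.rTensor (Multiplier A))

/-- The image of `M(A) ⊗ W` in `M(A ⊗ A)`. -/
noncomputable def legRight (W : Submodule ℂ (Multiplier A)) :
    Submodule ℂ (Multiplier (A ⊗[ℂ] A)) :=
  LinearMap.range (mtmulLin ∘ₗ W.subtype.lTensor (Multiplier A))

theorem mtmul_one_mul_mtmulLin (m : Multiplier A) (t : Multiplier A ⊗[ℂ] Multiplier A) :
    mtmul 1 m * mtmulLin t = mtmulLin ((LinearMap.mulLeft ℂ m).lTensor _ t) := by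
  induction t using TensorProduct.induction_on with
  | zero => simp
  | add u v hu hv => simp only [map_add, mul_add, hu, hv]
  | tmul u v => simp [mtmul_mul_mtmul]

theorem mtmulLin_mul_mtmul_one (m : Multiplier A) (t : Multiplier A ⊗[ℂ] Multiplier A) :
    mtmulLin t * mtmul 1 m = mtmulLin ((LinearMap.mulRight ℂ m).lTensor _ t) := by
  induction t using TensorProduct.induction_on with
  | zero => simp
  | add u v hu hv => simp only [map_add, add_mul, hu, hv]
  | tmul u v => simp [mtmul_mul_mtmul]

theorem mtmul_mul_mtmulLin (m : Multiplier A) (t : Multiplier A ⊗[ℂ] Multiplier A) :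
    mtmul m 1 * mtmulLin t = mtmulLin ((LinearMap.mulLeft ℂ m).rTensor _ t) := by
  induction t using TensorProduct.induction_on with
  | zero => simp
  | add u v hu hv => simp only [map_add, mul_add, hu, hv]
  | tmul u v => simp [mtmul_mul_mtmul]

theorem mtmulLin_mul_mtmul (m : Multiplier A) (t : Multiplier A ⊗[ℂ] Multiplier A) :
    mtmulLin t * mtmul m 1 = mtmulLin ((LinearMap.mulRight ℂ m).rTensor _ t) := by
  induction t using TensorProduct.induction_on with
  | zero => simp
  | add u v hu hv => simp only [map_add, add_mul, hu, hv]
  | tmul u v => simp [mtmul_mul_mtmul]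

theorem mul_mem_legLeft {V : Submodule ℂ (Multiplier A)} {z : Multiplier (A ⊗[ℂ] A)}
    (hz : z ∈ legLeft V) (m : Multiplier A) : mtmul 1 m * z ∈ legLeft V := by
  obtain ⟨t, rfl⟩ := hz
  refine ⟨(LinearMap.mulLeft ℂ m).lTensor _ t, ?_⟩
  rw [LinearMap.comp_apply, LinearMap.comp_apply, mtmul_one_mul_mtmulLin]
  exact congrArg mtmulLin (LinearMap.congr_fun ((LinearMap.rTensor_comp_lTensor _ _ _).trans
    (LinearMap.lTensor_comp_rTensor _ _ _).symm) t)

theorem mem_legLeft_mul {V : Submodule ℂ (Multiplier A)} {z : Multiplier (A ⊗[ℂ] A)}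
    (hz : z ∈ legLeft V) (m : Multiplier A) : z * mtmul 1 m ∈ legLeft V := by
  obtain ⟨t, rfl⟩ := hz
  refine ⟨(LinearMap.mulRight ℂ m).lTensor _ t, ?_⟩
  rw [LinearMap.comp_apply, LinearMap.comp_apply, mtmulLin_mul_mtmul_one]
  exact congrArg mtmulLin (LinearMap.congr_fun ((LinearMap.rTensor_comp_lTensor _ _ _).trans
    (LinearMap.lTensor_comp_rTensor _ _ _).symm) t)

theorem mul_mem_legRight {W : Submodule ℂ (Multiplier A)} {z : Multiplier (A ⊗[ℂ] A)}
    (hz : z ∈ legRight W) (m : Multiplier A) : mtmul m 1 * z ∈ legRight W := by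
  obtain ⟨t, rfl⟩ := hz
  refine ⟨(LinearMap.mulLeft ℂ m).rTensor _ t, ?_⟩
  rw [LinearMap.comp_apply, LinearMap.comp_apply, mtmul_mul_mtmulLin]
  exact congrArg mtmulLin (LinearMap.congr_fun ((LinearMap.lTensor_comp_rTensor _ _ _).trans
    (LinearMap.rTensor_comp_lTensor _ _ _).symm) t)

theorem mem_legRight_mul {W : Submodule ℂ (Multiplier A)} {z : Multiplier (A ⊗[ℂ] A)}
    (hz : z ∈ legRight W) (m : Multiplier A) : z * mtmul m 1 ∈ legRight W := by
  obtain ⟨t, rfl⟩ := hz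
  refine ⟨(LinearMap.mulRight ℂ m).rTensor _ t, ?_⟩
  rw [LinearMap.comp_apply, LinearMap.comp_apply, mtmulLin_mul_mtmul]
  exact congrArg mtmulLin (LinearMap.congr_fun ((LinearMap.lTensor_comp_rTensor _ _ _).trans
    (LinearMap.rTensor_comp_lTensor _ _ _).symm) t)

theorem mtmulLin_map_mem_legLeft {V : Submodule ℂ (Multiplier A)} {U U' : Type*} [AddCommGroup U]
    [Module ℂ U] [AddCommGroup U'] [Module ℂ U'] (f : U →ₗ[ℂ] Multiplier A) (hf : ∀ u, f u ∈ V)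
    (g : U' →ₗ[ℂ] Multiplier A) (t : U ⊗[ℂ] U') :
    mtmulLin (TensorProduct.map f g t) ∈ legLeft V := by
  refine ⟨TensorProduct.map (f.codRestrict V hf) g t, ?_⟩
  rw [LinearMap.comp_apply, ← LinearMap.comp_apply (LinearMap.rTensor _ _),
    LinearMap.rTensor_comp_map, LinearMap.subtype_comp_codRestrict]

theorem mtmulLin_map_mem_legRight {W : Submodule ℂ (Multiplier A)} {U U' : Type*} [AddCommGroup U]
    [Module ℂ U] [AddCommGroup U'] [Module ℂ U'] (f : U →ₗ[ℂ] Multiplier A)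
    (g : U' →ₗ[ℂ] Multiplier A) (hg : ∀ u, g u ∈ W) (t : U ⊗[ℂ] U') :
    mtmulLin (TensorProduct.map f g t) ∈ legRight W := by
  refine ⟨TensorProduct.map f (g.codRestrict W hg) t, ?_⟩
  rw [LinearMap.comp_apply, ← LinearMap.comp_apply (LinearMap.lTensor _ _),
    LinearMap.lTensor_comp_map, LinearMap.subtype_comp_codRestrict]

theorem embedLin_mul_left (a : A) :
    LinearMap.mulLeft ℂ (embed a) ∘ₗ embedLin = embedLin ∘ₗ LinearMap.mulLeft ℂ a :=
  LinearMap.ext fun x => (embed_mul a x).symm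

theorem embedLin_mul_right (a : A) :
    LinearMap.mulRight ℂ (embed a) ∘ₗ embedLin = embedLin ∘ₗ LinearMap.mulRight ℂ a :=
  LinearMap.ext fun x => (embed_mul x a).symm

/-- If the first legs of all elements `(σ ⊗ ι)((1 ⊗ c)Δ(a)(1 ⊗ b))` lie in `V`, then `σ` takes
its values in `V`: this is fullness of the coproduct. -/
theorem IsFull.range_le_left (hF : IsFull Δ) (hA : IsNondegenerate A) (hΔ : IsRegularCoproduct Δ)
    (σ : A →ₗ[ℂ] Multiplier A) (V : Submodule ℂ (Multiplier A))
    (hσ : ∀ a b c, mtmulLin (TensorProduct.map σ embedLin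
      (lact (leg₂ c) (hΔ.dr₂ hA b a))) ∈ legLeft V) (a : A) : σ a ∈ V := by
  have hz : V.mkQ ∘ₗ σ = 0 := by
    refine hF.eq_zero_left hA hΔ _ fun a b => ?_
    refine joint_lTensor (fun c => LinearMap.mulLeft ℂ c) hA.2 _ fun c => ?_
    apply Module.Flat.lTensor_preserves_injective_linearMap (M := Multiplier A ⧸ V) embedLin
      (embedLin_injective hA)
    obtain ⟨t, ht⟩ := hσ a b c
    have ht := mtmulLin_injective hA hA ht
    have := congrArg (V.mkQ.rTensor (Multiplier A)) ht
    rw [← LinearMap.comp_apply, ← LinearMap.rTensor_comp, ← LinearMap.comp_apply,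
      LinearMap.rTensor_comp_map] at this
    have h0 : V.mkQ ∘ₗ V.subtype = 0 := by ext; simp
    rw [h0, LinearMap.rTensor_zero, LinearMap.zero_apply] at this
    rw [map_zero, this]
    generalize hΔ.dr₂ hA b a = s
    induction s using TensorProduct.induction_on with
    | zero => simp
    | add u v hu hv => simp only [map_add, hu, hv]
    | tmul u v => simp
  have := LinearMap.congr_fun hz a
  simpa using this

/-- If the second legs of all elements `(ι ⊗ τ)((b ⊗ 1)Δ(a)(c ⊗ 1))` lie in `W`, then `τ` takes its
values in `W`. -/
theorem IsFull.range_le_right (hF : IsFull Δ) (hA : IsNondegenerate A) (hΔ : IsRegularCoproduct Δ)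
    (τ : A →ₗ[ℂ] Multiplier A) (W : Submodule ℂ (Multiplier A))
    (hτ : ∀ a b c, mtmulLin (TensorProduct.map embedLin τ
      (ract (leg₁ c) (hΔ.dl₁ hA b a))) ∈ legRight W) (a : A) : τ a ∈ W := by
  have hz : W.mkQ ∘ₗ τ = 0 := by
    refine hF.eq_zero_right hA hΔ _ fun a b => ?_
    refine joint_rTensor (fun c => LinearMap.mulRight ℂ c) hA.1 _ fun c => ?_
    apply Module.Flat.rTensor_preserves_injective_linearMap (M := Multiplier A ⧸ W) embedLin
      (embedLin_injective hA)
    obtain ⟨t, ht⟩ := hτ a b c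
    have ht := mtmulLin_injective hA hA ht
    have := congrArg (W.mkQ.lTensor (Multiplier A)) ht
    rw [← LinearMap.comp_apply, ← LinearMap.lTensor_comp, ← LinearMap.comp_apply,
      LinearMap.lTensor_comp_map] at this
    have h0 : W.mkQ ∘ₗ W.subtype = 0 := by ext; simp
    rw [h0, LinearMap.lTensor_zero, LinearMap.zero_apply] at this
    rw [map_zero, this]
    generalize hΔ.dl₁ hA b a = s
    induction s using TensorProduct.induction_on with
    | zero => simp
    | add u v hu hv => simp only [map_add, hu, hv]
    | tmul u v => simp
  have := LinearMap.congr_fun hz a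
  simpa using this

namespace IsWeakBialgebraWith

theorem lact_dr₁ (h : IsWeakBialgebraWith Δ E ε) (a b : A) :
    lact E (h.coproduct.dr₁ h.nondeg b a) = h.coproduct.dr₁ h.nondeg b a := by
  apply embed_injective (h.nondeg.tensor h.nondeg)
  rw [← mul_embed, h.coproduct.embed_dr₁, ← mul_assoc, h.canonical.mul_delta h.nondeg]

theorem lact_dr₂ (h : IsWeakBialgebraWith Δ E ε) (a b : A) :
    lact E (h.coproduct.dr₂ h.nondeg b a) = h.coproduct.dr₂ h.nondeg b a := by
  apply embed_injective (h.nondeg.tensor h.nondeg)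
  rw [← mul_embed, h.coproduct.embed_dr₂, ← mul_assoc, h.canonical.mul_delta h.nondeg]

theorem ract_dl₁ (h : IsWeakBialgebraWith Δ E ε) (a b : A) :
    ract E (h.coproduct.dl₁ h.nondeg b a) = h.coproduct.dl₁ h.nondeg b a := by
  apply embed_injective (h.nondeg.tensor h.nondeg)
  rw [← embed_mul_multiplier, h.coproduct.embed_dl₁, mul_assoc, h.canonical.delta_mul h.nondeg]

theorem ract_dl₂ (h : IsWeakBialgebraWith Δ E ε) (a b : A) :
    ract E (h.coproduct.dl₂ h.nondeg b a) = h.coproduct.dl₂ h.nondeg b a := by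
  apply embed_injective (h.nondeg.tensor h.nondeg)
  rw [← embed_mul_multiplier, h.coproduct.embed_dl₂, mul_assoc, h.canonical.delta_mul h.nondeg]

/-- `E(y ⊗ ab) = (ι ⊗ ε ⊗ ι)((E ⊗ 1)(y ⊗ Δ(a)(1 ⊗ b)))`, since `ab = (ε ⊗ ι)(Δ(a)(1 ⊗ b))`. -/
theorem lact_tmul_mul (h : IsWeakBialgebraWith Δ E ε) (a b y : A) :
    lact E (y ⊗ₜ (a * b)) =
      (lactLin.flip y ∘ₗ h.source').rTensor A (h.coproduct.dr₂ h.nondeg b a) := by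
  rw [← h.coproduct.sliceLeft_dr₂ h.nondeg h.counit, ← h.lact_dr₂, h.lact_tmul_sliceLeft,
    h.lact_dr₂]
  induction h.coproduct.dr₂ h.nondeg b a using TensorProduct.induction_on with
  | zero => simp
  | add u v hu hv => simp only [map_add, TensorProduct.tmul_add, hu, hv]
  | tmul u v => simp [h.lact_source']

/-- `E(ab ⊗ y) = (ι ⊗ ε ⊗ ι)((1 ⊗ E)(Δ(a)(b ⊗ 1) ⊗ y))`. -/
theorem lact_mul_tmul (h : IsWeakBialgebraWith Δ E ε) (a b y : A) :
    lact E ((a * b) ⊗ₜ y) =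
      (lactLin.flip y ∘ₗ h.target).lTensor A (h.coproduct.dr₁ h.nondeg b a) := by
  rw [← h.coproduct.sliceRight_dr₁ h.nondeg h.counit, ← h.lact_dr₁, h.lact_sliceRight_tmul,
    h.lact_dr₁]
  induction h.coproduct.dr₁ h.nondeg b a using TensorProduct.induction_on with
  | zero => simp
  | add u v hu hv => simp only [map_add, TensorProduct.add_tmul, hu, hv]
  | tmul u v => simp [h.lact_target, lact_reassoc]

/-- `(y ⊗ ba)E = (ι ⊗ ε ⊗ ι)((y ⊗ (1 ⊗ b)Δ(a))(E ⊗ 1))`. -/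
theorem ract_tmul_mul (h : IsWeakBialgebraWith Δ E ε) (a b y : A) :
    ract E (y ⊗ₜ (b * a)) =
      (ractLin.flip y ∘ₗ h.source).rTensor A (h.coproduct.dl₂ h.nondeg b a) := by
  rw [← h.coproduct.sliceLeft_dl₂ h.nondeg h.counit, ← h.ract_dl₂, h.ract_tmul_sliceLeft,
    h.ract_dl₂]
  induction h.coproduct.dl₂ h.nondeg b a using TensorProduct.induction_on with
  | zero => simp
  | add u v hu hv => simp only [map_add, TensorProduct.tmul_add, hu, hv]
  | tmul u v => simp [h.ract_source]

/-- `(ba ⊗ y)E = (ι ⊗ ε ⊗ ι)(((b ⊗ 1)Δ(a) ⊗ y)(1 ⊗ E))`. -/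
theorem ract_mul_tmul (h : IsWeakBialgebraWith Δ E ε) (a b y : A) :
    ract E ((b * a) ⊗ₜ y) =
      (ractLin.flip y ∘ₗ h.target').lTensor A (h.coproduct.dl₁ h.nondeg b a) := by
  rw [← h.coproduct.sliceRight_dl₁ h.nondeg h.counit, ← h.ract_dl₁, h.ract_sliceRight_tmul,
    h.ract_dl₁]
  induction h.coproduct.dl₁ h.nondeg b a using TensorProduct.induction_on with
  | zero => simp
  | add u v hu hv => simp only [map_add, TensorProduct.add_tmul, hu, hv]
  | tmul u v => simp [h.ract_target', ract_reassoc]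

/-- `E(1 ⊗ ab) = (ι ⊗ ε ⊗ ι)((E ⊗ 1)(1 ⊗ Δ(a)(1 ⊗ b)))`. -/
theorem mul_leg₂ (h : IsWeakBialgebraWith Δ E ε) (a b : A) :
    E * leg₂ (a * b) =
      mtmulLin (TensorProduct.map h.source' embedLin (h.coproduct.dr₂ h.nondeg b a)) := by
  refine ext_lact_tmul h.nondeg h.nondeg fun y z => ?_
  have hz : h.coproduct.dr₂ h.nondeg (b * z) a =
      ract (leg₂ z) (h.coproduct.dr₂ h.nondeg b a) := by
    apply embed_injective (h.nondeg.tensor h.nondeg)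
    rw [← embed_mul_multiplier, h.coproduct.embed_dr₂, h.coproduct.embed_dr₂, mul_assoc,
      mtmul_mul_mtmul, ← embed_mul, one_mul]
  rw [lact_mul, lact_mtmul, TensorProduct.map_tmul, lact_embed, lact_one, LinearMap.id_apply,
    mul_assoc, h.lact_tmul_mul, hz]
  induction h.coproduct.dr₂ h.nondeg b a using TensorProduct.induction_on with
  | zero => simp
  | add u v hu hv => simp only [map_add, lact_add, hu, hv]
  | tmul u v => simp

/-- `E(ab ⊗ 1) = (ι ⊗ εₜ)(Δ(a)(b ⊗ 1))`. -/
theorem mul_leg₁ (h : IsWeakBialgebraWith Δ E ε) (a b : A) :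
    E * leg₁ (a * b) =
      mtmulLin (TensorProduct.map embedLin h.target (h.coproduct.dr₁ h.nondeg b a)) := by
  refine ext_lact_tmul h.nondeg h.nondeg fun z y => ?_
  have hz : h.coproduct.dr₁ h.nondeg (b * z) a =
      ract (leg₁ z) (h.coproduct.dr₁ h.nondeg b a) := by
    apply embed_injective (h.nondeg.tensor h.nondeg)
    rw [← embed_mul_multiplier, h.coproduct.embed_dr₁, h.coproduct.embed_dr₁, mul_assoc,
      mtmul_mul_mtmul, ← embed_mul, one_mul]
  rw [lact_mul, lact_mtmul, TensorProduct.map_tmul, lact_embed, lact_one, LinearMap.id_apply,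
    mul_assoc, h.lact_mul_tmul, hz]
  induction h.coproduct.dr₁ h.nondeg b a using TensorProduct.induction_on with
  | zero => simp
  | add u v hu hv => simp only [map_add, lact_add, hu, hv]
  | tmul u v => simp

/-- `(1 ⊗ ba)E = (εₛ ⊗ ι)((1 ⊗ b)Δ(a))`. -/
theorem leg₂_mul (h : IsWeakBialgebraWith Δ E ε) (a b : A) :
    leg₂ (b * a) * E =
      mtmulLin (TensorProduct.map h.source embedLin (h.coproduct.dl₂ h.nondeg b a)) := by
  refine ext_ract_tmul h.nondeg h.nondeg fun y z => ?_
  have hz : h.coproduct.dl₂ h.nondeg (z * b) a =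
      lact (leg₂ z) (h.coproduct.dl₂ h.nondeg b a) := by
    apply embed_injective (h.nondeg.tensor h.nondeg)
    rw [← mul_embed, h.coproduct.embed_dl₂, h.coproduct.embed_dl₂, ← mul_assoc,
      mtmul_mul_mtmul, ← embed_mul, one_mul]
  rw [ract_mul, ract_mtmul, TensorProduct.map_tmul, ract_embed, ract_one, LinearMap.id_apply,
    ← mul_assoc, h.ract_tmul_mul, hz]
  induction h.coproduct.dl₂ h.nondeg b a using TensorProduct.induction_on with
  | zero => simp
  | add u v hu hv => simp only [map_add, ract_add, hu, hv]
  | tmul u v => simp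

/-- `(ba ⊗ 1)E = (ι ⊗ εₜ')((b ⊗ 1)Δ(a))`, where `εₜ'(a) = (ε ⊗ ι)((a ⊗ 1)E)`. -/
theorem leg₁_mul (h : IsWeakBialgebraWith Δ E ε) (a b : A) :
    leg₁ (b * a) * E =
      mtmulLin (TensorProduct.map embedLin h.target' (h.coproduct.dl₁ h.nondeg b a)) := by
  refine ext_ract_tmul h.nondeg h.nondeg fun z y => ?_
  have hz : h.coproduct.dl₁ h.nondeg (z * b) a =
      lact (leg₁ z) (h.coproduct.dl₁ h.nondeg b a) := by
    apply embed_injective (h.nondeg.tensor h.nondeg)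
    rw [← mul_embed, h.coproduct.embed_dl₁, h.coproduct.embed_dl₁, ← mul_assoc,
      mtmul_mul_mtmul, ← embed_mul, one_mul]
  rw [ract_mul, ract_mtmul, TensorProduct.map_tmul, ract_embed, ract_one, LinearMap.id_apply,
    ← mul_assoc, h.ract_mul_tmul, hz]
  induction h.coproduct.dl₁ h.nondeg b a using TensorProduct.induction_on with
  | zero => simp
  | add u v hu hv => simp only [map_add, ract_add, hu, hv]
  | tmul u v => simp

/-- A subspace `V` of `M(A)` that contains the first legs of `(1 ⊗ A)E(1 ⊗ A)` contains the ranges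
of both maps `a ↦ (ι ⊗ ε)((1 ⊗ a)E)` and `a ↦ (ι ⊗ ε)(E(1 ⊗ a))`. -/
theorem range_source_le (h : IsWeakBialgebraWith Δ E ε) (V : Submodule ℂ (Multiplier A))
    (hV : ∀ c x, leg₂ c * E * leg₂ x ∈ legLeft V) (a : A) :
    h.source a ∈ V ∧ h.source' a ∈ V := by
  constructor
  · refine h.full.range_le_left h.nondeg h.coproduct h.source V (fun a b c => ?_) a
    convert hV (c * a) b using 1
    rw [h.leg₂_mul, mtmulLin_mul_mtmul_one, ← h.coproduct.ract_leg₂_dl₂]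
    congr 1
    rw [← LinearMap.comp_apply (LinearMap.lTensor _ _), LinearMap.lTensor_comp_map,
      embedLin_mul_right, ← LinearMap.map_comp_lTensor]
    rfl
  · refine h.full.range_le_left h.nondeg h.coproduct h.source' V (fun a b c => ?_) a
    convert hV c (a * b) using 1
    rw [mul_assoc, h.mul_leg₂, mtmul_one_mul_mtmulLin]
    congr 1
    rw [← LinearMap.comp_apply (LinearMap.lTensor _ _), LinearMap.lTensor_comp_map,
      embedLin_mul_left, ← LinearMap.map_comp_lTensor]
    rfl

/-- A subspace `W` of `M(A)` that contains the second legs of `(A ⊗ 1)E(A ⊗ 1)` contains the ranges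
of both maps `a ↦ (ε ⊗ ι)(E(a ⊗ 1))` and `a ↦ (ε ⊗ ι)((a ⊗ 1)E)`. -/
theorem range_target_le (h : IsWeakBialgebraWith Δ E ε) (W : Submodule ℂ (Multiplier A))
    (hW : ∀ c x, leg₁ c * E * leg₁ x ∈ legRight W) (a : A) :
    h.target a ∈ W ∧ h.target' a ∈ W := by
  constructor
  · refine h.full.range_le_right h.nondeg h.coproduct h.target W (fun a b c => ?_) a
    convert hW b (a * c) using 1
    rw [mul_assoc, h.mul_leg₁, mtmul_mul_mtmulLin, h.coproduct.ract_leg₁_dl₁]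
    congr 1
    rw [← LinearMap.comp_apply (LinearMap.rTensor _ _), LinearMap.rTensor_comp_map,
      embedLin_mul_left, ← LinearMap.map_comp_rTensor]
    rfl
  · refine h.full.range_le_right h.nondeg h.coproduct h.target' W (fun a b c => ?_) a
    convert hW (b * a) c using 1
    rw [h.leg₁_mul, mtmulLin_mul_mtmul]
    congr 1
    rw [← LinearMap.comp_apply (LinearMap.rTensor _ _), LinearMap.rTensor_comp_map,
      embedLin_mul_right, ← LinearMap.map_comp_rTensor]
    rfl

/-- Since `A = A²`, a linear map that sends products into `S` has its range in `S`. -/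
theorem mem_of_mul (h : IsWeakBialgebraWith Δ E ε) {W : Type*} [AddCommGroup W] [Module ℂ W]
    (f : A →ₗ[ℂ] W) (S : Submodule ℂ W) (hf : ∀ x y, f (x * y) ∈ S) (x : A) : f x ∈ S := by
  have := h.eq_of_mul (S.mkQ ∘ₗ f) 0 (fun x y => by simpa using hf x y) x
  simpa using this

/-- The range of `εₛ` contains the first legs of `(1 ⊗ A)E`, hence the values of
`a ↦ (ι ⊗ ε)(E(1 ⊗ a))`. -/
theorem source_mem_range (h : IsWeakBialgebraWith Δ E ε) (a : A) :
    h.source' a ∈ LinearMap.range h.source := by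
  refine (h.range_source_le _ (fun c x => ?_) a).2
  refine mem_legLeft_mul ?_ _
  refine h.mem_of_mul (LinearMap.mulRight ℂ E ∘ₗ mtmulBilin 1 ∘ₗ embedLin) _ (fun b a => ?_) c
  change leg₂ (b * a) * E ∈ _
  rw [h.leg₂_mul]
  exact mtmulLin_map_mem_legLeft _ (LinearMap.mem_range_self _) _ _

/-- The range of `a ↦ (ι ⊗ ε)(E(1 ⊗ a))` contains the first legs of `E(1 ⊗ A)`, hence the values of
`εₛ`. -/
theorem source_mem_range' (h : IsWeakBialgebraWith Δ E ε) (a : A) :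
    h.source a ∈ LinearMap.range h.source' := by
  refine (h.range_source_le _ (fun c x => ?_) a).1
  rw [mul_assoc]
  refine mul_mem_legLeft ?_ _
  refine h.mem_of_mul (LinearMap.mulLeft ℂ E ∘ₗ mtmulBilin 1 ∘ₗ embedLin) _ (fun b a => ?_) x
  change E * leg₂ (b * a) ∈ _
  rw [h.mul_leg₂]
  exact mtmulLin_map_mem_legLeft _ (LinearMap.mem_range_self _) _ _

/-- The range of `εₜ` contains the second legs of `E(A ⊗ 1)`, hence the values of
`a ↦ (ε ⊗ ι)((a ⊗ 1)E)`. -/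
theorem target_mem_range (h : IsWeakBialgebraWith Δ E ε) (a : A) :
    h.target' a ∈ LinearMap.range h.target := by
  refine (h.range_target_le _ (fun c x => ?_) a).2
  rw [mul_assoc]
  refine mul_mem_legRight ?_ _
  refine h.mem_of_mul (LinearMap.mulLeft ℂ E ∘ₗ mtmulBilin.flip 1 ∘ₗ embedLin) _
    (fun b a => ?_) x
  change E * leg₁ (b * a) ∈ _
  rw [h.mul_leg₁]
  exact mtmulLin_map_mem_legRight _ _ (LinearMap.mem_range_self _) _

/-- The range of `a ↦ (ε ⊗ ι)((a ⊗ 1)E)` contains the second legs of `(A ⊗ 1)E`, hence the values of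
`εₜ`. -/
theorem target_mem_range' (h : IsWeakBialgebraWith Δ E ε) (a : A) :
    h.target a ∈ LinearMap.range h.target' := by
  refine (h.range_target_le _ (fun c x => ?_) a).1
  refine mem_legRight_mul ?_ _
  refine h.mem_of_mul (LinearMap.mulRight ℂ E ∘ₗ mtmulBilin.flip 1 ∘ₗ embedLin) _
    (fun b a => ?_) c
  change leg₁ (b * a) * E ∈ _
  rw [h.leg₁_mul]
  exact mtmulLin_map_mem_legRight _ _ (LinearMap.mem_range_self _) _

end IsWeakBialgebraWith

end Legs

/-! ### The base algebras -/

section BaseAlgebras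

variable {A : Type*} [NonUnitalRing A] [Module ℂ A] [IsScalarTower ℂ A A] [SMulCommClass ℂ A A]
  {Δ : A →ₙₐ[ℂ] Multiplier (A ⊗[ℂ] A)} {E : Multiplier (A ⊗[ℂ] A)} {ε : A →ₗ[ℂ] ℂ}

namespace IsWeakBialgebraWith

theorem lact_reassoc_tmul_eq (a b z : A) :
    (TensorProduct.assoc ℂ A A A).symm (a ⊗ₜ lact E (b ⊗ₜ z)) =
      lact (reassoc (mtmul 1 E)) ((a ⊗ₜ b) ⊗ₜ z) := by
  simp [lact_reassoc]

theorem ract_reassoc_tmul_eq (a b z : A) :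
    (TensorProduct.assoc ℂ A A A).symm (a ⊗ₜ ract E (b ⊗ₜ z)) =
      ract (reassoc (mtmul 1 E)) ((a ⊗ₜ b) ⊗ₜ z) := by
  simp [ract_reassoc]

theorem sliceMiddle_lact_reassoc (h : IsWeakBialgebraWith Δ E ε) (w : A ⊗[ℂ] A) (z : A) :
    sliceMiddle ε (lact (reassoc (mtmul 1 E)) (w ⊗ₜ z)) =
      (lactLin.flip z ∘ₗ h.target).lTensor A w := by
  induction w using TensorProduct.induction_on with
  | zero => simp
  | add u v hu hv => simp only [map_add, TensorProduct.add_tmul, hu, hv]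
  | tmul u v => simp [h.lact_target, lact_reassoc]

theorem sliceMiddle_ract_mtmul (h : IsWeakBialgebraWith Δ E ε) (y : A) (w : A ⊗[ℂ] A) :
    sliceMiddle ε (ract (mtmul E 1) ((TensorProduct.assoc ℂ A A A).symm (y ⊗ₜ w))) =
      (ractLin.flip y ∘ₗ h.source).rTensor A w := by
  induction w using TensorProduct.induction_on with
  | zero => simp
  | add u v hu hv => simp only [map_add, TensorProduct.tmul_add, hu, hv]
  | tmul u v => simp [h.ract_source]

/-- `E(1 ⊗ εₜ(a)) = (ι ⊗ εₜ)(E(1 ⊗ a))`. -/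
theorem lact_tmul_target (h : IsWeakBialgebraWith Δ E ε) (a y z : A) :
    lact E (y ⊗ₜ lact (h.target a) z) =
      (lactLin.flip z ∘ₗ h.target).lTensor A (lact E (y ⊗ₜ a)) := by
  rw [h.lact_target, h.lact_tmul_sliceLeft, lact_reassoc_tmul_eq, ← lact_mul, h.comult.comm,
    lact_mul, ← h.sliceMiddle_lact_reassoc]
  rfl

/-- `(εₛ(a) ⊗ 1)E = (εₛ ⊗ ι)((a ⊗ 1)E)`. -/
theorem ract_source_tmul (h : IsWeakBialgebraWith Δ E ε) (a y z : A) :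
    ract E (ract (h.source a) y ⊗ₜ z) =
      (ractLin.flip y ∘ₗ h.source).rTensor A (ract E (a ⊗ₜ z)) := by
  rw [h.ract_source, h.ract_sliceRight_tmul, ← h.sliceMiddle_ract_mtmul, ract_reassoc_tmul_eq,
    ← ract_mul, ← h.comult.comm, ract_mul]
  rfl

/-- `E(1 ⊗ εₜ(a)) = E(b ⊗ 1)` with `b = (ι ⊗ ε)(E(1 ⊗ a))`: both sides are
`(ι ⊗ ε ⊗ ι)((E ⊗ 1)(1 ⊗ E)(1 ⊗ a ⊗ 1))`. -/
theorem mul_mtmul_target (h : IsWeakBialgebraWith Δ E ε) (a : A) :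
    E * mtmul 1 (h.target a) = E * mtmul (h.source' a) 1 := by
  refine ext_lact_tmul h.nondeg h.nondeg fun y z => ?_
  simp only [lact_mul, lact_mtmul, TensorProduct.map_tmul, lact_one, LinearMap.id_apply]
  rw [h.lact_target, h.lact_source', h.lact_tmul_sliceLeft, h.lact_sliceRight_tmul,
    lact_reassoc_tmul_eq, ← lact_mul, h.comult.comm, lact_mul]
  rfl

/-- `(εₛ(a) ⊗ 1)E = (1 ⊗ c)E` with `c = (ε ⊗ ι)((a ⊗ 1)E)`. -/
theorem mtmul_source_mul (h : IsWeakBialgebraWith Δ E ε) (a : A) :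
    mtmul (h.source a) 1 * E = mtmul 1 (h.target' a) * E := by
  refine ext_ract_tmul h.nondeg h.nondeg fun y z => ?_
  simp only [ract_mul, ract_mtmul, TensorProduct.map_tmul, ract_one, LinearMap.id_apply]
  rw [h.ract_target', h.ract_source, h.ract_tmul_sliceLeft, h.ract_sliceRight_tmul,
    ract_reassoc_tmul_eq, ← ract_mul, ← h.comult.comm, ract_mul]
  rfl

theorem target_mul_target (h : IsWeakBialgebraWith Δ E ε) (a b : A) :
    h.target a * h.target b = h.target (lact (h.target a) b) := by
  refine ext_lact h.nondeg fun z => ?_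
  rw [lact_mul, h.lact_target a, h.lact_tmul_target, h.lact_target a]
  induction lact E (a ⊗ₜ b) using TensorProduct.induction_on with
  | zero => simp
  | add u v hu hv => simp only [map_add, lact_add, hu, hv]
  | tmul u v =>
    simp only [LinearMap.lTensor_tmul, sliceLeft_tmul, map_smul, LinearMap.comp_apply]
    rfl

theorem source_mul_source (h : IsWeakBialgebraWith Δ E ε) (a b : A) :
    h.source a * h.source b = h.source (ract (h.source b) a) := by
  refine ext_ract h.nondeg fun z => ?_
  rw [ract_mul, h.ract_source b, h.ract_source_tmul, h.ract_source b]
  induction ract E (a ⊗ₜ b) using TensorProduct.induction_on with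
  | zero => simp
  | add u v hu hv => simp only [map_add, ract_add, hu, hv]
  | tmul u v =>
    simp only [LinearMap.rTensor_tmul, sliceRight_tmul, map_smul, LinearMap.comp_apply]
    rfl

/-- `E(1 ⊗ εₜ(ab)) = (εₛ' ⊗ εₜ)(Δ(a)(1 ⊗ b))` with `εₛ'(a) = (ι ⊗ ε)(E(1 ⊗ a))`; the right-hand side
lies in `B ⊗ C`. -/
theorem mul_mtmul_target_eq (h : IsWeakBialgebraWith Δ E ε) (a b : A) :
    E * mtmul 1 (h.target (a * b)) =
      mtmulLin (TensorProduct.map h.source' h.target (h.coproduct.dr₂ h.nondeg b a)) := by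
  refine ext_lact_tmul h.nondeg h.nondeg fun y z => ?_
  rw [lact_mul, lact_mtmul, TensorProduct.map_tmul, lact_one, LinearMap.id_apply,
    h.lact_tmul_target, h.lact_tmul_mul]
  induction h.coproduct.dr₂ h.nondeg b a using TensorProduct.induction_on with
  | zero => simp
  | add u v hu hv => simp only [map_add, lact_add, hu, hv]
  | tmul u v => simp

/-- `(εₛ(ba) ⊗ 1)E = (εₛ ⊗ εₜ')((b ⊗ 1)Δ(a))` with `εₜ'(a) = (ε ⊗ ι)((a ⊗ 1)E)`; the right-hand side
lies in `B ⊗ C`. -/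
theorem mtmul_source_mul_eq (h : IsWeakBialgebraWith Δ E ε) (a b : A) :
    mtmul (h.source (b * a)) 1 * E =
      mtmulLin (TensorProduct.map h.source h.target' (h.coproduct.dl₁ h.nondeg b a)) := by
  refine ext_ract_tmul h.nondeg h.nondeg fun y z => ?_
  rw [ract_mul, ract_mtmul, TensorProduct.map_tmul, ract_one, LinearMap.id_apply,
    h.ract_source_tmul, h.ract_mul_tmul]
  induction h.coproduct.dl₁ h.nondeg b a using TensorProduct.induction_on with
  | zero => simp
  | add u v hu hv => simp only [map_add, ract_add, hu, hv]
  | tmul u v => simp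

/-- The subalgebra `B = εₛ(A)` of `M(A)`. -/
noncomputable def sourceAlg (h : IsWeakBialgebraWith Δ E ε) :
    NonUnitalSubalgebra ℂ (Multiplier A) :=
  { LinearMap.range h.source with
    mul_mem' := by
      rintro _ _ ⟨a, rfl⟩ ⟨b, rfl⟩
      exact ⟨_, (h.source_mul_source a b).symm⟩ }

/-- The subalgebra `C = εₜ(A)` of `M(A)`. -/
noncomputable def targetAlg (h : IsWeakBialgebraWith Δ E ε) :
    NonUnitalSubalgebra ℂ (Multiplier A) :=
  { LinearMap.range h.target with
    mul_mem' := by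
      rintro _ _ ⟨a, rfl⟩ ⟨b, rfl⟩
      exact ⟨_, (h.target_mul_target a b).symm⟩ }

theorem source_mem (h : IsWeakBialgebraWith Δ E ε) (a : A) : h.source a ∈ h.sourceAlg := ⟨a, rfl⟩

theorem target_mem (h : IsWeakBialgebraWith Δ E ε) (a : A) : h.target a ∈ h.targetAlg := ⟨a, rfl⟩

theorem source'_mem (h : IsWeakBialgebraWith Δ E ε) (a : A) : h.source' a ∈ h.sourceAlg :=
  h.source_mem_range a

theorem target'_mem (h : IsWeakBialgebraWith Δ E ε) (a : A) : h.target' a ∈ h.targetAlg :=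
  h.target_mem_range a

/-- A subspace of `A` that contains all products is `A`. -/
theorem eq_top_of_mul (h : IsWeakBialgebraWith Δ E ε) (S : Submodule ℂ A)
    (hS : ∀ x y : A, x * y ∈ S) : S = ⊤ :=
  eq_top_iff.2 fun x _ => h.mem_of_mul LinearMap.id S hS x

/-- `BA = A = AB`: by the counit property, `xy = (ι ⊗ ε)(Δ(x)(y ⊗ 1))`, and `Δ(x)(y ⊗ 1) ∈ E(A ⊗ A)`
has its slices in `BA`. -/
theorem isNondegSubalgebra_sourceAlg (h : IsWeakBialgebraWith Δ E ε) :
    IsNondegSubalgebra h.sourceAlg := by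
  constructor
  · refine h.eq_top_of_mul _ fun x y => ?_
    rw [← h.coproduct.sliceRight_dr₁ h.nondeg h.counit, ← h.lact_dr₁]
    induction h.coproduct.dr₁ h.nondeg y x using TensorProduct.induction_on with
    | zero => simp
    | add u v hu hv => simpa only [map_add] using add_mem hu hv
    | tmul u v => exact Submodule.subset_span ⟨_, h.source'_mem v, u, (h.lact_source' v u).symm⟩
  · refine h.eq_top_of_mul _ fun x y => ?_
    rw [← h.coproduct.sliceRight_dl₁ h.nondeg h.counit, ← h.ract_dl₁]
    induction h.coproduct.dl₁ h.nondeg x y using TensorProduct.induction_on with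
    | zero => simp
    | add u v hu hv => simpa only [map_add] using add_mem hu hv
    | tmul u v => exact Submodule.subset_span ⟨_, h.source_mem v, u, (h.ract_source v u).symm⟩

theorem isNondegSubalgebra_targetAlg (h : IsWeakBialgebraWith Δ E ε) :
    IsNondegSubalgebra h.targetAlg := by
  constructor
  · refine h.eq_top_of_mul _ fun x y => ?_
    rw [← h.coproduct.sliceLeft_dr₂ h.nondeg h.counit, ← h.lact_dr₂]
    induction h.coproduct.dr₂ h.nondeg y x using TensorProduct.induction_on with
    | zero => simp
    | add u v hu hv => simpa only [map_add] using add_mem hu hv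
    | tmul u v => exact Submodule.subset_span ⟨_, h.target_mem u, v, (h.lact_target u v).symm⟩
  · refine h.eq_top_of_mul _ fun x y => ?_
    rw [← h.coproduct.sliceLeft_dl₂ h.nondeg h.counit, ← h.ract_dl₂]
    induction h.coproduct.dl₂ h.nondeg x y using TensorProduct.induction_on with
    | zero => simp
    | add u v hu hv => simpa only [map_add] using add_mem hu hv
    | tmul u v => exact Submodule.subset_span ⟨_, h.target'_mem u, v, (h.ract_target' u v).symm⟩

/-- `B` is idempotent: `εₛ(a b) = εₛ(a) b` for `b ∈ B`, and `AB = A`. -/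
theorem isIdempotentAlg_sourceAlg (h : IsWeakBialgebraWith Δ E ε) :
    IsIdempotentAlg h.sourceAlg := by
  have key : ∀ a : A, (⟨h.source a, h.source_mem a⟩ : h.sourceAlg) ∈
      Submodule.span ℂ {z : h.sourceAlg | ∃ x y, z = x * y} := by
    intro a
    have ha : a ∈ Submodule.span ℂ {z | ∃ b ∈ h.sourceAlg, ∃ x, z = ract b x} := by
      rw [h.isNondegSubalgebra_sourceAlg.2]
      trivial
    let f : A →ₗ[ℂ] h.sourceAlg := h.source.codRestrict h.sourceAlg.toSubmodule h.source_mem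
    change f a ∈ _
    induction ha using Submodule.span_induction with
    | zero => simp
    | add x y _ _ hx hy => rw [map_add]; exact add_mem hx hy
    | smul c x _ hx => rw [map_smul]; exact Submodule.smul_mem _ c hx
    | mem x hx =>
      obtain ⟨_, ⟨b, rfl⟩, y, rfl⟩ := hx
      exact Submodule.subset_span ⟨⟨_, h.source_mem y⟩, ⟨_, h.source_mem b⟩,
        Subtype.ext (h.source_mul_source y b).symm⟩
  refine eq_top_iff.2 ?_
  rintro ⟨_, ⟨a, rfl⟩⟩ _
  exact key a

/-- `C` is idempotent: `εₜ(c a) = c εₜ(a)` for `c ∈ C`, and `CA = A`. -/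
theorem isIdempotentAlg_targetAlg (h : IsWeakBialgebraWith Δ E ε) :
    IsIdempotentAlg h.targetAlg := by
  have key : ∀ a : A, (⟨h.target a, h.target_mem a⟩ : h.targetAlg) ∈
      Submodule.span ℂ {z : h.targetAlg | ∃ x y, z = x * y} := by
    intro a
    have ha : a ∈ Submodule.span ℂ {z | ∃ b ∈ h.targetAlg, ∃ x, z = lact b x} := by
      rw [h.isNondegSubalgebra_targetAlg.1]
      trivial
    let f : A →ₗ[ℂ] h.targetAlg := h.target.codRestrict h.targetAlg.toSubmodule h.target_mem
    change f a ∈ _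
    induction ha using Submodule.span_induction with
    | zero => simp
    | add x y _ _ hx hy => rw [map_add]; exact add_mem hx hy
    | smul c x _ hx => rw [map_smul]; exact Submodule.smul_mem _ c hx
    | mem x hx =>
      obtain ⟨_, ⟨b, rfl⟩, y, rfl⟩ := hx
      exact Submodule.subset_span ⟨⟨_, h.target_mem b⟩, ⟨_, h.target_mem y⟩,
        Subtype.ext (h.target_mul_target b y).symm⟩
  refine eq_top_iff.2 ?_
  rintro ⟨_, ⟨a, rfl⟩⟩ _
  exact key a

end IsWeakBialgebraWith

end BaseAlgebras

/-! ### Multipliers of `B ⊗ C` and separability -/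

section Subalgebras

variable {A : Type*} [NonUnitalRing A] [Module ℂ A] [IsScalarTower ℂ A A] [SMulCommClass ℂ A A]
  {B C : NonUnitalSubalgebra ℂ (Multiplier A)}

/-- Since `BA = A`, linear maps on `A` that agree on all `bx` with `b ∈ B` are equal. -/
theorem IsNondegSubalgebra.eq_of_lact (hB : IsNondegSubalgebra B) {W : Type*} [AddCommGroup W]
    [Module ℂ W] (f g : A →ₗ[ℂ] W) (hfg : ∀ b ∈ B, ∀ x, f (lact b x) = g (lact b x)) (x : A) :
    f x = g x := by
  have hs : Set.EqOn f g (Submodule.span ℂ {z : A | ∃ b ∈ B, ∃ x, z = lact b x}) := by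
    refine LinearMap.eqOn_span ?_
    rintro _ ⟨b, hb, x, rfl⟩
    exact hfg b hb x
  exact hs (by rw [hB.1]; trivial)

theorem IsNondegSubalgebra.eq_of_ract (hB : IsNondegSubalgebra B) {W : Type*} [AddCommGroup W]
    [Module ℂ W] (f g : A →ₗ[ℂ] W) (hfg : ∀ b ∈ B, ∀ x, f (ract b x) = g (ract b x)) (x : A) :
    f x = g x := by
  have hs : Set.EqOn f g (Submodule.span ℂ {z : A | ∃ b ∈ B, ∃ x, z = ract b x}) := by
    refine LinearMap.eqOn_span ?_
    rintro _ ⟨b, hb, x, rfl⟩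
    exact hfg b hb x
  exact hs (by rw [hB.2]; trivial)

theorem IsNondegSubalgebra.mem_of_lact (hB : IsNondegSubalgebra B) {W : Type*} [AddCommGroup W]
    [Module ℂ W] (f : A →ₗ[ℂ] W) (S : Submodule ℂ W) (hf : ∀ b ∈ B, ∀ x, f (lact b x) ∈ S)
    (x : A) : f x ∈ S := by
  have := hB.eq_of_lact (S.mkQ ∘ₗ f) 0 (fun b hb x => by simpa using hf b hb x) x
  simpa using this

theorem IsNondegSubalgebra.mem_of_ract (hB : IsNondegSubalgebra B) {W : Type*} [AddCommGroup W]
    [Module ℂ W] (f : A →ₗ[ℂ] W) (S : Submodule ℂ W) (hf : ∀ b ∈ B, ∀ x, f (ract b x) ∈ S)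
    (x : A) : f x ∈ S := by
  have := hB.eq_of_ract (S.mkQ ∘ₗ f) 0 (fun b hb x => by simpa using hf b hb x) x
  simpa using this

/-- The product of `B` is non-degenerate, since `BA = A = AB`. -/
theorem IsNondegSubalgebra.isNondegenerate (hA : IsNondegenerate A) (hB : IsNondegSubalgebra B) :
    IsNondegenerate B := by
  constructor
  · intro b hb
    refine Subtype.ext (ext_lact hA (hB.eq_of_lact _ _ fun c hc x => ?_))
    exact congrArg (fun m : B => lact (m : Multiplier A) x) (hb ⟨c, hc⟩)
  · intro b hb
    refine Subtype.ext (ext_ract hA (hB.eq_of_ract _ _ fun c hc x => ?_))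
    exact congrArg (fun m : B => ract (m : Multiplier A) x) (hb ⟨c, hc⟩)

@[simp] theorem inclTensor_tmul (b : B) (c : C) :
    inclTensor B C (b ⊗ₜ c) = mtmul (b : Multiplier A) c := rfl

theorem inclTensor_eq (t : B ⊗[ℂ] C) : inclTensor B C t =
    mtmulLin (TensorProduct.map B.toSubmodule.subtype C.toSubmodule.subtype t) := by
  induction t using TensorProduct.induction_on with
  | zero => simp
  | add u v hu hv => simp only [map_add, hu, hv]
  | tmul u v => rw [inclTensor_tmul, TensorProduct.map_tmul, mtmulLin_tmul]; rfl

theorem inclTensor_injective (hA : IsNondegenerate A) : Function.Injective (inclTensor B C) := by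
  intro s t hst
  rw [inclTensor_eq, inclTensor_eq] at hst
  exact TensorProduct.map_injective_of_flat_flat _ _ B.toSubmodule.injective_subtype
    C.toSubmodule.injective_subtype (mtmulLin_injective hA hA hst)

theorem inclTensor_mul (s t : B ⊗[ℂ] C) :
    inclTensor B C (s * t) = inclTensor B C s * inclTensor B C t := by
  induction s using TensorProduct.induction_on with
  | zero => simp
  | add u v hu hv => simp only [map_add, add_mul, hu, hv]
  | tmul a b =>
    induction t using TensorProduct.induction_on with
    | zero => simp
    | add u v hu hv => simp only [map_add, mul_add, hu, hv]
    | tmul c d => simp [mtmul_mul_mtmul]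

theorem IsImageOf.mul {m m' : Multiplier (A ⊗[ℂ] A)} {n n' : Multiplier (B ⊗[ℂ] C)}
    (h : IsImageOf B C m n) (h' : IsImageOf B C m' n') : IsImageOf B C (m * m') (n * n') :=
  ⟨fun x => by rw [mul_assoc, h'.1, h.1, lact_mul],
    fun x => by rw [← mul_assoc, h.2, h'.2, ract_mul]⟩

theorem isImageOf_inclTensor (t : B ⊗[ℂ] C) : IsImageOf B C (inclTensor B C t) (embed t) :=
  ⟨fun x => by rw [lact_embed, inclTensor_mul], fun x => by rw [ract_embed, inclTensor_mul]⟩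

theorem isImageOf_mtmul_left (b : B) :
    IsImageOf B C (mtmul (b : Multiplier A) 1) (mtmul (embed b) 1) := by
  constructor <;>
  · intro x
    induction x using TensorProduct.induction_on with
    | zero => simp
    | add u v hu hv => simp only [map_add, mul_add, add_mul, hu, hv]
    | tmul u v => simp [mtmul_mul_mtmul]

theorem isImageOf_mtmul_right (c : C) :
    IsImageOf B C (mtmul 1 (c : Multiplier A)) (mtmul 1 (embed c)) := by
  constructor <;>
  · intro x
    induction x using TensorProduct.induction_on with
    | zero => simp
    | add u v hu hv => simp only [map_add, mul_add, add_mul, hu, hv]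
    | tmul u v => simp [mtmul_mul_mtmul]

/-- The embedding `M(B ⊗ C) ⊆ M(A ⊗ A)` is injective, since `B ⊗ C → M(A ⊗ A)` is. -/
theorem IsImageOf.right_unique (hA : IsNondegenerate A) {m : Multiplier (A ⊗[ℂ] A)}
    {n n' : Multiplier (B ⊗[ℂ] C)} (h : IsImageOf B C m n) (h' : IsImageOf B C m n') : n = n' :=
  Multiplier.ext (fun x => inclTensor_injective hA (by rw [← h.1, ← h'.1]))
    (fun x => inclTensor_injective hA (by rw [← h.2, ← h'.2]))

/-- The embedding `M(B ⊗ C) ⊆ M(A ⊗ A)` is single-valued, since `(B ⊗ C)(A ⊗ A) = A ⊗ A`. -/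
theorem IsImageOf.left_unique (hA : IsNondegenerate A) (hB : IsNondegSubalgebra B)
    (hC : IsNondegSubalgebra C) {m m' : Multiplier (A ⊗[ℂ] A)}
    {n : Multiplier (B ⊗[ℂ] C)} (h : IsImageOf B C m n) (h' : IsImageOf B C m' n) : m = m' := by
  refine ext_lact_tmul hA hA fun x y => ?_
  refine hB.eq_of_lact (lact m ∘ₗ (TensorProduct.mk ℂ A A).flip y)
    (lact m' ∘ₗ (TensorProduct.mk ℂ A A).flip y) (fun b hb x => ?_) x
  refine hC.eq_of_lact (lact m ∘ₗ TensorProduct.mk ℂ A A _)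
    (lact m' ∘ₗ TensorProduct.mk ℂ A A _) (fun c hc y => ?_) y
  have := (h.1 ((⟨b, hb⟩ : B) ⊗ₜ (⟨c, hc⟩ : C))).trans (h'.1 _).symm
  rw [inclTensor_tmul] at this
  exact congrArg (fun m => lact m (x ⊗ₜ y)) this

/-- A multiplier `m` of `A ⊗ A` with `m(B ⊗ C) ⊆ B ⊗ C` and `(B ⊗ C)m ⊆ B ⊗ C` is the image of a
multiplier of `B ⊗ C`. -/
theorem exists_isImageOf (hA : IsNondegenerate A) (hB : IsNondegenerate B) (hC : IsNondegenerate C)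
    (m : Multiplier (A ⊗[ℂ] A)) (hl : ∀ x, ∃ t, inclTensor B C t = m * inclTensor B C x)
    (hr : ∀ x, ∃ t, inclTensor B C t = inclTensor B C x * m) :
    ∃ n : Multiplier (B ⊗[ℂ] C), IsImageOf B C m n := by
  let e := LinearEquiv.ofInjective (inclTensor B C) (inclTensor_injective hA)
  let L : B ⊗[ℂ] C →ₗ[ℂ] B ⊗[ℂ] C := e.symm.toLinearMap ∘ₗ
    (LinearMap.mulLeft ℂ m ∘ₗ inclTensor B C).codRestrict (LinearMap.range (inclTensor B C)) hl
  let R : B ⊗[ℂ] C →ₗ[ℂ] B ⊗[ℂ] C := e.symm.toLinearMap ∘ₗ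
    (LinearMap.mulRight ℂ m ∘ₗ inclTensor B C).codRestrict (LinearMap.range (inclTensor B C)) hr
  have hL : ∀ x, inclTensor B C (L x) = m * inclTensor B C x := fun x =>
    congrArg Subtype.val (e.apply_symm_apply _)
  have hR : ∀ x, inclTensor B C (R x) = inclTensor B C x * m := fun x =>
    congrArg Subtype.val (e.apply_symm_apply _)
  refine ⟨mkMultiplier (hB.tensor hC) L R fun x y => inclTensor_injective hA ?_,
    fun x => (hL x).symm, fun x => (hR x).symm⟩
  rw [inclTensor_mul, inclTensor_mul, hL, hR, mul_assoc]

theorem inclTensor_mem_legLeft (V : Submodule ℂ B) {t : B ⊗[ℂ] C} (ht : t ∈ leftSub V C) :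
    inclTensor B C t ∈ legLeft (V.map B.toSubmodule.subtype) := by
  obtain ⟨s, rfl⟩ := ht
  induction s using TensorProduct.induction_on with
  | zero => simp
  | add u v hu hv => simpa only [map_add] using add_mem hu hv
  | tmul v c => exact ⟨⟨v, Submodule.mem_map_of_mem v.2⟩ ⊗ₜ c, mtmulLin_tmul _ _⟩

theorem inclTensor_mem_legRight (W : Submodule ℂ C) {t : B ⊗[ℂ] C} (ht : t ∈ rightSub B W) :
    inclTensor B C t ∈ legRight (W.map C.toSubmodule.subtype) := by
  obtain ⟨s, rfl⟩ := ht
  induction s using TensorProduct.induction_on with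
  | zero => simp
  | add u v hu hv => simpa only [map_add] using add_mem hu hv
  | tmul b w => exact ⟨(b : Multiplier A) ⊗ₜ ⟨w, Submodule.mem_map_of_mem w.2⟩, mtmulLin_tmul _ _⟩

theorem eq_top_of_le_map {D : NonUnitalSubalgebra ℂ (Multiplier A)} (V : Submodule ℂ D)
    (hV : ∀ b : D, (b : Multiplier A) ∈ V.map D.toSubmodule.subtype) : V = ⊤ := by
  refine eq_top_iff.2 fun b _ => ?_
  obtain ⟨v, hv, hvb⟩ := hV b
  have : v = b := Subtype.ext hvb
  exact this ▸ hv

theorem IsImageOf.embed_eq (hA : IsNondegenerate A) {m : Multiplier (A ⊗[ℂ] A)}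
    {n : Multiplier (B ⊗[ℂ] C)} (h : IsImageOf B C m n) {t : B ⊗[ℂ] C}
    (ht : inclTensor B C t = m) : embed t = n := by
  subst ht
  exact (isImageOf_inclTensor t).right_unique hA h

theorem IsImageOf.inclTensor_eq (hA : IsNondegenerate A) (hB : IsNondegSubalgebra B)
    (hC : IsNondegSubalgebra C) {m : Multiplier (A ⊗[ℂ] A)}
    {n : Multiplier (B ⊗[ℂ] C)} (h : IsImageOf B C m n) {t : B ⊗[ℂ] C}
    (ht : embed t = n) : inclTensor B C t = m := by
  subst ht
  exact (isImageOf_inclTensor t).left_unique hA hB hC h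

/-- The defining properties of a regular separability idempotent of `M(B ⊗ C)` may be verified in
`M(A ⊗ A)`. -/
theorem IsImageOf.isRegularSeparabilityIdempotent (hA : IsNondegenerate A)
    (hB : IsNondegSubalgebra B) (hC : IsNondegSubalgebra C) (hB2 : IsIdempotentAlg B)
    (hC2 : IsIdempotentAlg C) {E : Multiplier (A ⊗[ℂ] A)} (hE : E * E = E)
    (hEC : ∀ c : C, ∃ t, inclTensor B C t = E * mtmul 1 (c : Multiplier A))
    (hBE : ∀ b : B, ∃ t, inclTensor B C t = mtmul (b : Multiplier A) 1 * E)
    (hl : ∀ c : C, ∃ b : B, E * mtmul (b : Multiplier A) 1 = E * mtmul 1 (c : Multiplier A))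
    (hl' : ∀ b : B, ∃ c : C, E * mtmul 1 (c : Multiplier A) = E * mtmul (b : Multiplier A) 1)
    (hr : ∀ c : C, ∃ b : B, mtmul (b : Multiplier A) 1 * E = mtmul 1 (c : Multiplier A) * E)
    (hr' : ∀ b : B, ∃ c : C, mtmul 1 (c : Multiplier A) * E = mtmul (b : Multiplier A) 1 * E)
    (hV : ∀ V, (∀ c : C, E * mtmul 1 (c : Multiplier A) ∈ legLeft V) →
      ∀ b : B, (b : Multiplier A) ∈ V)
    (hV' : ∀ V, (∀ c : C, mtmul 1 (c : Multiplier A) * E ∈ legLeft V) →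
      ∀ b : B, (b : Multiplier A) ∈ V)
    (hW : ∀ W, (∀ b : B, E * mtmul (b : Multiplier A) 1 ∈ legRight W) →
      ∀ c : C, (c : Multiplier A) ∈ W)
    (hW' : ∀ W, (∀ b : B, mtmul (b : Multiplier A) 1 * E ∈ legRight W) →
      ∀ c : C, (c : Multiplier A) ∈ W)
    {F : Multiplier (B ⊗[ℂ] C)} (hF : IsImageOf B C E F) :
    IsRegularSeparabilityIdempotent F := by
  have hFc : ∀ c : C, IsImageOf B C (E * mtmul 1 (c : Multiplier A)) (F * mtmul 1 (embed c)) :=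
    fun c => hF.mul (isImageOf_mtmul_right c)
  have hcF : ∀ c : C, IsImageOf B C (mtmul 1 (c : Multiplier A) * E) (mtmul 1 (embed c) * F) :=
    fun c => (isImageOf_mtmul_right c).mul hF
  have hFb : ∀ b : B, IsImageOf B C (E * mtmul (b : Multiplier A) 1) (F * mtmul (embed b) 1) :=
    fun b => hF.mul (isImageOf_mtmul_left b)
  have hbF : ∀ b : B, IsImageOf B C (mtmul (b : Multiplier A) 1 * E) (mtmul (embed b) 1 * F) :=
    fun b => (isImageOf_mtmul_left b).mul hF
  have hsl : ∀ (b : B) (c : C), E * mtmul (b : Multiplier A) 1 = E * mtmul 1 (c : Multiplier A) →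
      F * mtmul (embed b) 1 = F * mtmul 1 (embed c) := fun b c hbc =>
    (hbc ▸ hFb b).right_unique hA (hFc c)
  have hsr : ∀ (b : B) (c : C), mtmul (b : Multiplier A) 1 * E = mtmul 1 (c : Multiplier A) * E →
      mtmul (embed b) 1 * F = mtmul 1 (embed c) * F := fun b c hbc =>
    (hbc ▸ hbF b).right_unique hA (hcF c)
  have h₁ : ∀ c : C, ∃ t, embed t = F * mtmul 1 (embed c) := fun c => by
    obtain ⟨t, ht⟩ := hEC c
    exact ⟨t, (hFc c).embed_eq hA ht⟩
  have h₂ : ∀ b : B, ∃ t, embed t = mtmul (embed b) 1 * F := fun b => by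
    obtain ⟨t, ht⟩ := hBE b
    exact ⟨t, (hbF b).embed_eq hA ht⟩
  constructor
  · exact hB.isNondegenerate hA
  · exact hC.isNondegenerate hA
  · exact hB2
  · exact hC2
  · exact (hE ▸ hF.mul hF).right_unique hA hF
  · exact h₁
  · exact h₂
  · intro c
    obtain ⟨b, hb⟩ := hr c
    rw [← hsr b c hb]
    exact h₂ b
  · intro b
    obtain ⟨c, hc⟩ := hl' b
    rw [hsl b c hc.symm]
    exact h₁ c
  · refine fun V h => eq_top_of_le_map V (hV _ fun c => ?_)
    obtain ⟨t, htV, ht⟩ := h c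
    rw [← (hFc c).inclTensor_eq hA hB hC ht]
    exact inclTensor_mem_legLeft V htV
  · refine fun V h => eq_top_of_le_map V (hV' _ fun c => ?_)
    obtain ⟨t, htV, ht⟩ := h c
    rw [← (hcF c).inclTensor_eq hA hB hC ht]
    exact inclTensor_mem_legLeft V htV
  · refine fun W h => eq_top_of_le_map W (hW' _ fun b => ?_)
    obtain ⟨t, htW, ht⟩ := h b
    rw [← (hbF b).inclTensor_eq hA hB hC ht]
    exact inclTensor_mem_legRight W htW
  · refine fun W h => eq_top_of_le_map W (hW _ fun b => ?_)
    obtain ⟨t, htW, ht⟩ := h b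
    rw [← (hFb b).inclTensor_eq hA hB hC ht]
    exact inclTensor_mem_legRight W htW
  · ext z
    constructor
    · rintro ⟨b, rfl⟩
      obtain ⟨c, hc⟩ := hl' b
      exact ⟨c, (hsl b c hc.symm).symm⟩
    · rintro ⟨c, rfl⟩
      obtain ⟨b, hb⟩ := hl c
      exact ⟨b, hsl b c hb⟩
  · ext z
    constructor
    · rintro ⟨b, rfl⟩
      obtain ⟨c, hc⟩ := hr' b
      exact ⟨c, (hsr b c hc.symm).symm⟩
    · rintro ⟨c, rfl⟩
      obtain ⟨b, hb⟩ := hr c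
      exact ⟨b, hsr b c hb⟩

end Subalgebras

section Separability

variable {A : Type*} [NonUnitalRing A] [Module ℂ A] [IsScalarTower ℂ A A] [SMulCommClass ℂ A A]
  {Δ : A →ₙₐ[ℂ] Multiplier (A ⊗[ℂ] A)} {E : Multiplier (A ⊗[ℂ] A)} {ε : A →ₗ[ℂ] ℂ}

namespace IsWeakBialgebraWith

/-- `E(1 ⊗ C) ⊆ E(B ⊗ 1)`. -/
theorem exists_source_of_target (h : IsWeakBialgebraWith Δ E ε) (c : h.targetAlg) :
    ∃ b : h.sourceAlg, E * mtmul (b : Multiplier A) 1 = E * mtmul 1 (c : Multiplier A) := by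
  obtain ⟨_, ⟨a, rfl⟩⟩ := c
  exact ⟨⟨_, h.source'_mem a⟩, (h.mul_mtmul_target a).symm⟩

/-- `E(B ⊗ 1) ⊆ E(1 ⊗ C)`. -/
theorem exists_target_of_source (h : IsWeakBialgebraWith Δ E ε) (b : h.sourceAlg) :
    ∃ c : h.targetAlg, E * mtmul 1 (c : Multiplier A) = E * mtmul (b : Multiplier A) 1 := by
  obtain ⟨_, ⟨a, rfl⟩⟩ := b
  obtain ⟨a', ha'⟩ := h.source_mem_range' a
  exact ⟨⟨_, h.target_mem a'⟩, by rw [h.mul_mtmul_target, ha']⟩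

/-- `(B ⊗ 1)E ⊆ (1 ⊗ C)E`. -/
theorem exists_target_of_source' (h : IsWeakBialgebraWith Δ E ε) (b : h.sourceAlg) :
    ∃ c : h.targetAlg, mtmul 1 (c : Multiplier A) * E = mtmul (b : Multiplier A) 1 * E := by
  obtain ⟨_, ⟨a, rfl⟩⟩ := b
  exact ⟨⟨_, h.target'_mem a⟩, (h.mtmul_source_mul a).symm⟩

/-- `(1 ⊗ C)E ⊆ (B ⊗ 1)E`. -/
theorem exists_source_of_target' (h : IsWeakBialgebraWith Δ E ε) (c : h.targetAlg) :
    ∃ b : h.sourceAlg, mtmul (b : Multiplier A) 1 * E = mtmul 1 (c : Multiplier A) * E := by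
  obtain ⟨_, ⟨a, rfl⟩⟩ := c
  obtain ⟨a', ha'⟩ := h.target_mem_range' a
  exact ⟨⟨_, h.source_mem a'⟩, by rw [h.mtmul_source_mul, ha']⟩

/-- `E(1 ⊗ c) ∈ B ⊗ C` for `c ∈ C`. -/
theorem exists_mul_target (h : IsWeakBialgebraWith Δ E ε) (c : h.targetAlg) :
    ∃ t, inclTensor h.sourceAlg h.targetAlg t = E * mtmul 1 (c : Multiplier A) := by
  obtain ⟨_, ⟨a, rfl⟩⟩ := c
  refine h.mem_of_mul (LinearMap.mulLeft ℂ E ∘ₗ mtmulBilin 1 ∘ₗ h.target)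
    (LinearMap.range (inclTensor h.sourceAlg h.targetAlg)) (fun x y => ?_) a
  refine ⟨TensorProduct.map
    (h.source'.codRestrict h.sourceAlg.toSubmodule h.source'_mem)
    (h.target.codRestrict h.targetAlg.toSubmodule h.target_mem)
    (h.coproduct.dr₂ h.nondeg y x), ?_⟩
  refine Eq.trans ?_ (h.mul_mtmul_target_eq x y).symm
  rw [inclTensor_eq, ← LinearMap.comp_apply (TensorProduct.map _ _), ← TensorProduct.map_comp]
  rfl

/-- `(b ⊗ 1)E ∈ B ⊗ C` for `b ∈ B`. -/
theorem exists_source_mul (h : IsWeakBialgebraWith Δ E ε) (b : h.sourceAlg) :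
    ∃ t, inclTensor h.sourceAlg h.targetAlg t = mtmul (b : Multiplier A) 1 * E := by
  obtain ⟨_, ⟨a, rfl⟩⟩ := b
  refine h.mem_of_mul (LinearMap.mulRight ℂ E ∘ₗ mtmulBilin.flip 1 ∘ₗ h.source)
    (LinearMap.range (inclTensor h.sourceAlg h.targetAlg)) (fun x y => ?_) a
  refine ⟨TensorProduct.map
    (h.source.codRestrict h.sourceAlg.toSubmodule h.source_mem)
    (h.target'.codRestrict h.targetAlg.toSubmodule h.target'_mem)
    (h.coproduct.dl₁ h.nondeg x y), ?_⟩
  refine Eq.trans ?_ (h.mtmul_source_mul_eq y x).symm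
  rw [inclTensor_eq, ← LinearMap.comp_apply (TensorProduct.map _ _), ← TensorProduct.map_comp]
  rfl

/-- `E` is a multiplier of `B ⊗ C`. -/
theorem exists_isImageOf (h : IsWeakBialgebraWith Δ E ε) :
    ∃ F : Multiplier (h.sourceAlg ⊗[ℂ] h.targetAlg),
      IsImageOf h.sourceAlg h.targetAlg E F := by
  refine WMB.exists_isImageOf h.nondeg
    (h.isNondegSubalgebra_sourceAlg.isNondegenerate h.nondeg)
    (h.isNondegSubalgebra_targetAlg.isNondegenerate h.nondeg) E (fun x => ?_) (fun x => ?_)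
  · induction x using TensorProduct.induction_on with
    | zero => exact ⟨0, by simp⟩
    | add u v hu hv =>
      obtain ⟨s, hs⟩ := hu
      obtain ⟨t, ht⟩ := hv
      exact ⟨s + t, by rw [map_add, map_add, mul_add, hs, ht]⟩
    | tmul b c =>
      obtain ⟨t, ht⟩ := h.exists_mul_target c
      refine ⟨ract (mtmul (embed b) 1) t, ?_⟩
      rw [← (isImageOf_mtmul_left b).2, ht, mul_assoc, mtmul_mul_mtmul, one_mul, mul_one,
        inclTensor_tmul]
  · induction x using TensorProduct.induction_on with
    | zero => exact ⟨0, by simp⟩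
    | add u v hu hv =>
      obtain ⟨s, hs⟩ := hu
      obtain ⟨t, ht⟩ := hv
      exact ⟨s + t, by rw [map_add, map_add, add_mul, hs, ht]⟩
    | tmul b c =>
      obtain ⟨t, ht⟩ := h.exists_source_mul b
      refine ⟨lact (mtmul 1 (embed c)) t, ?_⟩
      rw [← (isImageOf_mtmul_right c).1, ht, ← mul_assoc, mtmul_mul_mtmul, one_mul, mul_one,
        inclTensor_tmul]

/-- The left leg of `E(1 ⊗ C)` is all of `B`: since `CA = A`, a subspace `V` containing it also
contains the first legs of `E(1 ⊗ A)`. -/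
theorem sourceAlg_le_of_mul (h : IsWeakBialgebraWith Δ E ε) (V : Submodule ℂ (Multiplier A))
    (hV : ∀ c : h.targetAlg, E * mtmul 1 (c : Multiplier A) ∈ legLeft V) (b : h.sourceAlg) :
    (b : Multiplier A) ∈ V := by
  obtain ⟨_, ⟨a, rfl⟩⟩ := b
  refine (h.range_source_le _ (fun c x => ?_) a).1
  rw [mul_assoc]
  refine mul_mem_legLeft ?_ _
  refine h.isNondegSubalgebra_targetAlg.mem_of_lact
    (LinearMap.mulLeft ℂ E ∘ₗ mtmulBilin 1 ∘ₗ embedLin) _ (fun c hc y => ?_) x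
  have := mem_legLeft_mul (hV ⟨c, hc⟩) (embed y)
  rw [mul_assoc, mtmul_mul_mtmul, mul_one, mul_embed] at this
  exact this

/-- The left leg of `(1 ⊗ C)E` is all of `B`. -/
theorem sourceAlg_le_of_mul' (h : IsWeakBialgebraWith Δ E ε) (V : Submodule ℂ (Multiplier A))
    (hV : ∀ c : h.targetAlg, mtmul 1 (c : Multiplier A) * E ∈ legLeft V) (b : h.sourceAlg) :
    (b : Multiplier A) ∈ V := by
  obtain ⟨_, ⟨a, rfl⟩⟩ := b
  refine (h.range_source_le _ (fun x c => ?_) a).1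
  refine mem_legLeft_mul ?_ _
  refine h.isNondegSubalgebra_targetAlg.mem_of_ract
    (LinearMap.mulRight ℂ E ∘ₗ mtmulBilin 1 ∘ₗ embedLin) _ (fun c hc y => ?_) x
  have := mul_mem_legLeft (hV ⟨c, hc⟩) (embed y)
  rw [← mul_assoc, mtmul_mul_mtmul, mul_one, embed_mul_multiplier] at this
  exact this

/-- The right leg of `E(B ⊗ 1)` is all of `C`. -/
theorem targetAlg_le_of_mul (h : IsWeakBialgebraWith Δ E ε) (W : Submodule ℂ (Multiplier A))
    (hW : ∀ b : h.sourceAlg, E * mtmul (b : Multiplier A) 1 ∈ legRight W) (c : h.targetAlg) :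
    (c : Multiplier A) ∈ W := by
  obtain ⟨_, ⟨a, rfl⟩⟩ := c
  refine (h.range_target_le _ (fun c x => ?_) a).1
  rw [mul_assoc]
  refine mul_mem_legRight ?_ _
  refine h.isNondegSubalgebra_sourceAlg.mem_of_lact
    (LinearMap.mulLeft ℂ E ∘ₗ mtmulBilin.flip 1 ∘ₗ embedLin) _ (fun b hb y => ?_) x
  have := mem_legRight_mul (hW ⟨b, hb⟩) (embed y)
  rw [mul_assoc, mtmul_mul_mtmul, mul_one, mul_embed] at this
  exact this

/-- The right leg of `(B ⊗ 1)E` is all of `C`. -/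
theorem targetAlg_le_of_mul' (h : IsWeakBialgebraWith Δ E ε) (W : Submodule ℂ (Multiplier A))
    (hW : ∀ b : h.sourceAlg, mtmul (b : Multiplier A) 1 * E ∈ legRight W) (c : h.targetAlg) :
    (c : Multiplier A) ∈ W := by
  obtain ⟨_, ⟨a, rfl⟩⟩ := c
  refine (h.range_target_le _ (fun x c => ?_) a).1
  refine mem_legRight_mul ?_ _
  refine h.isNondegSubalgebra_sourceAlg.mem_of_ract
    (LinearMap.mulRight ℂ E ∘ₗ mtmulBilin.flip 1 ∘ₗ embedLin) _ (fun b hb y => ?_) x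
  have := mul_mem_legRight (hW ⟨b, hb⟩) (embed y)
  rw [← mul_assoc, mtmul_mul_mtmul, mul_one, embed_mul_multiplier] at this
  exact this

theorem isRegularSeparabilityIdempotentIn (h : IsWeakBialgebraWith Δ E ε) :
    IsRegularSeparabilityIdempotentIn h.sourceAlg h.targetAlg E where
  nondeg_left := h.isNondegSubalgebra_sourceAlg
  nondeg_right := h.isNondegSubalgebra_targetAlg
  separability := by
    obtain ⟨F, hF⟩ := h.exists_isImageOf
    exact ⟨F, hF, hF.isRegularSeparabilityIdempotent h.nondeg h.isNondegSubalgebra_sourceAlg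
      h.isNondegSubalgebra_targetAlg h.isIdempotentAlg_sourceAlg h.isIdempotentAlg_targetAlg
      h.canonical.idem h.exists_mul_target h.exists_source_mul h.exists_source_of_target
      h.exists_target_of_source h.exists_source_of_target' h.exists_target_of_source'
      h.sourceAlg_le_of_mul h.sourceAlg_le_of_mul' h.targetAlg_le_of_mul h.targetAlg_le_of_mul'⟩

end IsWeakBialgebraWith

/-- The canonical idempotent and the counit of a weak multiplier bialgebra are unique, so that the
axioms stated for some such `E` and `ε` hold for all of them. -/
theorem IsWeakMultiplierBialgebra.isWeakBialgebraWith (hΔ : IsWeakMultiplierBialgebra Δ)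
    (hE : IsCanonicalIdempotent Δ E) (hε : IsCounit Δ ε) : IsWeakBialgebraWith Δ E ε := by
  obtain ⟨E', hE', hc⟩ := hΔ.canonical
  obtain ⟨ε', hε', hm⟩ := hΔ.counit
  obtain rfl := hE.unique hE' hΔ.nondegenerate
  obtain rfl := hε.unique hΔ.nondegenerate hΔ.coproduct hΔ.full hε'
  exact ⟨hΔ.nondegenerate, hΔ.idempotent, hΔ.coproduct, hΔ.full, hE, hc, hε, hm⟩

end Separability

end WMB

open WMB in
theorem proposition2p3 {A : Type*} [NonUnitalRing A] [Module ℂ A] [IsScalarTower ℂ A A]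
    [SMulCommClass ℂ A A] (Δ : A →ₙₐ[ℂ] Multiplier (A ⊗[ℂ] A))
    (hΔ : IsWeakMultiplierBialgebra Δ)
    (E : Multiplier (A ⊗[ℂ] A)) (hE : IsCanonicalIdempotent Δ E)
    (ε : A →ₗ[ℂ] ℂ) (hε : IsCounit Δ ε) :
    ∃ (εs εt : A →ₗ[ℂ] Multiplier A) (B C : NonUnitalSubalgebra ℂ (Multiplier A)),
      IsSourceMap E ε εs ∧ IsTargetMap E ε εt ∧
      B.toSubmodule = LinearMap.range εs ∧ C.toSubmodule = LinearMap.range εt ∧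
      IsRegularSeparabilityIdempotentIn B C E ∧
      IsSeparableFramework Δ E B C := by
  have h : IsWeakBialgebraWith Δ E ε := hΔ.isWeakBialgebraWith hE hε
  exact ⟨h.source, h.target, h.sourceAlg, h.targetAlg, h.ract_source, h.lact_target, rfl, rfl,
    h.isRegularSeparabilityIdempotentIn, h.nondeg, h.idem, h.coproduct, h.full, h.canonical,
    h.comult, h.isRegularSeparabilityIdempotentIn⟩
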